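/- **Setting.** For $n=2j\in\mathbb N$ let $J_1,J_2,J_3$ be the angular momentum matrices of the spin-$j$ representation of $SU(2)$ on $\mathbb C^{n+1}$ in the standard basis, $J_\pm=J_1\pm iJ_2$. The rotation $g=\exp(v\cdot L)\in SO(3)$, $v\in\mathbb R^3$, where $L_1,L_2,L_3$ are the standard infinitesimal rotations, acts on operators by $P^g=e^{-iv\cdot J}Pe^{iv\cdot J}$ and on functions on $S^2$ by $f^g(\mathbf n)=f(g^{-1}\mathbf n)$. A *symbol correspondence* is an injective linear map $P\mapsto W_P$ from $M_{\mathbb C}(n+1)$ to smooth functions $S^2\to\mathbb C$ with $W_{P^g}=(W_P)^g$ for all $g\in SO(3)$, $W_{P^*}=\overline{W_P}$ and $\frac1{4\pi}\int_{S^2}W_P\,dS=\frac1{n+1}\operatorname{tr}P$. Its twisted product is defined on symbols by $W_P\star W_Q=W_{PQ}$. Put $\beta_{l,m}=\sqrt{(l+m)(l-m+1)}$. For $-l\le m\le l$ let $\mathbf e^j(l,l)=(-1)^lJ_+^l/\|J_+^l\|$ (Hilbert–Schmidt norm, $l\le n$), $\mathbf e^j(l,m-1)=[J_-,\mathbf e^j(l,m)]/\beta_{l,m}$,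 and let the spherical harmonics be $Y_l^l=(-1)^l\frac{\sqrt{(2l+1)!}}{l!\,2^l}(x+iy)^l$, $Y_l^{m-1}=J_-(Y_l^m)/\beta_{l,m}$, where here $J_-$ is the derivation with $J_-x=-z$, $J_-y=iz$, $J_-z=x-iy$. The correspondence $W$ has *characteristic numbers* $c_1,\dots,c_n\in\mathbb R\setminus\{0\}$ if $W_P(g\mathbf n_0)=\operatorname{tr}(PK^g)$ for all $P$ and all $g\in SO(3)$, where $\mathbf n_0=(0,0,1)$ and $K=\frac1{n+1}I+\sum_{l=1}^n c_l\sqrt{\tfrac{2l+1}{n+1}}\,\mathbf e^j(l,0)$. Given $\mathcal C:\{(n,l)\in\mathbb N^2: n\ge l>0\}\to\mathbb R\setminus\{0\}$, let $\mathbf W_{\mathcal C}$ be the sequence, indexed by $n\in\mathbb N$, of symbol correspondences with characteristic numbers $c^n_l=\mathcal C(n,l)$ (and $c_0^n=1$), with twisted products $\star^n$. Let $\{\cdot,\cdot\}$ be the Poisson bracket of the area form of $S^2$, so that $\{x,y\}=z$ and cyclically. The sequence is of *Poisson type* if, for all $l_1,l_2\in\mathbb N$, $|m_1|\le l_1$,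 $|m_2|\le l_2$, with $f=Y_{l_1}^{m_1}$, $g=Y_{l_2}^{m_2}$, uniformly on $S^2$ as $n\to\infty$: (i) $f\star^n g-g\star^n f\to0$; (ii) $f\star^n g+g\star^n f\to2fg$; (iii) $n(f\star^n g-g\star^n f)\to2i\{f,g\}$. It is of *anti-Poisson type* if (i), (ii) hold and (iii) holds with limit $-2i\{f,g\}$. It is of *pure-Poisson* (*pure-anti-Poisson*) type if it is of Poisson (anti-Poisson) type and moreover (iv) $n(f\star^n g+g\star^n f-2fg)\to0$ uniformly on $S^2$ for all such $f,g$. **Theorem.** For every $\mathcal C$: 1. $\mathbf W_{\mathcal C}$ is of Poisson type if and only if $\lim_{n\to\infty}c_l^n=1$ for all $l\in\mathbb N$. 2. $\mathbf W_{\mathcal C}$ is of anti-Poisson type if and only if $\lim_{n\to\infty}c_l^n=(-1)^l$ for all $l\in\mathbb N$. 3. $\mathbf W_{\mathcal C}$ is of pure-Poisson type (resp. pure-anti-Poisson type) if and only if $\lim_{n\to\infty}n\,(c_l^n-f(l))=0$ for all $l\in\mathbb N$, where $f(l)=1$ (resp. $f(l)=(-1)^l$). Consequently, generic sequences are neither of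 Poisson nor of anti-Poisson type: the set of $\mathcal C$ for which $\mathbf W_{\mathcal C}$ is of neither type is residual (its complement is meagre) in $(\mathbb R\setminus\{0\})^{\{n\ge l>0\}}$ with the product topology; the same holds within the Stratonovich–Weyl sequences, $c_l^n=\pm1$, in $\{\pm1\}^{\{n\ge l>0\}}$; and if the signs $c_l^n$, $n\ge l>0$, are independent and uniformly distributed on $\{\pm1\}$, then $\mathbf W_{\mathcal C}$ is almost surely of neither type. -/

import Mathlib

open MeasureTheory Filter Topology
open scoped Matrix Manifold ContDiff

noncomputable section

namespace SpinSymbol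

/-! ### The spin-`j` system, `n = 2j`, in the standard basis `|j,j⟩, |j,j-1⟩, …, |j,-j⟩` -/

/-- Operators on the spin-`j` Hilbert space `ℂ^(n+1)`, `n = 2j`. -/
abbrev Op (n : ℕ) : Type := Matrix (Fin (n + 1)) (Fin (n + 1)) ℂ

/-- The raising operator `J₊`. -/
def Jplus (n : ℕ) : Op n :=
  Matrix.of fun i k => if (i : ℕ) + 1 = k then ((√((k : ℝ) * ((n : ℝ) + 1 - k)) : ℝ) : ℂ) else 0

/-- The lowering operator `J₋`, the adjoint of `J₊`. -/
def Jminus (n : ℕ) : Op n := (Jplus n)ᴴ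

/-- The angular momentum operators `J₁, J₂, J₃`. -/
def J (n : ℕ) : Fin 3 → Op n :=
  ![(1 / 2 : ℂ) • (Jplus n + Jminus n),
    (1 / (2 * Complex.I)) • (Jplus n - Jminus n),
    Matrix.diagonal fun i => (n : ℂ) / 2 - ((i : ℕ) : ℂ)]

/-- The unitary operator `exp (-i v·J)` representing the spinor rotation
`exp (-(i/2) v·σ) ∈ SU(2)`. Every element of `SU(2)` is of that form. -/
def spinRot (n : ℕ) (v : Fin 3 → ℝ) : Op n :=
  NormedSpace.exp ((-Complex.I) • ∑ k, (v k : ℂ) • J n k)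

/-- The infinitesimal rotations `L₁, L₂, L₃`, a basis of the Lie algebra of `SO(3)`. -/
def L : Fin 3 → Matrix (Fin 3) (Fin 3) ℝ :=
  ![!![0, 0, 0; 0, 0, -1; 0, 1, 0],
    !![0, 0, 1; 0, 0, 0; -1, 0, 0],
    !![0, -1, 0; 1, 0, 0; 0, 0, 0]]

/-- The rotation `exp (v·L) ∈ SO(3)`, by the angle `|v|` around the axis `v`; the image of
`exp (-(i/2) v·σ)` under the covering `SU(2) → SO(3)`. Every rotation is of that form. -/
def rot (v : Fin 3 → ℝ) : Matrix (Fin 3) (Fin 3) ℝ :=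
  NormedSpace.exp (∑ k, v k • L k)

/-- The conjugate `P^g = φ_j(g) P φ_j(g)⁻¹`, where `g` is the rotation `exp (v·L)`. -/
def conjOp {n : ℕ} (v : Fin 3 → ℝ) (P : Op n) : Op n :=
  spinRot n v * P * spinRot n (-v)

/-- The coefficient `β_{l,m} = √((l+m)(l-m+1))` of the lowering operators. -/
def beta (l : ℕ) (m : ℤ) : ℝ := √(((l : ℝ) + m) * ((l : ℝ) - m + 1))

/-- The matrices `e^j(l, l-k)`: `e^j(l,l) = (-1)^l J₊^l / ‖J₊^l‖` for the Hilbert-Schmidt norm,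
`e^j(l,m-1) = [J₋, e^j(l,m)] / β_{l,m}`. -/
def coupledAux (n l : ℕ) : ℕ → Op n
  | 0 => (((-1) ^ l / √(Complex.re (Matrix.trace (Jminus n ^ l * Jplus n ^ l))) : ℝ) : ℂ) •
      Jplus n ^ l
  | k + 1 => ((1 / beta l ((l : ℤ) - k) : ℝ) : ℂ) •
      (Jminus n * coupledAux n l k - coupledAux n l k * Jminus n)

/-- The coupled standard basis `e^j(l,m)`, `-l ≤ m ≤ l ≤ n`, of the operator space. -/
def coupled (n l : ℕ) (m : ℤ) : Op n := coupledAux n l ((l : ℤ) - m).toNat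

/-! ### The sphere, its Poisson bracket, and spherical harmonics -/

/-- Euclidean 3-space. -/
abbrev E3 : Type := EuclideanSpace ℝ (Fin 3)

/-- The unit sphere. -/
abbrev S2 : Type := Metric.sphere (0 : E3) 1

instance : Fact (Module.finrank ℝ E3 = 2 + 1) := ⟨by simp⟩

/-- The north pole `(0,0,1)`. -/
def northPole : S2 := ⟨!₂[0, 0, 1], by simp [EuclideanSpace.norm_eq, Fin.sum_univ_three]⟩

/-- The radial projection of `E3 \ {0}` onto the sphere (with a dummy value at `0`). -/
def radialProj (x : E3) : S2 :=
  if h : x = 0 then northPole else ⟨‖x‖⁻¹ • x, by simp [norm_smul, h]⟩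

/-- The `k`-th component of the gradient of `f` at `p ∈ S²`, a tangent vector of the sphere:
the partial derivative of the extension of `f` that is constant on rays. -/
def grad (f : S2 → ℂ) (p : S2) (k : Fin 3) : ℂ :=
  fderiv ℝ (fun x : E3 => f (radialProj x)) (p : E3) (EuclideanSpace.single k 1)

/-- The Poisson bracket of the area form `ω = x dy∧dz + y dz∧dx + z dx∧dy` of the sphere:
the Hamiltonian field of `f`, with `ω(X_f, ·) + df = 0`, is `X_f(p) = p × ∇f(p)`, and
`{f, g}(p) = X_f(g)(p) = p · (∇f(p) × ∇g(p))`. -/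
def poisson (f g : S2 → ℂ) (p : S2) : ℂ :=
  (fun k => ((p : E3) k : ℂ)) ⬝ᵥ (crossProduct (grad f p) (grad g p))

/-- The lowering operator `J₋ = J₁ - i J₂` on polynomials in `x, y, z`, where `J_k = i L_k` acts as
a derivation: `J₋ x = -z`, `J₋ y = i z`, `J₋ z = x - i y`. -/
def lowering : Derivation ℂ (MvPolynomial (Fin 3) ℂ) (MvPolynomial (Fin 3) ℂ) :=
  MvPolynomial.mkDerivation ℂ
    ![-MvPolynomial.X 2, Complex.I • MvPolynomial.X 2,
      MvPolynomial.X 0 - Complex.I • MvPolynomial.X 1]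

/-- The polynomials `Y_{l, l-k}`: `Y_{l,l} = (-1)^l (x+iy)^l / λ_l` with
`λ_l = ‖(x+iy)^l‖ = l! 2^l / √((2l+1)!)` for the normalized `L²` norm of the sphere,
`Y_{l,m-1} = J₋ Y_{l,m} / β_{l,m}`. -/
def harmonicAux (l : ℕ) : ℕ → MvPolynomial (Fin 3) ℂ
  | 0 => (((-1) ^ l / ((l.factorial : ℝ) * 2 ^ l / √((2 * l + 1).factorial : ℝ)) : ℝ) : ℂ) •
      (MvPolynomial.X 0 + Complex.I • MvPolynomial.X 1) ^ l
  | k + 1 => ((1 / beta l ((l : ℤ) - k) : ℝ) : ℂ) • lowering (harmonicAux l k)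

/-- The spherical harmonic `Y_l^m`, `-l ≤ m ≤ l`, as a function on the sphere. -/
def Y (l : ℕ) (m : ℤ) (p : S2) : ℂ :=
  MvPolynomial.eval (fun k => ((p : E3) k : ℂ)) (harmonicAux l ((l : ℤ) - m).toNat)

/-! ### Symbol correspondences and twisted products -/

/-- A symbol correspondence for the spin-`j` system, `n = 2j`. -/
structure SymbolCorrespondence (n : ℕ) where
  /-- the symbol map `P ↦ W_P` -/
  symbol : Op n →ₗ[ℂ] (S2 → ℂ)
  smooth : ∀ P, ContMDiff (𝓡 2) 𝓘(ℝ, ℂ) ∞ (symbol P)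
  injective : Function.Injective symbol
  /-- `W_{P^g}(g x) = W_P(x)` for every rotation `g` -/
  equivariant : ∀ (P : Op n) (v : Fin 3 → ℝ) (x y : S2),
    (y : E3).ofLp = rot v *ᵥ (x : E3).ofLp → symbol (conjOp v P) y = symbol P x
  real : ∀ (P : Op n) (x : S2), symbol Pᴴ x = starRingEnd ℂ (symbol P x)
  /-- the normalized integral over the sphere of the symbol is the normalized trace -/
  normalized : ∀ P : Op n,
    (1 / (4 * (Real.pi : ℂ))) * ∫ x, symbol P x ∂(volume : Measure E3).toSphere =
      (1 / ((n : ℂ) + 1)) * P.trace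

/-- The operator kernel `K = I/(n+1) + ∑_{l=1}^n c_l √((2l+1)/(n+1)) e^j(l,0)`. -/
def kernel (n : ℕ) (c : ℕ → ℝ) : Op n :=
  (1 / ((n : ℂ) + 1)) • (1 : Op n) +
    ∑ l ∈ Finset.Icc 1 n, ((c l * √((2 * (l : ℝ) + 1) / ((n : ℝ) + 1)) : ℝ) : ℂ) • coupled n l 0

/-- `W` has the characteristic numbers `c_1, …, c_n`: for the operator kernel `K` that they define,
`W_P(g n₀) = trace (P K^g)` for all operators `P` and rotations `g`, with `n₀` the north pole. -/
def SymbolCorrespondence.HasCharacteristicNumbers {n : ℕ} (W : SymbolCorrespondence n)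
    (c : ℕ → ℝ) : Prop :=
  ∀ (P : Op n) (v : Fin 3 → ℝ) (x : S2), (x : E3).ofLp = rot v *ᵥ (northPole : E3).ofLp →
    W.symbol P x = (P * conjOp v (kernel n c)).trace

/-- The twisted product of symbols, `W_P ⋆ W_Q = W_{PQ}` (a dummy value is taken at functions that
are not symbols of an operator). -/
def SymbolCorrespondence.star {n : ℕ} (W : SymbolCorrespondence n) (f g : S2 → ℂ) : S2 → ℂ :=
  W.symbol (Function.invFun W.symbol f * Function.invFun W.symbol g)

/-! ### Sequences of symbol correspondences -/

/-- The index set `Δ⁺(ℕ²) = {(n,l) | n ≥ l > 0}`. -/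
abbrev DeltaPlus : Type := {q : ℕ × ℕ // 0 < q.2 ∧ q.2 ≤ q.1}

/-- The numbers `c_l^n`: `c_l^n = C(n,l)` for `n ≥ l > 0`, and `c_0^n = 1`
(with a dummy value for `l > n`). -/
def charNum (C : DeltaPlus → ℝˣ) (n l : ℕ) : ℝ :=
  if h : 0 < l ∧ l ≤ n then ((C ⟨(n, l), h⟩ : ℝˣ) : ℝ) else 1

/-- `W` is the symbol correspondence sequence `W_C` with characteristic numbers `C`. -/
def IsSequenceOf (W : ∀ n, SymbolCorrespondence n) (C : DeltaPlus → ℝˣ) : Prop :=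
  ∀ n, (W n).HasCharacteristicNumbers (charNum C n)

/-- Properties (i) and (ii), and the property that `n` times the twisted commutator of `Y_{l₁}^{m₁}`
and `Y_{l₂}^{m₂}` tends to `2 i s {Y_{l₁}^{m₁}, Y_{l₂}^{m₂}}`; all limits are uniform on the
sphere. -/
structure IsPoissonTypeWithSign (s : ℂ) (W : ∀ n, SymbolCorrespondence n) : Prop where
  commutator : ∀ (l₁ l₂ : ℕ) (m₁ m₂ : ℤ), |m₁| ≤ l₁ → |m₂| ≤ l₂ →
    TendstoUniformly
      (fun n p => (W n).star (Y l₁ m₁) (Y l₂ m₂) p - (W n).star (Y l₂ m₂) (Y l₁ m₁) p)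
      (fun _ => 0) atTop
  anticommutator : ∀ (l₁ l₂ : ℕ) (m₁ m₂ : ℤ), |m₁| ≤ l₁ → |m₂| ≤ l₂ →
    TendstoUniformly
      (fun n p => (W n).star (Y l₁ m₁) (Y l₂ m₂) p + (W n).star (Y l₂ m₂) (Y l₁ m₁) p)
      (fun p => 2 * Y l₁ m₁ p * Y l₂ m₂ p) atTop
  bracket : ∀ (l₁ l₂ : ℕ) (m₁ m₂ : ℤ), |m₁| ≤ l₁ → |m₂| ≤ l₂ →
    TendstoUniformly
      (fun (n : ℕ) p => (n : ℂ) *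
        ((W n).star (Y l₁ m₁) (Y l₂ m₂) p - (W n).star (Y l₂ m₂) (Y l₁ m₁) p))
      (fun p => s * (2 * Complex.I * poisson (Y l₁ m₁) (Y l₂ m₂) p)) atTop

/-- Poisson type. -/
def IsPoissonType (W : ∀ n, SymbolCorrespondence n) : Prop := IsPoissonTypeWithSign 1 W

/-- Anti-Poisson type. -/
def IsAntiPoissonType (W : ∀ n, SymbolCorrespondence n) : Prop := IsPoissonTypeWithSign (-1) W

/-- Property (iv): `n (f ⋆ g + g ⋆ f - 2 f g) → 0` uniformly for spherical harmonics `f`, `g`. -/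
def IsPure (W : ∀ n, SymbolCorrespondence n) : Prop :=
  ∀ (l₁ l₂ : ℕ) (m₁ m₂ : ℤ), |m₁| ≤ l₁ → |m₂| ≤ l₂ →
    TendstoUniformly
      (fun (n : ℕ) p => (n : ℂ) *
        ((W n).star (Y l₁ m₁) (Y l₂ m₂) p + (W n).star (Y l₂ m₂) (Y l₁ m₁) p
          - 2 * Y l₁ m₁ p * Y l₂ m₂ p))
      (fun _ => 0) atTop

/-- Pure-Poisson type. -/
def IsPurePoissonType (W : ∀ n, SymbolCorrespondence n) : Prop := IsPoissonType W ∧ IsPure W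

/-- Pure-anti-Poisson type. -/
def IsPureAntiPoissonType (W : ∀ n, SymbolCorrespondence n) : Prop :=
  IsAntiPoissonType W ∧ IsPure W

/-- Signs as nonzero real numbers. A sequence of symbol correspondences is of Stratonovich-Weyl type
when its characteristic numbers are signs. -/
def ofSigns (ε : DeltaPlus → ℤˣ) : DeltaPlus → ℝˣ :=
  fun q => Units.map (Int.castRingHom ℝ : ℤ →* ℝ) (ε q)

/-- The law of a family of independent signs, each `1` or `-1` with probability `1/2`. -/
def randomSigns : Measure (DeltaPlus → ℤˣ) :=
  Measure.infinitePi fun _ => (PMF.uniformOfFintype ℤˣ).toMeasure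

end SpinSymbol

end

open SpinSymbol

/-!
By Schur's lemma made explicit, equivariance forces `W` to send `[J₋, ·]^k (2J₊/(n+1))^l` to
`d_l J₋^k (x+iy)^l` with one scale `d_l` for each `l`, and evaluation against the operator kernel
gives `d_l = c_l √(∏_{k=1}^l (1 - k²/(n+1)²))`, so that `c_l` and `d_l` have the same limits, also
after multiplication of their deviations by `n`.

The operators with `d_l = 1` multiply like polynomials on the sphere with the product
`F G + i {F, G}/(n+1) + O(1/(n+1)²)`: by the Leibniz rule for `J₋` this only has to be checked for
products with `2J₊/(n+1)`, where it is a computation with the commutation relations and the Casimir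
identity. A scale `d_l → s^l` with `s = ±1` replaces `F` by `F(s ·)`, which multiplies the bracket
by `s`. Conversely, the symbols of the relations `[J₃, J₊] = J₊` and `J₊ J₊^l = J₊^{l+1}` and of the
Casimir identity at the point `(1, 0, 0)` determine the limits of `d_1` and of
`d_{l+1} / (d_1 d_l)`.

The numbers `c_1^n` generically, and almost surely for random signs, avoid a neighbourhood of `1`
infinitely often, and likewise for `-1`; this is the Baire category theorem and the second
Borel-Cantelli lemma.
-/

noncomputable section

namespace SpinSymbol

open LieAlgebra ProbabilityTheory

attribute [local instance] LieRing.ofAssociativeRing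

/-! ### Spin triples in associative algebras -/

/-- A triple with the commutation relations of `(J₃, J₊, J₋)`: an `sl₂`-triple with `h` rescaled by
`2`, except that `h = 0` is allowed, as needed for spin `0`. -/
structure IsSpinTriple {R : Type*} [LieRing R] (h e f : R) : Prop where
  lie_h_e : ⁅h, e⁆ = e
  lie_h_f : ⁅h, f⁆ = -f
  lie_e_f : ⁅e, f⁆ = 2 • h

section SpinTriple

variable {𝕜 R : Type*} [Field 𝕜] [Ring R] [Algebra 𝕜 R]

theorem ad_mul (f x y : R) : ad 𝕜 R f (x * y) = ad 𝕜 R f x * y + x * ad 𝕜 R f y := by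
  simp only [ad_apply, LieRing.of_associative_ring_bracket]
  noncomm_ring

theorem iterate_leibniz_of_apply_three_eq_zero [CharZero 𝕜] {D : R →ₗ[𝕜] R}
    (hD : ∀ x y, D (x * y) = D x * y + x * D y) {u : R} (hu : D (D (D u)) = 0) (w : R) (k : ℕ) :
    D^[k + 2] (u * w) = u * D^[k + 2] w + ((k : 𝕜) + 2) • (D u * D^[k + 1] w) +
      (((k : 𝕜) + 2) * (k + 1) / 2) • (D (D u) * D^[k] w) := by
  induction k with
  | zero =>
    simp only [Function.iterate_succ, Function.iterate_zero, Function.comp, id, hD, map_add,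
      zero_add, Nat.cast_zero]
    module
  | succ k ih =>
    rw [Function.iterate_succ_apply', ih]
    simp only [map_add, map_smul, hD, hu, ← Function.iterate_succ_apply' D, zero_mul, zero_add,
      Nat.succ_eq_add_one]
    push_cast
    module

namespace IsSpinTriple

variable {h e f : R} (t : IsSpinTriple h e f)

include t

theorem h_mul_e : h * e = e * h + e :=
  sub_eq_iff_eq_add'.mp t.lie_h_e

theorem h_mul_f : h * f = f * h - f := by
  rw [sub_eq_add_neg]
  exact sub_eq_iff_eq_add'.mp t.lie_h_f

variable (𝕜)

theorem ad_f_e : ad 𝕜 R f e = (-2 : 𝕜) • h := by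
  rw [ad_apply, ← lie_skew, t.lie_e_f]
  module

theorem ad_f_h : ad 𝕜 R f h = f := by
  rw [ad_apply, ← lie_skew, t.lie_h_f, neg_neg]

theorem ad_f_ad_f_e : ad 𝕜 R f (ad 𝕜 R f e) = (-2 : 𝕜) • f := by
  rw [t.ad_f_e 𝕜, map_smul, t.ad_f_h 𝕜]

theorem ad_f_ad_f_ad_f_e : ad 𝕜 R f (ad 𝕜 R f (ad 𝕜 R f e)) = 0 := by
  rw [t.ad_f_ad_f_e 𝕜, map_smul, ad_apply, lie_self,
    smul_zero]

theorem ad_f_e_pow_succ (l : ℕ) :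
    ad 𝕜 R f (e ^ (l + 1)) =
      (-2 * ((l : 𝕜) + 1)) • (h * e ^ l) + ((l : 𝕜) * (l + 1)) • e ^ l := by
  induction l with
  | zero => simp [t.ad_f_e 𝕜]
  | succ l ih =>
    have e_mul : e * (h * e ^ l) = h * e ^ (l + 1) - e ^ (l + 1) := by
      rw [← mul_assoc, eq_sub_of_add_eq t.h_mul_e.symm, sub_mul, mul_assoc, ← pow_succ']
    rw [pow_succ' e (l + 1), ad_mul, ih, t.ad_f_e 𝕜]
    simp only [mul_add, mul_smul_comm, smul_mul_assoc, e_mul, ← pow_succ']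
    push_cast
    module

variable [CharZero 𝕜]

/- The term in `e ^ (l - 1)` has coefficient `0` when `l = 0`. -/
theorem f_mul_e_pow {C : 𝕜} (casimir : f * e + h * h + h = C • (1 : R)) (l : ℕ) :
    f * e ^ l = (-1 / ((4 * (l : 𝕜) + 2) * (l + 1))) • ad 𝕜 R f (ad 𝕜 R f (e ^ (l + 1))) +
      (1 / 2 : 𝕜) • ad 𝕜 R f (e ^ l) +
      ((l : 𝕜) * (4 * C + 1 - (l : 𝕜) ^ 2) / (4 * l + 2)) • e ^ (l - 1) := by
  have hl : (l : 𝕜) + 1 ≠ 0 := Nat.cast_add_one_ne_zero l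
  have hl' : 4 * (l : 𝕜) + 2 ≠ 0 := mod_cast (by positivity : 4 * l + 2 ≠ 0)
  cases l with
  | zero =>
    rw [zero_add, pow_one, t.ad_f_ad_f_e 𝕜, pow_zero, ad_apply,
      LieRing.of_associative_ring_bracket, Nat.cast_zero]
    simp only [mul_one, one_mul, sub_self]
    module
  | succ l =>
    have h_mul_h_mul : h * (h * e ^ l) = C • e ^ l - f * e ^ (l + 1) - h * e ^ l := by
      have := congrArg (· * e ^ l) casimir
      simp only [add_mul, smul_mul_assoc, one_mul, mul_assoc, ← pow_succ'] at this
      rw [← this]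
      abel
    rw [t.ad_f_e_pow_succ 𝕜 (l + 1)]
    simp only [map_add, map_smul, ad_mul, t.ad_f_h 𝕜, t.ad_f_e_pow_succ 𝕜 l, mul_add, mul_smul_comm,
      Nat.add_sub_cancel, h_mul_h_mul]
    push_cast at hl hl' ⊢
    match_scalars <;> field_simp <;> ring

theorem ad_f_iterate_e_pow (l : ℕ) :
    (ad 𝕜 R f)^[2 * l] (e ^ l) = (((2 * l).factorial : 𝕜) * (-1) ^ l) • f ^ l ∧
      (ad 𝕜 R f)^[2 * l + 1] (e ^ l) = 0 := by
  induction l with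
  | zero => simp [LieRing.of_associative_ring_bracket]
  | succ l ih =>
    have leibniz := iterate_leibniz_of_apply_three_eq_zero (ad_mul (𝕜 := 𝕜) f)
      (t.ad_f_ad_f_ad_f_e 𝕜) (e ^ l)
    have iterate_two : (ad 𝕜 R f)^[2 * l + 2] (e ^ l) = 0 := by
      rw [Function.iterate_succ_apply', ih.2, map_zero]
    have iterate_three : (ad 𝕜 R f)^[2 * l + 3] (e ^ l) = 0 := by
      rw [Function.iterate_succ_apply', iterate_two, map_zero]
    constructor
    · rw [pow_succ', mul_add_one, leibniz, iterate_two, ih.1, ih.2, t.ad_f_ad_f_e 𝕜]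
      simp only [mul_zero, smul_zero, zero_add, smul_mul_smul_comm, ← pow_succ', smul_smul]
      congr 1
      rw [Nat.factorial_succ, Nat.factorial_succ]
      push_cast
      ring
    · have leibniz_succ := leibniz (2 * l + 1)
      rw [iterate_two, iterate_three, ih.2] at leibniz_succ
      simpa only [pow_succ', mul_add_one, add_assoc, mul_zero, smul_zero, add_zero]
        using leibniz_succ

theorem ad_f_iterate_e_pow_eq_zero {l k : ℕ} (hk : 2 * l < k) : (ad 𝕜 R f)^[k] (e ^ l) = 0 := by
  obtain ⟨r, rfl⟩ := Nat.exists_eq_add_of_le' (Nat.succ_le_iff.mpr hk)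
  rw [Function.iterate_add_apply, (t.ad_f_iterate_e_pow 𝕜 l).2]
  exact Function.iterate_fixed (map_zero _) r

end IsSpinTriple

end SpinTriple

section Trace

variable {ι 𝕜 : Type*} [Fintype ι] [DecidableEq ι] [Field 𝕜]

theorem trace_ad (M A : Matrix ι ι 𝕜) : (ad 𝕜 _ M A).trace = 0 := by
  rw [ad_apply, LieRing.of_associative_ring_bracket, Matrix.trace_sub, Matrix.trace_mul_comm,
    sub_self]

theorem trace_ad_mul (M A B : Matrix ι ι 𝕜) :
    (ad 𝕜 _ M A * B).trace = -(A * ad 𝕜 _ M B).trace := by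
  rw [eq_neg_iff_add_eq_zero, ← Matrix.trace_add, ← ad_mul, trace_ad]

theorem trace_ad_iterate_mul (M : Matrix ι ι 𝕜) (k : ℕ) (A B : Matrix ι ι 𝕜) :
    ((ad 𝕜 _ M)^[k] A * B).trace = (-1) ^ k * (A * (ad 𝕜 _ M)^[k] B).trace := by
  induction k generalizing B with
  | zero => simp
  | succ k ih =>
    rw [Function.iterate_succ_apply', trace_ad_mul, ih, Function.iterate_succ_apply, pow_succ]
    ring

theorem trace_pow_mul_ad (M A : Matrix ι ι 𝕜) (l : ℕ) : (M ^ l * ad 𝕜 _ M A).trace = 0 := by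
  rw [← neg_eq_zero, ← trace_ad_mul, ad_apply, LieRing.of_associative_ring_bracket,
    ← pow_succ, ← pow_succ', sub_self, zero_mul, Matrix.trace_zero]

end Trace

/-! ### The spin triple of the angular momentum operators -/

section Spin

variable (n : ℕ)

/-- The operator `J₃`, which is `J n 2` in the zero-based indexing of `J`. -/
def Jthree : Op n := Matrix.diagonal fun i => (n : ℂ) / 2 - ((i : ℕ) : ℂ)

/-- The matrix coefficient of `J₊` between the basis vectors numbered `k - 1` and `k`; it is a
function of `k : ℕ` so that the two ends of the ladder `k = 0`, `k = n + 1` can be included. -/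
def ladderCoef (k : ℕ) : ℂ := (√((k : ℝ) * ((n : ℝ) + 1 - k)) : ℝ)

theorem Jplus_apply (i k : Fin (n + 1)) :
    Jplus n i k = if (i : ℕ) + 1 = k then ladderCoef n k else 0 := rfl

theorem Jminus_apply (i k : Fin (n + 1)) :
    Jminus n i k = if (k : ℕ) + 1 = i then ladderCoef n i else 0 := by
  rw [Jminus, Matrix.conjTranspose_apply, Jplus_apply]
  split_ifs <;> simp [ladderCoef]

theorem ladderCoef_mul_self {k : ℕ} (hk : k ≤ n + 1) :
    ladderCoef n k * ladderCoef n k = k * ((n : ℂ) + 1 - k) := by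
  have hk' : (k : ℝ) ≤ n + 1 := mod_cast hk
  rw [ladderCoef, ← Complex.ofReal_mul, Real.mul_self_sqrt
    (mul_nonneg k.cast_nonneg (sub_nonneg.mpr hk'))]
  push_cast
  ring

theorem Jplus_mul_Jminus :
    Jplus n * Jminus n =
      Matrix.diagonal fun i : Fin (n + 1) => (((i : ℕ) : ℂ) + 1) * (n - (i : ℕ)) := by
  ext i k
  simp only [Matrix.mul_apply, Jplus_apply, Jminus_apply, Matrix.diagonal_apply]
  rw [Fin.sum_univ_eq_sum_range (fun j => (if (i : ℕ) + 1 = j then ladderCoef n j else 0) *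
    if (k : ℕ) + 1 = j then ladderCoef n j else 0)]
  simp only [ite_mul, zero_mul, Finset.sum_ite_eq, Finset.mem_range, add_left_inj, Fin.ext_iff,
    mul_ite, mul_zero]
  split_ifs with hi hik hik
  · rw [ladderCoef_mul_self n hi.le, hik]
    push_cast
    ring
  · rfl
  · rw [show (i : ℕ) = n by omega, sub_self, mul_zero]
  · rfl

theorem Jminus_mul_Jplus :
    Jminus n * Jplus n =
      Matrix.diagonal fun i : Fin (n + 1) => ((i : ℕ) : ℂ) * ((n : ℂ) + 1 - (i : ℕ)) := by
  ext i k
  simp only [Matrix.mul_apply, Jplus_apply, Jminus_apply, Matrix.diagonal_apply]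
  rw [Fin.sum_univ_eq_sum_range (fun j => (if j + 1 = (i : ℕ) then ladderCoef n i else 0) *
    if j + 1 = (k : ℕ) then ladderCoef n k else 0), ← ladderCoef_mul_self n i.2.le]
  have hi := i.2
  rcases hm : (i : ℕ) with _ | m
  · simp [ladderCoef]
  · simp only [add_left_inj, ite_mul, zero_mul, Finset.sum_ite_eq', Finset.mem_range, Fin.ext_iff]
    rw [if_pos (by omega), ← hm]
    split_ifs with hik
    · rw [hik]
    · rw [mul_zero]

theorem isSpinTriple_J : IsSpinTriple (Jthree n) (Jplus n) (Jminus n) where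
  lie_h_e := by
    ext i k
    simp only [LieRing.of_associative_ring_bracket, Jthree, Matrix.diagonal_mul,
      Matrix.mul_diagonal, Matrix.sub_apply, Jplus_apply]
    split_ifs with h
    · rw [← h]
      push_cast
      ring
    · ring
  lie_h_f := by
    ext i k
    simp only [LieRing.of_associative_ring_bracket, Jthree, Matrix.diagonal_mul,
      Matrix.mul_diagonal, Matrix.sub_apply, Matrix.neg_apply, Jminus_apply]
    split_ifs with h
    · rw [← h]
      push_cast
      ring
    · ring
  lie_e_f := by
    rw [LieRing.of_associative_ring_bracket, Jplus_mul_Jminus, Jminus_mul_Jplus, Jthree,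
      Matrix.diagonal_sub, ← Matrix.diagonal_smul]
    congr 1
    ext i
    simp only [Pi.smul_apply, nsmul_eq_mul]
    push_cast
    ring

theorem casimir_J :
    Jminus n * Jplus n + Jthree n * Jthree n + Jthree n =
      ((((n : ℂ) + 1) ^ 2 - 1) / 4) • (1 : Op n) := by
  rw [Jminus_mul_Jplus, Jthree, Matrix.diagonal_mul_diagonal, Matrix.diagonal_add,
    Matrix.diagonal_add, ← Matrix.diagonal_one, ← Matrix.diagonal_smul]
  congr 1
  ext i
  simp only [Pi.smul_apply, smul_eq_mul]
  ring

/-- The operator `[J₋, ·]` on the operator space. -/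
abbrev adMinus : Op n →ₗ[ℂ] Op n := ad ℂ (Op n) (Jminus n)

theorem Jminus_mul_Jplus_pow (l : ℕ) :
    Jminus n * Jplus n ^ l =
      (-1 / ((4 * (l : ℂ) + 2) * (l + 1))) • adMinus n (adMinus n (Jplus n ^ (l + 1))) +
      (1 / 2 : ℂ) • adMinus n (Jplus n ^ l) +
      ((l : ℂ) * (((n : ℂ) + 1) ^ 2 - (l : ℂ) ^ 2) / (4 * l + 2)) • Jplus n ^ (l - 1) := by
  rw [(isSpinTriple_J n).f_mul_e_pow ℂ (casimir_J n)]
  congr 4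
  ring

theorem trace_Jminus_pow_mul_Jplus_pow_succ (l : ℕ) :
    (Jminus n ^ (l + 1) * Jplus n ^ (l + 1)).trace =
      ((l : ℂ) + 1) * (((n : ℂ) + 1) ^ 2 - ((l : ℂ) + 1) ^ 2) / (4 * l + 6) *
        (Jminus n ^ l * Jplus n ^ l).trace := by
  rw [pow_succ, mul_assoc, Jminus_mul_Jplus_pow]
  simp only [mul_add, Matrix.trace_add, mul_smul_comm, Matrix.trace_smul, trace_pow_mul_ad,
    Nat.add_sub_cancel, smul_eq_mul]
  push_cast
  ring

/-- The square `‖J₊^l‖²` of the Hilbert-Schmidt norm. -/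
def hsNormSq (l : ℕ) : ℝ :=
  ((n : ℝ) + 1) * ∏ k ∈ Finset.range l,
    ((k : ℝ) + 1) * (((n : ℝ) + 1) ^ 2 - ((k : ℝ) + 1) ^ 2) / (4 * k + 6)

theorem trace_Jminus_pow_mul_Jplus_pow (l : ℕ) :
    (Jminus n ^ l * Jplus n ^ l).trace = (hsNormSq n l : ℂ) := by
  induction l with
  | zero => simp [hsNormSq]
  | succ l ih =>
    rw [trace_Jminus_pow_mul_Jplus_pow_succ, ih, hsNormSq, hsNormSq, Finset.prod_range_succ]
    push_cast
    ring

theorem hsNormSq_pos {l : ℕ} (hl : l ≤ n) : 0 < hsNormSq n l := by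
  refine mul_pos (by positivity) (Finset.prod_pos fun k hk => ?_)
  have hk' : (k : ℝ) < n := mod_cast (Finset.mem_range.mp hk).trans_le hl
  have : ((k : ℝ) + 1) ^ 2 < ((n : ℝ) + 1) ^ 2 := by gcongr
  exact div_pos (mul_pos (by positivity) (by linarith)) (by positivity)

theorem trace_adMinus_iterate_Jplus_pow_mul_self (l : ℕ) :
    ((adMinus n)^[l] (Jplus n ^ l) * (adMinus n)^[l] (Jplus n ^ l)).trace =
      ((2 * l).factorial : ℂ) * (hsNormSq n l : ℂ) := by
  rw [trace_ad_iterate_mul, ← Function.iterate_add_apply, ← two_mul,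
    ((isSpinTriple_J n).ad_f_iterate_e_pow ℂ l).1, mul_smul_comm, Matrix.trace_smul,
    Matrix.trace_mul_comm, trace_Jminus_pow_mul_Jplus_pow, smul_eq_mul]
  linear_combination ((2 * l).factorial : ℂ) * (hsNormSq n l : ℂ) *
    pow_mul_pow_eq_one l (by norm_num : (-1 : ℂ) * -1 = 1)

theorem trace_adMinus_iterate_Jplus_pow_mul_of_ne {l l' : ℕ} (h : l ≠ l') :
    ((adMinus n)^[l] (Jplus n ^ l) * (adMinus n)^[l'] (Jplus n ^ l')).trace = 0 := by
  wlog hlt : l < l' generalizing l l'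
  · rw [Matrix.trace_mul_comm]
    exact this h.symm (by omega)
  rw [Matrix.trace_mul_comm, trace_ad_iterate_mul, ← Function.iterate_add_apply,
    (isSpinTriple_J n).ad_f_iterate_e_pow_eq_zero ℂ (by omega), mul_zero, Matrix.trace_zero,
    mul_zero]

end Spin

/-! ### Rotations and their spin representation -/

theorem exp_intertwine {𝔸 𝔹 : Type*} [NormedRing 𝔸] [NormedAlgebra ℝ 𝔸] [CompleteSpace 𝔸]
    [NormedRing 𝔹] [NormedAlgebra ℝ 𝔹] [CompleteSpace 𝔹] (X Y : 𝔸) (A : 𝔹) (ψ : 𝔹 →L[ℝ] 𝔸)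
    (h : ∀ M, X * ψ M - ψ M * Y = ψ (A * M)) (M : 𝔹) :
    NormedSpace.exp X * ψ M = ψ (NormedSpace.exp A * M) * NormedSpace.exp Y := by
  let _ := NormedAlgebra.restrictScalars ℚ ℝ 𝔸
  let F : ℝ → 𝔸 := fun t => NormedSpace.exp (t • (-X)) * ψ (NormedSpace.exp (t • A) * M) *
    NormedSpace.exp (t • Y)
  have hF (t : ℝ) : HasDerivAt F 0 t := by
    have hψ : HasDerivAt (fun t : ℝ => ψ (NormedSpace.exp (t • A) * M))
        (ψ (A * NormedSpace.exp (t • A) * M)) t :=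
      ψ.hasFDerivAt.comp_hasDerivAt t ((hasDerivAt_exp_smul_const' A t).mul_const M)
    refine (((hasDerivAt_exp_smul_const (-X) t).mul hψ).mul
      (hasDerivAt_exp_smul_const' Y t)).congr_deriv ?_
    rw [mul_assoc A, ← h]
    simp only [Pi.mul_apply]
    noncomm_ring
  have F_zero_eq_one : F 0 = F 1 := is_const_of_deriv_eq_zero
    (fun t => (hF t).differentiableAt) (fun t => (hF t).deriv) 0 1
  simp only [F, zero_smul, NormedSpace.exp_zero, one_mul, mul_one, one_smul] at F_zero_eq_one
  have exp_mul_exp_neg : NormedSpace.exp X * NormedSpace.exp (-X) = 1 := by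
    rw [← NormedSpace.exp_add_of_commute ((Commute.refl X).neg_right), add_neg_cancel,
      NormedSpace.exp_zero]
  rw [F_zero_eq_one, mul_assoc, ← mul_assoc, ← mul_assoc, exp_mul_exp_neg, one_mul]

section Rotation

attribute [local instance] Matrix.linftyOpNormedRing Matrix.linftyOpNormedAlgebra

variable (n : ℕ)

/-- The operator `w·J` for a complex vector `w`. -/
def dotJ (w : Fin 3 → ℂ) : Op n := ∑ k, w k • J n k

theorem dotJ_eq (w : Fin 3 → ℂ) :
    dotJ n w = w 2 • Jthree n + ((w 0 - Complex.I * w 1) / 2) • Jplus n +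
      ((w 0 + Complex.I * w 1) / 2) • Jminus n := by
  have J_zero : J n 0 = (1 / 2 : ℂ) • (Jplus n + Jminus n) := rfl
  have J_one : J n 1 = (1 / (2 * Complex.I)) • (Jplus n - Jminus n) := rfl
  have J_two : J n 2 = Jthree n := rfl
  have one_div_two_I : 1 / (2 * Complex.I) = -Complex.I / 2 := by
    rw [one_div, mul_inv, Complex.inv_I, mul_comm, div_eq_mul_inv]
  rw [dotJ, Fin.sum_univ_three, J_zero, J_one, J_two, one_div_two_I]
  module

theorem lie_dotJ_dotJ (v w : Fin 3 → ℂ) :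
    ⁅dotJ n v, dotJ n w⁆ = Complex.I • dotJ n (v ⨯₃ w) := by
  have t := isSpinTriple_J n
  have Jplus_mul_Jminus : Jplus n * Jminus n = Jminus n * Jplus n + 2 • Jthree n :=
    sub_eq_iff_eq_add'.mp t.lie_e_f
  simp only [dotJ_eq, LieRing.of_associative_ring_bracket, add_mul, mul_add, smul_mul_assoc,
    mul_smul_comm, t.h_mul_e, t.h_mul_f, Jplus_mul_Jminus, cross_apply, Matrix.cons_val]
  match_scalars <;> ring_nf <;> simp only [Complex.I_sq] <;> ring

theorem sum_smul_L (v : Fin 3 → ℝ) :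
    ∑ k, v k • L k = !![0, -v 2, v 1; v 2, 0, -v 0; -v 1, v 0, 0] := by
  ext i j
  fin_cases i <;> fin_cases j <;> simp [L, Fin.sum_univ_three]

theorem sum_smul_L_mulVec (v w : Fin 3 → ℝ) : (∑ k, v k • L k) *ᵥ w = v ⨯₃ w := by
  rw [sum_smul_L]
  ext i
  fin_cases i <;> simp [cross_apply, Matrix.mulVec, dotProduct, Fin.sum_univ_three] <;> ring

theorem rot_neg (v : Fin 3 → ℝ) : rot (-v) = (rot v)ᵀ := by
  rw [rot, rot, ← Matrix.exp_transpose, sum_smul_L, sum_smul_L]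
  congr 1
  ext i j
  fin_cases i <;> fin_cases j <;> simp

theorem rot_mul_rot_neg (v : Fin 3 → ℝ) : rot v * rot (-v) = 1 := by
  simp only [rot, Pi.neg_apply, neg_smul, Finset.sum_neg_distrib]
  rw [← Matrix.exp_add_of_commute, add_neg_cancel, NormedSpace.exp_zero]
  exact (Commute.refl _).neg_right

theorem spinRot_eq (v : Fin 3 → ℝ) :
    spinRot n v = NormedSpace.exp ((-Complex.I) • dotJ n fun k => (v k : ℂ)) := rfl

theorem spinRot_neg (v : Fin 3 → ℝ) :
    spinRot n (-v) = NormedSpace.exp (-((-Complex.I) • dotJ n fun k => (v k : ℂ))) := by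
  simp only [spinRot, dotJ, Pi.neg_apply, Complex.ofReal_neg, neg_smul, Finset.sum_neg_distrib,
    smul_neg]

theorem spinRot_mul_spinRot_neg (v : Fin 3 → ℝ) : spinRot n v * spinRot n (-v) = 1 := by
  rw [spinRot_neg, spinRot_eq, ← Matrix.exp_add_of_commute, add_neg_cancel, NormedSpace.exp_zero]
  exact (Commute.refl _).neg_right

theorem spinRot_neg_mul_spinRot (v : Fin 3 → ℝ) : spinRot n (-v) * spinRot n v = 1 := by
  simpa only [neg_neg] using spinRot_mul_spinRot_neg n (-v)

theorem spinRot_mul_dotJ (v w : Fin 3 → ℝ) :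
    spinRot n v * dotJ n (fun k => (w k : ℂ)) =
      dotJ n (fun k => ((rot v *ᵥ w) k : ℝ)) * spinRot n v := by
  let ψ : Matrix (Fin 3) (Fin 3) ℝ →ₗ[ℝ] Op n :=
    { toFun := fun M => dotJ n fun k => (((M *ᵥ w) k : ℝ) : ℂ)
      map_add' := fun M M' => by
        simp only [dotJ, Matrix.add_mulVec, Pi.add_apply, Complex.ofReal_add, add_smul,
          Finset.sum_add_distrib]
      map_smul' := fun r M => by
        simp only [dotJ, Matrix.smul_mulVec, Pi.smul_apply, smul_eq_mul, Complex.ofReal_mul,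
          Finset.smul_sum, mul_smul, RingHom.id_apply, Complex.coe_smul] }
  have infinitesimal (M : Matrix (Fin 3) (Fin 3) ℝ) :
      ⁅(-Complex.I) • dotJ n fun k => (v k : ℂ), ψ M⁆ = ψ ((∑ k, v k • L k) * M) := by
    simp only [ψ, LinearMap.coe_mk, AddHom.coe_mk]
    rw [smul_lie, lie_dotJ_dotJ, smul_smul, neg_mul, Complex.I_mul_I, neg_neg, one_smul,
      ← Matrix.mulVec_mulVec, sum_smul_L_mulVec]
    congr 1
    ext k
    fin_cases k <;> simp [cross_apply]
  have key := exp_intertwine _ _ _ (LinearMap.toContinuousLinearMap ψ) infinitesimal 1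
  simp only [mul_one, LinearMap.coe_toContinuousLinearMap', ψ, LinearMap.coe_mk, AddHom.coe_mk,
    Matrix.one_mulVec] at key
  exact key

theorem rot_smul_mulVec {u w : Fin 3 → ℝ} (hu : u ⬝ᵥ u = 1) (huw : u ⬝ᵥ w = 0) (θ : ℝ) :
    rot (θ • u) *ᵥ w = Real.cos θ • w + Real.sin θ • (u ⨯₃ w) := by
  let ψ : ℂ →ₗ[ℝ] Matrix (Fin 3) (Fin 3) ℝ :=
    { toFun := fun z => Matrix.of fun i _ => (z.re • w + z.im • (u ⨯₃ w)) i
      map_add' := fun z z' => by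
        ext i j
        simp only [Complex.add_re, Complex.add_im, Matrix.of_apply, Matrix.add_apply,
          Pi.add_apply, Pi.smul_apply, smul_eq_mul]
        ring
      map_smul' := fun r z => by
        ext i j
        simp only [Complex.smul_re, Complex.smul_im, Matrix.of_apply, Matrix.smul_apply,
          Pi.add_apply, Pi.smul_apply, smul_eq_mul, RingHom.id_apply]
        ring }
  have mul_ψ (M : Matrix (Fin 3) (Fin 3) ℝ) (z : ℂ) :
      M * ψ z = Matrix.of fun i _ => (M *ᵥ (z.re • w + z.im • (u ⨯₃ w))) i := rfl
  have cross_cross : u ⨯₃ (u ⨯₃ w) = -w := by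
    rw [cross_cross_eq_smul_sub_smul', hu, huw, zero_smul, one_smul, zero_sub]
  have infinitesimal (z : ℂ) :
      (∑ k, (θ • u) k • L k) * ψ z - ψ z * 0 = ψ (θ * Complex.I * z) := by
    rw [mul_zero, sub_zero, mul_ψ, sum_smul_L_mulVec]
    ext i j
    simp only [ψ, cross_cross, LinearMap.coe_mk, AddHom.coe_mk, Matrix.of_apply, map_add, map_smul,
      LinearMap.smul_apply, smul_neg, Pi.smul_apply, Pi.add_apply, Pi.neg_apply, smul_eq_mul,
      Complex.mul_re, Complex.mul_im, Complex.ofReal_re, Complex.ofReal_im, Complex.I_re,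
      Complex.I_im, mul_zero, mul_one, sub_self, zero_mul, add_zero, zero_sub, neg_mul, zero_add]
    ring
  have exp_eq : NormedSpace.exp (θ * Complex.I) = Complex.cos θ + Complex.sin θ * Complex.I := by
    rw [← Complex.exp_eq_exp_ℂ, Complex.exp_mul_I]
  have key := exp_intertwine _ 0 _ (LinearMap.toContinuousLinearMap ψ) infinitesimal 1
  rw [NormedSpace.exp_zero, mul_one, mul_one, exp_eq] at key
  ext i
  calc (rot (θ • u) *ᵥ w) i = (rot (θ • u) * ψ 1) i 0 := by simp [mul_ψ]
    _ = ψ (Complex.cos θ + Complex.sin θ * Complex.I) i 0 := congrFun₂ key i 0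
    _ = (Real.cos θ • w + Real.sin θ • (u ⨯₃ w)) i := by
      simp [ψ, ← Complex.ofReal_cos, ← Complex.ofReal_sin]

theorem sum_sq_eq_one (x : S2) :
    (x : E3) 0 ^ 2 + (x : E3) 1 ^ 2 + (x : E3) 2 ^ 2 = 1 := by
  have hx := mem_sphere_zero_iff_norm.mp x.2
  rw [EuclideanSpace.norm_eq, Real.sqrt_eq_one, Fin.sum_univ_three] at hx
  simpa only [Real.norm_eq_abs, sq_abs] using hx

theorem exists_rot_northPole (x : S2) :
    ∃ v, (x : E3).ofLp = rot v *ᵥ (northPole : E3).ofLp := by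
  have hx := sum_sq_eq_one x
  set z : ℂ := ⟨(x : E3) 0, (x : E3) 1⟩
  let θ := Real.arccos ((x : E3) 2)
  have hz : |(x : E3) 2| ≤ 1 := abs_le_one_iff_mul_self_le_one.mpr
    (by nlinarith only [hx, sq_nonneg ((x : E3) 0), sq_nonneg ((x : E3) 1)])
  have cos_θ : Real.cos θ = (x : E3) 2 := Real.cos_arccos (abs_le.mp hz).1 (abs_le.mp hz).2
  have sin_θ : Real.sin θ = ‖z‖ := by
    rw [Real.sin_arccos, Complex.norm_def, Complex.normSq_mk]
    congr 1
    linarith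
  refine ⟨θ • ![-Real.sin z.arg, Real.cos z.arg, 0], ?_⟩
  rw [rot_smul_mulVec, cos_θ, sin_θ]
  · ext i
    fin_cases i
    · simpa [northPole, cross_apply, -Complex.norm_mul_cos_arg] using
        (Complex.norm_mul_cos_arg z).symm
    · simpa [northPole, cross_apply, -Complex.norm_mul_sin_arg] using
        (Complex.norm_mul_sin_arg z).symm
    · simp [northPole, cross_apply]
  · simp [dotProduct, Fin.sum_univ_three, ← sq]
  · simp [northPole, dotProduct, Fin.sum_univ_three]

end Rotation

/-! ### Traces against operators invariant under rotations about the third axis -/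

section Torus

variable (n : ℕ)

/-- The diagonal matrix with entries `τ ^ i`, `τ ≠ 0`: up to a scalar, these are the complexified
rotations about the third axis. -/
def torus (τ : ℂ) : Op n := Matrix.diagonal fun i => τ ^ (i : ℕ)

theorem torus_mul_torus_inv {τ : ℂ} (hτ : τ ≠ 0) : torus n τ * torus n τ⁻¹ = 1 := by
  simp only [torus, Matrix.diagonal_mul_diagonal, ← mul_pow, mul_inv_cancel₀ hτ, one_pow,
    Matrix.diagonal_one]

theorem Jplus_mul_torus (τ : ℂ) : Jplus n * torus n τ = τ • (torus n τ * Jplus n) := by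
  ext i k
  simp only [torus, Matrix.mul_diagonal, Matrix.smul_apply, Matrix.diagonal_mul, Jplus_apply,
    smul_eq_mul]
  split_ifs with h
  · rw [← h]
    ring
  · ring

theorem torus_mul_Jminus (τ : ℂ) : torus n τ * Jminus n = τ • (Jminus n * torus n τ) := by
  ext i k
  simp only [torus, Matrix.mul_diagonal, Matrix.smul_apply, Matrix.diagonal_mul, Jminus_apply,
    smul_eq_mul]
  split_ifs with h
  · rw [← h]
    ring
  · ring

theorem torus_mul_Jthree (τ : ℂ) : torus n τ * Jthree n = Jthree n * torus n τ := by
  simp only [torus, Jthree, Matrix.diagonal_mul_diagonal, mul_comm]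

theorem torus_mul_Jplus_pow (τ : ℂ) (l : ℕ) :
    τ ^ l • (torus n τ * Jplus n ^ l) = Jplus n ^ l * torus n τ := by
  induction l with
  | zero => simp
  | succ l ih =>
    rw [pow_succ (Jplus n), mul_assoc (Jplus n ^ l), Jplus_mul_torus, mul_smul_comm,
      ← mul_assoc (Jplus n ^ l), ← ih, smul_mul_assoc, smul_smul, mul_assoc, pow_succ']

theorem torus_mul_adMinus {τ a b : ℂ} {A : Op n}
    (hA : a • (torus n τ * A) = b • (A * torus n τ)) :
    a • (torus n τ * adMinus n A) = (b * τ) • (adMinus n A * torus n τ) := by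
  have torus_mul_Jminus_mul : torus n τ * (Jminus n * A) = τ • (Jminus n * (torus n τ * A)) := by
    rw [← mul_assoc, torus_mul_Jminus, smul_mul_assoc, mul_assoc]
  simp only [ad_apply, LieRing.of_associative_ring_bracket, mul_sub, sub_mul, smul_sub,
    torus_mul_Jminus_mul]
  rw [smul_comm, ← mul_smul_comm, hA, ← mul_assoc, ← smul_mul_assoc a, hA, smul_mul_assoc,
    mul_assoc A, torus_mul_Jminus]
  simp only [mul_smul_comm, smul_smul, mul_assoc, mul_comm τ]

theorem torus_mul_iterate (τ : ℂ) (l k : ℕ) :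
    τ ^ l • (torus n τ * (adMinus n)^[k] (Jplus n ^ l)) =
      τ ^ k • ((adMinus n)^[k] (Jplus n ^ l) * torus n τ) := by
  induction k with
  | zero =>
    rw [pow_zero, one_smul]
    exact torus_mul_Jplus_pow n τ l
  | succ k ih =>
    rw [Function.iterate_succ_apply', pow_succ]
    exact torus_mul_adMinus n ih

variable {n}

theorem trace_pow_mul_of_torus_conj {τ : ℂ} (hτ : τ ≠ 0) {K : Op n}
    (hK : torus n τ * K = K * torus n τ) (u p q : ℂ) (l : ℕ) :
    ((u • Jthree n + p • Jplus n + q • Jminus n) ^ l * K).trace =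
      ((u • Jthree n + (p * τ) • Jplus n + (q * τ⁻¹) • Jminus n) ^ l * K).trace := by
  set A := u • Jthree n + p • Jplus n + q • Jminus n
  set B := u • Jthree n + (p * τ) • Jplus n + (q * τ⁻¹) • Jminus n
  have semiconj : SemiconjBy (torus n τ) B A := by
    simp only [SemiconjBy, A, B, add_mul, mul_add, smul_mul_assoc, mul_smul_comm,
      torus_mul_Jthree, Jplus_mul_torus, torus_mul_Jminus, smul_smul, inv_mul_cancel_right₀ hτ]
  have mul_inv := torus_mul_torus_inv n hτ
  calc (A ^ l * K).trace = (A ^ l * (torus n τ * torus n τ⁻¹) * K).trace := by rw [mul_inv, mul_one]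
    _ = (torus n τ * (B ^ l * torus n τ⁻¹ * K)).trace := by
      rw [← mul_assoc, ← (semiconj.pow_right l).eq]
      simp only [mul_assoc]
    _ = (B ^ l * (torus n τ⁻¹ * (K * torus n τ))).trace := by
      rw [Matrix.trace_mul_comm]
      simp only [mul_assoc]
    _ = (B ^ l * K).trace := by
      rw [← hK, ← mul_assoc (torus n τ⁻¹), mul_eq_one_comm.mp mul_inv, one_mul]

/- The scaling by `τ = 2` or `τ = 1/2` multiplies such a trace by `2 ^ l`. -/
theorem trace_nilpotent_pow_mul {K : Op n} (hK : ∀ τ ≠ 0, torus n τ * K = K * torus n τ)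
    {p q : ℂ} (hpq : p * q = 0) {l : ℕ} (hl : l ≠ 0) :
    ((p • Jplus n + q • Jminus n) ^ l * K).trace = 0 := by
  have two_pow_ne_one : (2 : ℂ) ^ l - 1 ≠ 0 :=
    sub_ne_zero.mpr (mod_cast (Nat.one_lt_two_pow hl).ne')
  have eq_zero_of_eq_two_pow_mul {x : ℂ} (h : x = 2 ^ l * x) : x = 0 :=
    (mul_eq_zero.mp (by linear_combination -h : (2 ^ l - 1) * x = 0)).resolve_left two_pow_ne_one
  apply eq_zero_of_eq_two_pow_mul
  rcases mul_eq_zero.mp hpq with rfl | rfl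
  · have := trace_pow_mul_of_torus_conj (τ := 2⁻¹) (by simp) (hK _ (by simp)) 0 0 q l
    simpa [smul_pow, mul_pow, mul_assoc, mul_left_comm] using this
  · have := trace_pow_mul_of_torus_conj (τ := 2) (by simp) (hK _ (by simp)) 0 p 0 l
    simpa [smul_pow, mul_pow, mul_assoc, mul_left_comm] using this

theorem trace_isotropic_pow_mul {K : Op n} (hK : ∀ τ ≠ 0, torus n τ * K = K * torus n τ)
    {a : Fin 3 → ℂ} (ha : a 0 ^ 2 + a 1 ^ 2 + a 2 ^ 2 = 0) (l : ℕ) :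
    (dotJ n a ^ l * K).trace =
      a 2 ^ l * ((Jthree n + (1 / 2 : ℂ) • Jplus n + (-1 / 2 : ℂ) • Jminus n) ^ l * K).trace := by
  rw [dotJ_eq]
  set p := (a 0 - Complex.I * a 1) / 2 with hp
  set q := (a 0 + Complex.I * a 1) / 2 with hq
  have hpq : 4 * (p * q) = -a 2 ^ 2 := by
    rw [hp, hq]
    linear_combination ha - a 1 ^ 2 * Complex.I_sq
  by_cases h : a 2 = 0
  · rcases eq_or_ne l 0 with rfl | hl
    · simp only [pow_zero, one_mul]
    · rw [h] at hpq
      rw [h, zero_pow hl, zero_mul, zero_smul, zero_add,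
        trace_nilpotent_pow_mul hK (by linear_combination hpq / 4) hl]
  · have hp0 : p ≠ 0 := fun h0 => h (pow_eq_zero_iff two_ne_zero |>.mp (by
      linear_combination hpq - 4 * q * h0))
    have hτ : a 2 / (2 * p) ≠ 0 := div_ne_zero h (mul_ne_zero two_ne_zero hp0)
    have p_mul : p * (a 2 / (2 * p)) = a 2 * (1 / 2) := by field_simp
    have q_mul : q * (a 2 / (2 * p))⁻¹ = a 2 * (-1 / 2) := by
      field_simp
      linear_combination hpq
    rw [trace_pow_mul_of_torus_conj hτ (hK _ hτ), p_mul, q_mul, ← smul_smul, ← smul_smul,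
      ← smul_add, ← smul_add, smul_pow, smul_mul_assoc, Matrix.trace_smul, smul_eq_mul]

end Torus

/-! ### The coupled basis and the spherical harmonics as iterated lowerings -/

section Lowering

theorem coupledAux_eq (n l k : ℕ) :
    coupledAux n l k = (((∏ j ∈ Finset.range k, 1 / beta l ((l : ℤ) - j)) *
      ((-1) ^ l / √(hsNormSq n l)) : ℝ) : ℂ) • (adMinus n)^[k] (Jplus n ^ l) := by
  induction k with
  | zero => simp [coupledAux, trace_Jminus_pow_mul_Jplus_pow]
  | succ k ih =>
    rw [coupledAux, ih, ← LieRing.of_associative_ring_bracket, lie_smul, smul_smul,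
      Function.iterate_succ_apply', ad_apply, Finset.prod_range_succ]
    push_cast
    congr 1
    ring

/-- The polynomial `x + iy`. -/
def xplus : MvPolynomial (Fin 3) ℂ := MvPolynomial.X 0 + Complex.I • MvPolynomial.X 1

/-- The polynomial `x - iy`. -/
def xminus : MvPolynomial (Fin 3) ℂ := MvPolynomial.X 0 - Complex.I • MvPolynomial.X 1

theorem lowering_xplus : lowering xplus = (-2 : ℂ) • MvPolynomial.X 2 := by
  simp only [xplus, lowering, map_add, Derivation.map_smul, MvPolynomial.mkDerivation_X,
    Matrix.cons_val_zero, Matrix.cons_val_one, smul_smul, Complex.I_mul_I]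
  module

theorem lowering_z : lowering (MvPolynomial.X 2) = xminus :=
  MvPolynomial.mkDerivation_X _ _ _

theorem lowering_xminus : lowering xminus = 0 := by
  simp only [xminus, lowering, map_sub, Derivation.map_smul, MvPolynomial.mkDerivation_X,
    Matrix.cons_val_zero, Matrix.cons_val_one, smul_smul, Complex.I_mul_I]
  module

/-- The unnormalized spherical harmonics `J₋^k (x+iy)^l`. -/
def bPoly (l k : ℕ) : MvPolynomial (Fin 3) ℂ := lowering^[k] (xplus ^ l)

theorem lowering_bPoly (l k : ℕ) : lowering (bPoly l k) = bPoly l (k + 1) :=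
  (Function.iterate_succ_apply' lowering k _).symm

/-- The factor between `bPoly l k` and the normalized `harmonicAux l k`. -/
def harmonicCoef (l k : ℕ) : ℝ :=
  (∏ j ∈ Finset.range k, 1 / beta l ((l : ℤ) - j)) *
    ((-1) ^ l / ((l.factorial : ℝ) * 2 ^ l / √((2 * l + 1).factorial : ℝ)))

theorem harmonicAux_eq (l k : ℕ) : harmonicAux l k = (harmonicCoef l k : ℂ) • bPoly l k := by
  induction k with
  | zero => simp [harmonicAux, bPoly, harmonicCoef, xplus]
  | succ k ih =>
    rw [harmonicAux, ih, Derivation.map_smul, lowering_bPoly, smul_smul, harmonicCoef,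
      harmonicCoef, Finset.prod_range_succ]
    push_cast
    congr 1
    ring

theorem beta_arg_pos {l j : ℕ} (hj : j < 2 * l) : 0 < (2 * (l : ℝ) - j) * (j + 1) :=
  mul_pos (sub_pos.mpr (mod_cast hj)) j.cast_add_one_pos

theorem beta_sub (l j : ℕ) : beta l ((l : ℤ) - j) = √((2 * (l : ℝ) - j) * (j + 1)) := by
  rw [beta]
  push_cast
  congr 1
  ring

theorem beta_pos {l j : ℕ} (hj : j < 2 * l) : 0 < beta l ((l : ℤ) - j) := by
  rw [beta_sub]
  exact Real.sqrt_pos.mpr (beta_arg_pos hj)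

theorem harmonicCoef_ne_zero {l k : ℕ} (hk : k ≤ 2 * l) : harmonicCoef l k ≠ 0 :=
  mul_ne_zero
    (Finset.prod_ne_zero_iff.mpr fun _ hj =>
      one_div_ne_zero (beta_pos ((Finset.mem_range.mp hj).trans_le hk)).ne')
    (div_ne_zero (by simp) (by positivity))

theorem prod_beta_sq_mul_factorial {l k : ℕ} (hk : k ≤ 2 * l) :
    (∏ j ∈ Finset.range k, 1 / beta l ((l : ℤ) - j)) ^ 2 * ((2 * l).factorial : ℝ) * k.factorial =
      (2 * l - k).factorial := by
  induction k with
  | zero => simp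
  | succ k ih =>
    have hb : beta l ((l : ℤ) - k) ^ 2 = (2 * l - k) * (k + 1) := by
      rw [beta_sub, Real.sq_sqrt (beta_arg_pos hk).le]
    obtain ⟨r, hr⟩ : ∃ r, 2 * l = k + (r + 1) := Nat.exists_eq_add_of_lt hk
    have hr' : (2 * l : ℝ) = k + (r + 1) := mod_cast hr
    rw [Finset.prod_range_succ, mul_pow, div_pow, hb, show 2 * l - (k + 1) = r by omega, hr',
      add_sub_cancel_left, Nat.factorial_succ k]
    have ih' := ih (by omega)
    rw [show 2 * l - k = r + 1 by omega, Nat.factorial_succ r] at ih'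
    push_cast at ih' ⊢
    field_simp
    linear_combination ih'

theorem prod_beta_sq_mul_factorial_self (l : ℕ) :
    (∏ j ∈ Finset.range l, 1 / beta l ((l : ℤ) - j)) ^ 2 * ((2 * l).factorial : ℝ) = 1 := by
  have h := prod_beta_sq_mul_factorial (l := l) (k := l) (by omega)
  rw [show 2 * l - l = l by omega] at h
  exact mul_right_cancel₀ (by positivity) (h.trans (one_mul _).symm)

end Lowering

/-! ### The operator kernel -/

/-- A point of the sphere as a point of `ℂ³`, at which complex polynomials can be evaluated. -/
def pt (p : S2) : Fin 3 → ℂ := fun k => ((p : E3) k : ℂ)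

theorem sum_pt_sq (p : S2) : pt p 0 ^ 2 + pt p 1 ^ 2 + pt p 2 ^ 2 = 1 := by
  simpa [pt] using congrArg ((↑) : ℝ → ℂ) (sum_sq_eq_one p)

theorem eval_xplus (u : Fin 3 → ℂ) : MvPolynomial.eval u xplus = u 0 + Complex.I * u 1 := by
  simp only [xplus, map_add, MvPolynomial.smul_eval, MvPolynomial.eval_X]

theorem eval_xminus (u : Fin 3 → ℂ) : MvPolynomial.eval u xminus = u 0 - Complex.I * u 1 := by
  simp only [xminus, map_sub, MvPolynomial.smul_eval, MvPolynomial.eval_X]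

theorem lowering_mul (p q : MvPolynomial (Fin 3) ℂ) :
    lowering (p * q) = lowering p * q + p * lowering q := by
  rw [Derivation.leibniz, smul_eq_mul, smul_eq_mul]
  ring

theorem iterate_lowering_xplus_mul (w : MvPolynomial (Fin 3) ℂ) (k : ℕ) :
    lowering^[k + 2] (xplus * w) = xplus * lowering^[k + 2] w +
      ((k : ℂ) + 2) • (lowering xplus * lowering^[k + 1] w) +
      (((k : ℂ) + 2) * (k + 1) / 2) • (lowering (lowering xplus) * lowering^[k] w) :=
  iterate_leibniz_of_apply_three_eq_zero (D := lowering.toLinearMap) lowering_mul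
    (by simp [lowering_xplus, lowering_z, lowering_xminus]) w k

theorem eval_northPole_bPoly (l : ℕ) :
    MvPolynomial.eval (pt northPole) (bPoly l l) = (l.factorial : ℂ) * (-2) ^ l := by
  have xplus_eq_zero : MvPolynomial.eval (pt northPole) xplus = 0 := by
    simp [eval_xplus, pt, northPole]
  have xminus_eq_zero : MvPolynomial.eval (pt northPole) xminus = 0 := by
    simp [eval_xminus, pt, northPole]
  have z_eq_one : MvPolynomial.eval (pt northPole) (MvPolynomial.X 2) = 1 := by
    simp [pt, northPole]
  induction l with
  | zero => simp [bPoly]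
  | succ l ih =>
    cases l with
    | zero => simp [bPoly, lowering_xplus, MvPolynomial.smul_eval, z_eq_one]
    | succ l =>
      rw [bPoly] at ih
      rw [bPoly, pow_succ' xplus (l + 1), iterate_lowering_xplus_mul, lowering_xplus,
        Derivation.map_smul, lowering_z, map_add, map_add, map_mul, xplus_eq_zero]
      simp only [map_mul, MvPolynomial.smul_eval, xminus_eq_zero, z_eq_one, ih,
        Nat.factorial_succ (l + 1)]
      push_cast
      ring

/-- The ratio of the factor `W_{(2J₊/(n+1))^l} / (x+iy)^l` to the characteristic number `c_l`. -/
def ratioNum (n l : ℕ) : ℝ :=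
  √(∏ k ∈ Finset.range l, (1 - ((k : ℝ) + 1) ^ 2 / ((n : ℝ) + 1) ^ 2))

theorem ratioNum_prod_pos {n l : ℕ} (hl : l ≤ n) :
    0 < ∏ k ∈ Finset.range l, (1 - ((k : ℝ) + 1) ^ 2 / ((n : ℝ) + 1) ^ 2) := by
  refine Finset.prod_pos fun k hk => ?_
  have hk' : (k : ℝ) < n := mod_cast (Finset.mem_range.mp hk).trans_le hl
  rw [sub_pos, div_lt_one (by positivity)]
  gcongr

theorem ratioNum_pos {n l : ℕ} (hl : l ≤ n) : 0 < ratioNum n l :=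
  Real.sqrt_pos.mpr (ratioNum_prod_pos hl)

theorem ratioNum_sq {n l : ℕ} (hl : l ≤ n) :
    ratioNum n l ^ 2 = ∏ k ∈ Finset.range l, (1 - ((k : ℝ) + 1) ^ 2 / ((n : ℝ) + 1) ^ 2) :=
  Real.sq_sqrt (ratioNum_prod_pos hl).le

theorem factorial_mul_hsNormSq (n l : ℕ) :
    ((2 * l + 1).factorial : ℝ) * hsNormSq n l =
      (n + 1) * (l.factorial * ((n : ℝ) + 1) ^ l) ^ 2 *
        ∏ k ∈ Finset.range l, (1 - ((k : ℝ) + 1) ^ 2 / ((n : ℝ) + 1) ^ 2) := by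
  induction l with
  | zero => simp [hsNormSq]
  | succ l ih =>
    have hsNormSq_succ : hsNormSq n (l + 1) = hsNormSq n l *
        (((l : ℝ) + 1) * (((n : ℝ) + 1) ^ 2 - ((l : ℝ) + 1) ^ 2) / (4 * l + 6)) := by
      rw [hsNormSq, hsNormSq, Finset.prod_range_succ, mul_assoc]
    rw [hsNormSq_succ, Finset.prod_range_succ, Nat.factorial_succ l,
      show 2 * (l + 1) + 1 = 2 * l + 1 + 1 + 1 by ring, Nat.factorial_succ (2 * l + 1 + 1),
      Nat.factorial_succ (2 * l + 1)]
    have factor_eq : (2 * (l : ℝ) + 3) * (2 * l + 2) *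
        (((l : ℝ) + 1) * (((n : ℝ) + 1) ^ 2 - ((l : ℝ) + 1) ^ 2) / (4 * l + 6)) =
          (l + 1) ^ 2 * (n + 1) ^ 2 * (1 - ((l : ℝ) + 1) ^ 2 / ((n : ℝ) + 1) ^ 2) := by
      field_simp
      ring
    push_cast
    linear_combination (2 * l + 1).factorial * hsNormSq n l * factor_eq +
      (l + 1) ^ 2 * (n + 1) ^ 2 * (1 - ((l : ℝ) + 1) ^ 2 / ((n : ℝ) + 1) ^ 2) * ih

theorem ratioNum_eq {n l : ℕ} (hl : l ≤ n) :
    ratioNum n l = √((2 * (l : ℝ) + 1) / ((n : ℝ) + 1)) *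
      (∏ j ∈ Finset.range l, 1 / beta l ((l : ℤ) - j)) * √(hsNormSq n l) * (2 * l).factorial /
        (l.factorial * ((n : ℝ) + 1) ^ l) := by
  have hP := prod_beta_sq_mul_factorial_self l
  have hP0 : 0 ≤ ∏ j ∈ Finset.range l, 1 / beta l ((l : ℤ) - j) :=
    Finset.prod_nonneg fun _ _ => one_div_nonneg.mpr (Real.sqrt_nonneg _)
  have hH := factorial_mul_hsNormSq n l
  rw [← ratioNum_sq hl, Nat.factorial_succ] at hH
  rw [← sq_eq_sq₀ (ratioNum_pos hl).le (by positivity), div_pow, mul_pow, mul_pow, mul_pow,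
    Real.sq_sqrt (by positivity), Real.sq_sqrt (hsNormSq_pos n hl).le]
  push_cast at hH
  generalize ∏ j ∈ Finset.range l, 1 / beta l ((l : ℤ) - j) = P at hP
  field_simp
  linear_combination -hH - (2 * l + 1) * (2 * l).factorial * hsNormSq n l * hP

section Kernel

variable {n : ℕ} {c : ℕ → ℝ}

theorem kernel_eq (hc : c 0 = 1) : kernel n c = ∑ l ∈ Finset.range (n + 1),
    ((c l * √((2 * (l : ℝ) + 1) / ((n : ℝ) + 1)) : ℝ) : ℂ) • coupledAux n l l := by
  rw [Finset.sum_range_succ', add_comm, kernel]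
  congr 1
  · have sqrt_div_sqrt : √((2 * ((0 : ℕ) : ℝ) + 1) / ((n : ℝ) + 1)) * (1 / √((n : ℝ) + 1)) =
        1 / ((n : ℝ) + 1) := by
      rw [Nat.cast_zero, mul_zero, zero_add, Real.sqrt_div zero_le_one, Real.sqrt_one,
        div_mul_div_comm, one_mul, Real.mul_self_sqrt (by positivity)]
    rw [coupledAux_eq, hc, Function.iterate_zero, id, pow_zero, pow_zero, smul_smul,
      ← Complex.ofReal_mul, hsNormSq, Finset.prod_range_zero, Finset.prod_range_zero, one_mul,
      one_mul, mul_one, sqrt_div_sqrt]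
    push_cast
    rfl
  · rw [Finset.range_eq_Ico, Finset.sum_Ico_add' (fun l =>
      ((c l * √((2 * (l : ℝ) + 1) / ((n : ℝ) + 1)) : ℝ) : ℂ) • coupledAux n l l)]
    exact Finset.sum_congr rfl fun l _ => by rw [coupled, sub_zero, Int.toNat_natCast]

theorem torus_mul_kernel (hc : c 0 = 1) {τ : ℂ} (hτ : τ ≠ 0) :
    torus n τ * kernel n c = kernel n c * torus n τ := by
  rw [kernel_eq hc, Finset.mul_sum, Finset.sum_mul]
  refine Finset.sum_congr rfl fun l _ => ?_
  rw [mul_smul_comm, smul_mul_assoc, coupledAux_eq, mul_smul_comm, smul_mul_assoc,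
    smul_right_injective _ (pow_ne_zero l hτ) (torus_mul_iterate n τ l l)]

theorem trace_mul_kernel (hc : c 0 = 1) {l : ℕ} (hl : l ≤ n) :
    ((adMinus n)^[l] (Jplus n ^ l) * kernel n c).trace =
      ((c l * ratioNum n l * (l.factorial * ((n : ℝ) + 1) ^ l) * (-1) ^ l : ℝ) : ℂ) := by
  rw [kernel_eq hc, Finset.mul_sum, Matrix.trace_sum,
    Finset.sum_eq_single_of_mem l (Finset.mem_range_succ_iff.mpr hl)]
  · have hs : √(hsNormSq n l) ≠ 0 := (Real.sqrt_pos.mpr (hsNormSq_pos n hl)).ne'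
    have hs2 : hsNormSq n l = √(hsNormSq n l) ^ 2 := (Real.sq_sqrt (hsNormSq_pos n hl).le).symm
    rw [mul_smul_comm, coupledAux_eq, mul_smul_comm, Matrix.trace_smul, Matrix.trace_smul,
      trace_adMinus_iterate_Jplus_pow_mul_self, ratioNum_eq hl, smul_eq_mul, smul_eq_mul, hs2,
      Real.sqrt_sq (Real.sqrt_nonneg _)]
    norm_cast
    push_cast
    field_simp
  · intro l' _ hne
    rw [mul_smul_comm, coupledAux_eq, mul_smul_comm, Matrix.trace_smul, Matrix.trace_smul,
      trace_adMinus_iterate_Jplus_pow_mul_of_ne n hne.symm, smul_zero, smul_zero]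

end Kernel

/-! ### The symbols of the operators `[J₋, ·]^k J₊^l` -/

theorem hasFDerivAt_eval {σ E : Type*} [Fintype σ] [NormedAddCommGroup E] [NormedSpace ℝ E]
    {u : E → σ → ℂ} {u' : σ → E →L[ℝ] ℂ} {x : E}
    (hu : ∀ j, HasFDerivAt (fun y => u y j) (u' j) x) (F : MvPolynomial σ ℂ) :
    HasFDerivAt (fun y => MvPolynomial.eval (u y) F)
      (∑ j, MvPolynomial.eval (u x) (MvPolynomial.pderiv j F) • u' j) x := by
  classical
  induction F using MvPolynomial.induction_on with
  | C a =>
    simp only [MvPolynomial.eval_C]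
    exact (hasFDerivAt_const a x).congr_fderiv (ContinuousLinearMap.ext fun v => by simp)
  | add p q hp hq =>
    simp only [map_add]
    refine (hp.add hq).congr_fderiv ?_
    rw [← Finset.sum_add_distrib]
    exact Finset.sum_congr rfl fun j _ => (add_smul _ _ _).symm
  | mul_X p i hp =>
    simp only [map_mul, MvPolynomial.eval_X]
    refine (hp.mul (hu i)).congr_fderiv (ContinuousLinearMap.ext fun v => ?_)
    simp [MvPolynomial.pderiv_X, Pi.single_apply, apply_ite, add_mul, mul_assoc,
      Finset.sum_add_distrib, Finset.mul_sum]

theorem hasDerivAt_eval {σ : Type*} [Fintype σ] {u : ℝ → σ → ℂ} {u' : σ → ℂ} {t : ℝ}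
    (hu : ∀ j, HasDerivAt (fun s => u s j) (u' j) t) (F : MvPolynomial σ ℂ) :
    HasDerivAt (fun s => MvPolynomial.eval (u s) F)
      (∑ j, u' j * MvPolynomial.eval (u t) (MvPolynomial.pderiv j F)) t := by
  refine (hasFDerivAt_eval (fun j => (hu j).hasFDerivAt) F).hasDerivAt.congr_deriv ?_
  simp [mul_comm]

theorem lowering_eq (F : MvPolynomial (Fin 3) ℂ) :
    lowering F = -MvPolynomial.X 2 * MvPolynomial.pderiv 0 F +
      (Complex.I • MvPolynomial.X 2) * MvPolynomial.pderiv 1 F +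
      (MvPolynomial.X 0 - Complex.I • MvPolynomial.X 1) * MvPolynomial.pderiv 2 F := by
  have : lowering = (-MvPolynomial.X 2 : MvPolynomial (Fin 3) ℂ) • MvPolynomial.pderiv 0 +
      (Complex.I • MvPolynomial.X 2 : MvPolynomial (Fin 3) ℂ) • MvPolynomial.pderiv 1 +
      (MvPolynomial.X 0 - Complex.I • MvPolynomial.X 1 : MvPolynomial (Fin 3) ℂ) •
        MvPolynomial.pderiv 2 := by
    refine MvPolynomial.derivation_ext fun i => ?_
    fin_cases i <;> simp [lowering, MvPolynomial.mkDerivation_X, MvPolynomial.pderiv_X, Pi.single,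
      Function.update]
  simp only [this, Derivation.add_apply, Derivation.smul_apply, smul_eq_mul]

theorem rot_smul (v : Fin 3 → ℝ) (t : ℝ) :
    rot (t • v) = NormedSpace.exp (t • ∑ k, v k • L k) := by
  simp only [rot, Pi.smul_apply, smul_eq_mul, mul_smul, Finset.smul_sum]

theorem rot_mulVec_mem_sphere (v : Fin 3 → ℝ) (x : S2) :
    WithLp.toLp 2 (rot v *ᵥ (x : E3).ofLp) ∈ Metric.sphere (0 : E3) 1 := by
  have hx := x.2
  rw [mem_sphere_zero_iff_norm, EuclideanSpace.norm_eq, Real.sqrt_eq_one] at hx ⊢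
  simp only [Real.norm_eq_abs, sq_abs] at hx ⊢
  have sum_sq (w : Fin 3 → ℝ) : ∑ i, w i ^ 2 = w ⬝ᵥ w := by simp [dotProduct, sq]
  have rot_neg_mul_rot : rot (-v) * rot v = 1 := by simpa using rot_mul_rot_neg (-v)
  rw [sum_sq] at hx ⊢
  rw [Matrix.dotProduct_mulVec, Matrix.vecMul_mulVec, ← rot_neg, rot_neg_mul_rot,
    Matrix.vecMul_one, hx]

theorem spinRot_smul (n : ℕ) (v : Fin 3 → ℝ) (t : ℝ) :
    spinRot n (t • v) = NormedSpace.exp (t • ((-Complex.I) • dotJ n fun k => (v k : ℂ))) := by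
  rw [spinRot_eq]
  congr 1
  simp only [dotJ, Pi.smul_apply, smul_eq_mul, Complex.ofReal_mul, mul_smul, Finset.smul_sum,
    Complex.coe_smul]
  exact Finset.sum_congr rfl fun k _ => smul_comm _ _ _

theorem spinRot_neg_smul (n : ℕ) (v : Fin 3 → ℝ) (t : ℝ) :
    spinRot n (-(t • v)) = NormedSpace.exp (t • -((-Complex.I) • dotJ n fun k => (v k : ℂ))) := by
  rw [← neg_smul, spinRot_smul, neg_smul, smul_neg]

theorem hasDerivAt_exp_mul_mul_exp_neg {𝔸 : Type*} [NormedRing 𝔸] [NormedAlgebra ℝ 𝔸]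
    [CompleteSpace 𝔸] (X P : 𝔸) :
    HasDerivAt (fun t : ℝ => NormedSpace.exp (t • X) * P * NormedSpace.exp (t • -X))
      (X * P - P * X) 0 := by
  refine (((hasDerivAt_exp_smul_const X (0 : ℝ)).mul_const P).mul
    (hasDerivAt_exp_smul_const (-X) (0 : ℝ))).congr_deriv ?_
  simp only [zero_smul, NormedSpace.exp_zero, one_mul, mul_one, mul_neg, sub_eq_add_neg]

section Symbol

attribute [local instance] Matrix.linftyOpNormedRing Matrix.linftyOpNormedAlgebra

theorem hasDerivAt_eval_rot_mulVec (v w : Fin 3 → ℝ) (F : MvPolynomial (Fin 3) ℂ) :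
    HasDerivAt (fun t : ℝ => MvPolynomial.eval (fun j => ((rot (t • v) *ᵥ w) j : ℂ)) F)
      (∑ j, ((v ⨯₃ w) j : ℂ) *
        MvPolynomial.eval (fun j => (w j : ℂ)) (MvPolynomial.pderiv j F)) 0 := by
  have rot_zero_mulVec : rot ((0 : ℝ) • v) *ᵥ w = w := by
    rw [rot_smul, zero_smul, NormedSpace.exp_zero, Matrix.one_mulVec]
  refine (hasDerivAt_eval (u' := fun j => ((v ⨯₃ w) j : ℂ)) (fun j => ?_) F).congr_deriv
    (by rw [rot_zero_mulVec])
  let ψ : Matrix (Fin 3) (Fin 3) ℝ →ₗ[ℝ] ℝ :=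
    { toFun := fun M => (M *ᵥ w) j
      map_add' := fun M M' => by rw [Matrix.add_mulVec]; rfl
      map_smul' := fun r M => by rw [Matrix.smul_mulVec]; rfl }
  have hψ := ((LinearMap.toContinuousLinearMap ψ).hasFDerivAt.comp_hasDerivAt (0 : ℝ)
    (hasDerivAt_exp_smul_const (∑ k, v k • L k) (0 : ℝ))).ofReal_comp
  simp only [zero_smul, NormedSpace.exp_zero, one_mul] at hψ
  rw [← sum_smul_L_mulVec]
  refine hψ.congr_of_eventuallyEq (Eventually.of_forall fun t => ?_)
  simp only [rot_smul]
  rfl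

variable {n : ℕ} (W : SymbolCorrespondence n)

theorem symbol_conj_spinRot (P : Op n) (v : Fin 3 → ℝ) (x : S2) :
    W.symbol (spinRot n v * P * spinRot n (-v)) x =
      W.symbol P ⟨_, rot_mulVec_mem_sphere (-v) x⟩ :=
  W.equivariant P v ⟨_, rot_mulVec_mem_sphere (-v) x⟩ x
    (by rw [Matrix.mulVec_mulVec, rot_mul_rot_neg, Matrix.one_mulVec])

-- Differentiate the equivariance identity along the one-parameter group of `v` at `0`.
theorem symbol_lie_dotJ {P : Op n} {F : MvPolynomial (Fin 3) ℂ}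
    (h : ∀ x, W.symbol P x = MvPolynomial.eval (pt x) F) (v : Fin 3 → ℝ) (x : S2) :
    W.symbol ⁅dotJ n (fun k => (v k : ℂ)), P⁆ x =
      -Complex.I * ∑ j, ((v ⨯₃ (x : E3).ofLp) j : ℂ) *
        MvPolynomial.eval (pt x) (MvPolynomial.pderiv j F) := by
  set X : Op n := (-Complex.I) • dotJ n fun k => (v k : ℂ) with hX
  let φ : Op n →ₗ[ℝ] ℂ := ((LinearMap.proj x).comp W.symbol).restrictScalars ℝ
  have hasDerivAt_conj : HasDerivAt
      (fun t : ℝ => φ (NormedSpace.exp (t • X) * P * NormedSpace.exp (t • -X)))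
      (φ (X * P - P * X)) 0 :=
    (LinearMap.toContinuousLinearMap φ).hasFDerivAt.comp_hasDerivAt (0 : ℝ)
      (hasDerivAt_exp_mul_mul_exp_neg X P)
  have conj_eq (t : ℝ) : φ (NormedSpace.exp (t • X) * P * NormedSpace.exp (t • -X)) =
      MvPolynomial.eval (fun j => ((rot (t • -v) *ᵥ (x : E3).ofLp) j : ℂ)) F := by
    rw [← spinRot_smul, ← spinRot_neg_smul, smul_neg]
    exact (symbol_conj_spinRot W P (t • v) x).trans (h _)
  have symbol_lie_X : W.symbol (X * P - P * X) x = _ :=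
    (hasDerivAt_conj.congr_of_eventuallyEq
      (Eventually.of_forall fun t => (conj_eq t).symm)).unique
        (hasDerivAt_eval_rot_mulVec (-v) (x : E3).ofLp F)
  have dotJ_eq_I_smul : dotJ n (fun k => (v k : ℂ)) = Complex.I • X := by
    rw [hX, smul_smul, mul_neg, Complex.I_mul_I, neg_neg, one_smul]
  rw [dotJ_eq_I_smul, smul_lie, LieRing.of_associative_ring_bracket, map_smul, Pi.smul_apply,
    symbol_lie_X, smul_eq_mul]
  simp only [map_neg, LinearMap.neg_apply, Pi.neg_apply, Complex.ofReal_neg, neg_mul,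
    Finset.sum_neg_distrib, mul_neg]
  rfl

theorem symbol_adMinus {P : Op n} {F : MvPolynomial (Fin 3) ℂ}
    (h : ∀ x, W.symbol P x = MvPolynomial.eval (pt x) F) (x : S2) :
    W.symbol (adMinus n P) x = MvPolynomial.eval (pt x) (lowering F) := by
  have Jminus_eq : Jminus n = dotJ n (fun k => ((![1, 0, 0] : Fin 3 → ℝ) k : ℂ)) -
      Complex.I • dotJ n (fun k => ((![0, 1, 0] : Fin 3 → ℝ) k : ℂ)) := by
    simp only [dotJ_eq, Matrix.cons_val, Complex.ofReal_zero, Complex.ofReal_one]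
    match_scalars <;> ring_nf <;> simp only [Complex.I_sq] <;> ring
  rw [ad_apply, Jminus_eq, sub_lie, smul_lie, map_sub, map_smul, Pi.sub_apply, Pi.smul_apply,
    symbol_lie_dotJ W h, symbol_lie_dotJ W h, lowering_eq]
  simp only [cross_apply, Matrix.cons_val, Fin.sum_univ_three, smul_eq_mul, map_add, map_sub,
    map_mul, map_neg, MvPolynomial.eval_X, MvPolynomial.smul_eval, pt]
  push_cast
  ring_nf
  simp only [Complex.I_sq]
  ring

theorem spinRot_neg_mul_dotJ_single_mul_spinRot (v : Fin 3 → ℝ) (i : Fin 3) :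
    spinRot n (-v) * dotJ n (fun k => ((Pi.single i 1 : Fin 3 → ℝ) k : ℂ)) * spinRot n v =
      dotJ n (fun b => (rot v i b : ℂ)) := by
  rw [spinRot_mul_dotJ, mul_assoc, spinRot_neg_mul_spinRot, mul_one, rot_neg]
  simp only [Matrix.mulVec_single_one, Matrix.col_apply, Matrix.transpose_apply]

theorem spinRot_neg_mul_Jplus_mul_spinRot (v : Fin 3 → ℝ) :
    spinRot n (-v) * Jplus n * spinRot n v =
      dotJ n (fun b => (rot v 0 b : ℂ) + Complex.I * rot v 1 b) := by
  have Jplus_eq : Jplus n = dotJ n (fun k => ((Pi.single 0 1 : Fin 3 → ℝ) k : ℂ)) +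
      Complex.I • dotJ n (fun k => ((Pi.single 1 1 : Fin 3 → ℝ) k : ℂ)) := by
    rw [dotJ_eq, dotJ_eq]
    simp only [Pi.single_apply, Fin.isValue, Fin.reduceEq, if_true, if_false, Complex.ofReal_one,
      Complex.ofReal_zero]
    match_scalars <;> ring_nf <;> simp only [Complex.I_sq] <;> ring
  rw [Jplus_eq, mul_add, add_mul, spinRot_neg_mul_dotJ_single_mul_spinRot, mul_smul_comm,
    smul_mul_assoc, spinRot_neg_mul_dotJ_single_mul_spinRot]
  simp only [dotJ, Finset.smul_sum, ← Finset.sum_add_distrib, smul_smul, ← add_smul]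

theorem rot_row_isotropic (v : Fin 3 → ℝ) :
    ((rot v 0 0 : ℂ) + Complex.I * rot v 1 0) ^ 2 + ((rot v 0 1 : ℂ) + Complex.I * rot v 1 1) ^ 2 +
      ((rot v 0 2 : ℂ) + Complex.I * rot v 1 2) ^ 2 = 0 := by
  have orthonormal (i j : Fin 3) : (rot v i 0 : ℂ) * rot v j 0 + rot v i 1 * rot v j 1 +
      rot v i 2 * rot v j 2 = ((1 : Matrix (Fin 3) (Fin 3) ℝ) i j : ℂ) := by
    rw [← rot_mul_rot_neg v, rot_neg, Matrix.mul_apply, Fin.sum_univ_three]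
    simp only [Matrix.transpose_apply]
    push_cast
    rfl
  have e00 := orthonormal 0 0
  have e11 := orthonormal 1 1
  have e01 := orthonormal 0 1
  rw [Matrix.one_apply_eq, Complex.ofReal_one] at e00 e11
  rw [Matrix.one_apply_ne zero_ne_one, Complex.ofReal_zero] at e01
  linear_combination e00 - e11 + 2 * Complex.I * e01 +
    ((rot v 1 0 : ℂ) ^ 2 + (rot v 1 1 : ℂ) ^ 2 + (rot v 1 2 : ℂ) ^ 2) * Complex.I_sq

-- A rotation conjugates `J₊` to `a · J` with `a` isotropic, whose powers the kernel, being
-- invariant under rotations about the third axis, sees only through `a₂`.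
theorem symbol_Jplus_pow {c : ℕ → ℝ} (hc : c 0 = 1) (hW : W.HasCharacteristicNumbers c) (l : ℕ) :
    ∃ μ : ℂ, ∀ x, W.symbol (Jplus n ^ l) x = μ * MvPolynomial.eval (pt x) (xplus ^ l) := by
  refine ⟨((Jthree n + (1 / 2 : ℂ) • Jplus n + (-1 / 2 : ℂ) • Jminus n) ^ l *
    kernel n c).trace, fun x => ?_⟩
  obtain ⟨v, hv⟩ := exists_rot_northPole x
  let a : Fin 3 → ℂ := fun b => (rot v 0 b : ℂ) + Complex.I * rot v 1 b
  have a_isotropic : a 0 ^ 2 + a 1 ^ 2 + a 2 ^ 2 = 0 := rot_row_isotropic v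
  have conj_Jplus_pow : spinRot n (-v) * Jplus n ^ l * spinRot n v = dotJ n a ^ l := by
    have semiconj : SemiconjBy (spinRot n (-v)) (Jplus n) (dotJ n a) := by
      rw [SemiconjBy, ← spinRot_neg_mul_Jplus_mul_spinRot, mul_assoc _ _ (spinRot n (-v)),
        spinRot_mul_spinRot_neg, mul_one]
    rw [(semiconj.pow_right l).eq, mul_assoc, spinRot_neg_mul_spinRot, mul_one]
  have a_two : a 2 = MvPolynomial.eval (pt x) xplus := by
    simp [eval_xplus, pt, hv, a, Matrix.mulVec, dotProduct, Fin.sum_univ_three, northPole]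
  calc W.symbol (Jplus n ^ l) x
      = (Jplus n ^ l * (spinRot n v * kernel n c * spinRot n (-v))).trace := hW _ v x hv
    _ = (spinRot n (-v) * Jplus n ^ l * spinRot n v * kernel n c).trace := by
      rw [← mul_assoc, Matrix.trace_mul_comm]
      simp only [mul_assoc]
    _ = _ := by
      rw [conj_Jplus_pow, trace_isotropic_pow_mul (fun _ hτ => torus_mul_kernel hc hτ) a_isotropic,
        a_two, map_pow, mul_comm]

/-- The rescaled operators `[J₋, ·]^k (2J₊/(n+1))^l`, whose symbols are proportional to
`bPoly l k`. -/
def bOp (n l k : ℕ) : Op n := (adMinus n)^[k] (((2 / ((n : ℂ) + 1)) • Jplus n) ^ l)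

theorem adMinus_bOp (n l k : ℕ) : adMinus n (bOp n l k) = bOp n l (k + 1) := by
  rw [bOp, bOp, Function.iterate_succ_apply']

theorem bOp_eq (n l k : ℕ) :
    bOp n l k = (2 / ((n : ℂ) + 1)) ^ l • (adMinus n)^[k] (Jplus n ^ l) := by
  rw [bOp, smul_pow]
  induction k with
  | zero => rfl
  | succ k ih => rw [Function.iterate_succ_apply', ih, map_smul, Function.iterate_succ_apply']

theorem symbol_bOp_of_symbol_bOp_zero {d : ℂ} {l : ℕ}
    (h : ∀ x, W.symbol (bOp n l 0) x = d * MvPolynomial.eval (pt x) (bPoly l 0)) (k : ℕ) (x : S2) :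
    W.symbol (bOp n l k) x = d * MvPolynomial.eval (pt x) (bPoly l k) := by
  induction k generalizing x with
  | zero => exact h x
  | succ k ih =>
    have symbol_bOp_succ := symbol_adMinus W (P := bOp n l k) (F := d • bPoly l k)
      (fun y => by rw [ih, MvPolynomial.smul_eval]) x
    rwa [adMinus_bOp, Derivation.map_smul, lowering_bPoly, MvPolynomial.smul_eval]
      at symbol_bOp_succ

theorem symbol_northPole {c : ℕ → ℝ} (hW : W.HasCharacteristicNumbers c) (P : Op n) :
    W.symbol P northPole = (P * kernel n c).trace := by
  have rot_zero : rot 0 = 1 := by simp [rot]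
  have spinRot_zero : spinRot n 0 = 1 := by simp [spinRot]
  rw [hW _ 0 northPole (by rw [rot_zero, Matrix.one_mulVec]), conjOp, neg_zero, spinRot_zero,
    one_mul, mul_one]

/-- The numbers `d l` are the factors by which the symbol correspondence `W` scales the spherical
harmonics: the symbol of the operator `bOp n l k` is `d l` times the polynomial `bPoly l k`. -/
def IsSymbolScale (d : ℕ → ℂ) : Prop :=
  ∀ l k x, W.symbol (bOp n l k) x = d l * MvPolynomial.eval (pt x) (bPoly l k)

theorem exists_isSymbolScale {c : ℕ → ℝ} (hc : c 0 = 1) (hW : W.HasCharacteristicNumbers c) :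
    ∃ d : ℕ → ℂ, IsSymbolScale W d ∧ ∀ l ≤ n, d l = ((c l * ratioNum n l : ℝ) : ℂ) := by
  choose μ hμ using symbol_Jplus_pow W hc hW
  have symbol_bOp : IsSymbolScale W fun l => (2 / ((n : ℂ) + 1)) ^ l * μ l := by
    refine fun l => symbol_bOp_of_symbol_bOp_zero W fun x => ?_
    rw [bOp_eq, map_smul, Pi.smul_apply, Function.iterate_zero, id, hμ, smul_eq_mul, mul_assoc]
    rfl
  refine ⟨_, symbol_bOp, fun l hl => ?_⟩
  have at_northPole := symbol_bOp l l northPole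
  rw [symbol_northPole W hW, bOp_eq, smul_mul_assoc, Matrix.trace_smul, trace_mul_kernel hc hl,
    eval_northPole_bPoly, smul_eq_mul] at at_northPole
  have factorial_mul_ne_zero : (l.factorial : ℂ) * (-2) ^ l ≠ 0 :=
    mul_ne_zero (mod_cast l.factorial_ne_zero) (pow_ne_zero _ (by norm_num))
  have hN : (n : ℂ) + 1 ≠ 0 := Nat.cast_add_one_ne_zero n
  refine mul_right_cancel₀ factorial_mul_ne_zero (at_northPole.symm.trans ?_)
  rw [div_pow, neg_pow (2 : ℂ)]
  push_cast
  field_simp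

end Symbol

/-! ### The Poisson bracket of polynomials -/

section PoissonPoly

open MvPolynomial

/-- The Poisson bracket of polynomials in `x, y, z`, with `{x, y} = z` and cyclically, as a
derivation in its second argument. -/
def poissonPoly (F : MvPolynomial (Fin 3) ℂ) :
    Derivation ℂ (MvPolynomial (Fin 3) ℂ) (MvPolynomial (Fin 3) ℂ) :=
  (X 1 * pderiv 2 F - X 2 * pderiv 1 F) • pderiv 0 +
    (X 2 * pderiv 0 F - X 0 * pderiv 2 F) • pderiv 1 +
    (X 0 * pderiv 1 F - X 1 * pderiv 0 F) • pderiv 2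

theorem poissonPoly_apply (F G : MvPolynomial (Fin 3) ℂ) :
    poissonPoly F G = (X 1 * pderiv 2 F - X 2 * pderiv 1 F) * pderiv 0 G +
      (X 2 * pderiv 0 F - X 0 * pderiv 2 F) * pderiv 1 G +
      (X 0 * pderiv 1 F - X 1 * pderiv 0 F) * pderiv 2 G := rfl

theorem poissonPoly_comm (F G : MvPolynomial (Fin 3) ℂ) :
    poissonPoly F G = -poissonPoly G F := by
  simp only [poissonPoly_apply]
  ring

theorem poissonPoly_self (F : MvPolynomial (Fin 3) ℂ) : poissonPoly F F = 0 := by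
  rw [poissonPoly_apply]
  ring

theorem poissonPoly_zero_left (G : MvPolynomial (Fin 3) ℂ) : poissonPoly 0 G = 0 := by
  rw [poissonPoly_comm, map_zero, neg_zero]

theorem poissonPoly_one_left (G : MvPolynomial (Fin 3) ℂ) : poissonPoly 1 G = 0 := by
  rw [poissonPoly_comm, Derivation.map_one_eq_zero, neg_zero]

theorem poissonPoly_add_left (F F' G : MvPolynomial (Fin 3) ℂ) :
    poissonPoly (F + F') G = poissonPoly F G + poissonPoly F' G := by
  rw [poissonPoly_comm, map_add, neg_add, ← poissonPoly_comm, ← poissonPoly_comm]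

theorem poissonPoly_smul_left (a : ℂ) (F G : MvPolynomial (Fin 3) ℂ) :
    poissonPoly (a • F) G = a • poissonPoly F G := by
  rw [poissonPoly_comm, Derivation.map_smul, ← smul_neg, ← poissonPoly_comm]

theorem poissonPoly_mul_left (F F' G : MvPolynomial (Fin 3) ℂ) :
    poissonPoly (F * F') G = F * poissonPoly F' G + F' * poissonPoly F G := by
  rw [poissonPoly_comm, Derivation.leibniz, neg_add, ← smul_neg, ← smul_neg, ← poissonPoly_comm,
    ← poissonPoly_comm, smul_eq_mul, smul_eq_mul]

theorem poissonPoly_mul_right (F G G' : MvPolynomial (Fin 3) ℂ) :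
    poissonPoly F (G * G') = G * poissonPoly F G' + G' * poissonPoly F G :=
  (poissonPoly F).leibniz G G'

theorem poissonPoly_X_zero (F : MvPolynomial (Fin 3) ℂ) :
    poissonPoly F (X 0) = X 1 * pderiv 2 F - X 2 * pderiv 1 F := by
  simp [poissonPoly_apply, pderiv_X]

theorem poissonPoly_X_one (F : MvPolynomial (Fin 3) ℂ) :
    poissonPoly F (X 1) = X 2 * pderiv 0 F - X 0 * pderiv 2 F := by
  simp [poissonPoly_apply, pderiv_X]

theorem poissonPoly_X_two (F : MvPolynomial (Fin 3) ℂ) :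
    poissonPoly F (X 2) = X 0 * pderiv 1 F - X 1 * pderiv 0 F := by
  simp [poissonPoly_apply, pderiv_X]

theorem C_I_sq : (C Complex.I : MvPolynomial (Fin 3) ℂ) ^ 2 = -1 := by
  rw [← map_pow, Complex.I_sq, map_neg, map_one]

theorem poissonPoly_z_xplus : poissonPoly (X 2) xplus = (-Complex.I) • xplus := by
  rw [xplus, map_add, Derivation.map_smul, poissonPoly_X_zero, poissonPoly_X_one, pderiv_X_self,
    pderiv_X_of_ne (by decide), pderiv_X_of_ne (by decide)]
  simp only [smul_eq_C_mul, map_neg]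
  linear_combination (X 1 : MvPolynomial (Fin 3) ℂ) * C_I_sq

theorem lowering_eq_I_smul_poissonPoly : lowering = Complex.I • poissonPoly xminus := by
  refine derivation_ext fun i => ?_
  rw [Derivation.smul_apply]
  fin_cases i <;>
    simp [lowering, mkDerivation_X, poissonPoly_X_zero, poissonPoly_X_one, poissonPoly_X_two,
      xminus, pderiv_X, smul_eq_C_mul]
  · linear_combination -(X 2 : MvPolynomial (Fin 3) ℂ) * C_I_sq
  · linear_combination (X 0 : MvPolynomial (Fin 3) ℂ) * C_I_sq

theorem lie_lowering_poissonPoly (F : MvPolynomial (Fin 3) ℂ) :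
    ⁅lowering, poissonPoly F⁆ = poissonPoly (lowering F) := by
  have lie_lowering_poissonPoly_X (i : Fin 3) :
      ⁅lowering, poissonPoly (X i)⁆ = poissonPoly (lowering (X i)) := by
    refine derivation_ext fun j => ?_
    rw [Derivation.commutator_apply]
    fin_cases i <;> fin_cases j <;>
      simp [lowering, mkDerivation_X, poissonPoly_X_zero, poissonPoly_X_one, poissonPoly_X_two,
        pderiv_X, sub_eq_add_neg]
  refine derivation_ext fun i => ?_
  have at_F := DFunLike.congr_fun (lie_lowering_poissonPoly_X i) F
  rw [Derivation.commutator_apply] at at_F ⊢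
  rw [poissonPoly_comm F, poissonPoly_comm F, poissonPoly_comm (lowering F), map_neg]
  linear_combination -at_F

theorem lowering_poissonPoly (F G : MvPolynomial (Fin 3) ℂ) :
    lowering (poissonPoly F G) = poissonPoly (lowering F) G + poissonPoly F (lowering G) := by
  rw [← lie_lowering_poissonPoly, Derivation.commutator_apply, sub_add_cancel]

/-- The ideal of the sphere `x² + y² + z² = 1`. -/
def sphereIdeal : Ideal (MvPolynomial (Fin 3) ℂ) := Ideal.span {X 0 ^ 2 + X 1 ^ 2 + X 2 ^ 2 - 1}

theorem mem_sphereIdeal {F : MvPolynomial (Fin 3) ℂ} :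
    F ∈ sphereIdeal ↔ ∃ H, F = (X 0 ^ 2 + X 1 ^ 2 + X 2 ^ 2 - 1) * H :=
  Ideal.mem_span_singleton

theorem poissonPoly_mem_sphereIdeal_right {G : MvPolynomial (Fin 3) ℂ} (hG : G ∈ sphereIdeal)
    (F : MvPolynomial (Fin 3) ℂ) : poissonPoly F G ∈ sphereIdeal := by
  obtain ⟨H, rfl⟩ := mem_sphereIdeal.mp hG
  refine mem_sphereIdeal.mpr ⟨poissonPoly F H, ?_⟩
  have radius_casimir : poissonPoly F (X 0 ^ 2 + X 1 ^ 2 + X 2 ^ 2 - 1) = 0 := by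
    simp only [map_sub, map_add, Derivation.leibniz_pow, Derivation.map_one_eq_zero,
      poissonPoly_X_zero, poissonPoly_X_one, poissonPoly_X_two, smul_eq_mul, nsmul_eq_mul]
    ring
  rw [poissonPoly_mul_right, radius_casimir, mul_zero, add_zero]

theorem poissonPoly_mem_sphereIdeal_left {F : MvPolynomial (Fin 3) ℂ} (hF : F ∈ sphereIdeal)
    (G : MvPolynomial (Fin 3) ℂ) : poissonPoly F G ∈ sphereIdeal := by
  rw [poissonPoly_comm]
  exact sphereIdeal.neg_mem (poissonPoly_mem_sphereIdeal_right hF G)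

theorem lowering_mem_sphereIdeal {F : MvPolynomial (Fin 3) ℂ} (hF : F ∈ sphereIdeal) :
    lowering F ∈ sphereIdeal := by
  rw [lowering_eq_I_smul_poissonPoly, Derivation.smul_apply, smul_eq_C_mul]
  exact sphereIdeal.mul_mem_left _ (poissonPoly_mem_sphereIdeal_right hF xminus)

theorem eval_eq_zero_of_mem_sphereIdeal {F : MvPolynomial (Fin 3) ℂ} (hF : F ∈ sphereIdeal)
    {u : Fin 3 → ℂ} (hu : u 0 ^ 2 + u 1 ^ 2 + u 2 ^ 2 = 1) : eval u F = 0 := by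
  obtain ⟨H, rfl⟩ := mem_sphereIdeal.mp hF
  simp [hu]

end PoissonPoly

/-! ### Expansions of sequences of operators to first order in `1/(n+1)` -/

/-- Pairs `(F, F')` of polynomials, which stand for `F + F'/(n+1)` up to terms of order
`1/(n+1)²` and are multiplied by the star product `F ⋆ G = FG + i{F, G}/(n+1)`. -/
def StarPoly : Type := MvPolynomial (Fin 3) ℂ × MvPolynomial (Fin 3) ℂ

namespace StarPoly

instance : AddCommGroup StarPoly :=
  inferInstanceAs (AddCommGroup (MvPolynomial (Fin 3) ℂ × MvPolynomial (Fin 3) ℂ))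

instance : Module ℂ StarPoly :=
  inferInstanceAs (Module ℂ (MvPolynomial (Fin 3) ℂ × MvPolynomial (Fin 3) ℂ))

/-- The pair `(F, F')` as an element of `StarPoly`. -/
def mk (F F' : MvPolynomial (Fin 3) ℂ) : StarPoly := (F, F')

/-- The coefficient `F` of `F + F'/(n+1)`. -/
def lead : StarPoly →ₗ[ℂ] MvPolynomial (Fin 3) ℂ := LinearMap.fst ℂ _ _

/-- The coefficient `F'` of `F + F'/(n+1)`. -/
def next : StarPoly →ₗ[ℂ] MvPolynomial (Fin 3) ℂ := LinearMap.snd ℂ _ _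

@[simp] theorem lead_mk (F F' : MvPolynomial (Fin 3) ℂ) : lead (mk F F') = F := rfl

@[simp] theorem next_mk (F F' : MvPolynomial (Fin 3) ℂ) : next (mk F F') = F' := rfl

@[ext] theorem ext {a b : StarPoly} (hlead : lead a = lead b) (hnext : next a = next b) : a = b :=
  Prod.ext hlead hnext

instance : Mul StarPoly where
  mul a b := mk (lead a * lead b)
    (lead a * next b + next a * lead b + Complex.I • poissonPoly (lead a) (lead b))

instance : One StarPoly where
  one := mk 1 0

@[simp] theorem lead_mul (a b : StarPoly) : lead (a * b) = lead a * lead b := rfl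

@[simp] theorem next_mul (a b : StarPoly) : next (a * b) =
    lead a * next b + next a * lead b + Complex.I • poissonPoly (lead a) (lead b) := rfl

@[simp] theorem lead_one : lead 1 = 1 := rfl

@[simp] theorem next_one : next 1 = 0 := rfl

instance : Ring StarPoly where
  __ := (inferInstance : AddCommGroup StarPoly)
  left_distrib a b c := by
    ext1
    · simp only [lead_mul, map_add, mul_add]
    · simp only [next_mul, map_add, smul_add]
      ring
  right_distrib a b c := by
    ext1
    · simp only [lead_mul, map_add, add_mul]
    · simp only [next_mul, map_add, poissonPoly_add_left, smul_add]
      ring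
  mul_assoc a b c := by
    ext1
    · simp only [lead_mul, mul_assoc]
    · simp only [lead_mul, next_mul, poissonPoly_mul_left, poissonPoly_mul_right,
        MvPolynomial.smul_eq_C_mul]
      ring
  one_mul a := by ext1 <;> simp [poissonPoly_one_left]
  mul_one a := by ext1 <;> simp
  zero_mul a := by ext1 <;> simp [poissonPoly_zero_left]
  mul_zero a := by ext1 <;> simp

instance : Algebra ℂ StarPoly := Algebra.ofModule
  (fun r a b => by ext1 <;> simp [poissonPoly_smul_left, smul_add, smul_comm r])
  (fun r a b => by ext1 <;> simp [smul_add, smul_comm r])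

theorem lead_lie (a b : StarPoly) : lead ⁅a, b⁆ = 0 := by
  rw [LieRing.of_associative_ring_bracket, map_sub, lead_mul, lead_mul, mul_comm, sub_self]

theorem next_lie (a b : StarPoly) :
    next ⁅a, b⁆ = (2 * Complex.I) • poissonPoly (lead a) (lead b) := by
  rw [LieRing.of_associative_ring_bracket, map_sub, next_mul, next_mul, poissonPoly_comm (lead b)]
  simp only [smul_neg, mul_smul, two_smul]
  ring

/-- The action of the lowering operator on both coefficients. -/
def lower : StarPoly →ₗ[ℂ] StarPoly := (lowering : _ →ₗ[ℂ] _).prodMap (lowering : _ →ₗ[ℂ] _)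

@[simp] theorem lead_lower (a : StarPoly) : lead (lower a) = lowering (lead a) := rfl

@[simp] theorem next_lower (a : StarPoly) : next (lower a) = lowering (next a) := rfl

theorem lower_mul (a b : StarPoly) : lower (a * b) = lower a * b + a * lower b := by
  ext1
  · simp only [lead_lower, lead_mul, lowering_mul, map_add]
  · simp only [lead_lower, next_lower, next_mul, map_add, lowering_mul, Derivation.map_smul,
      lowering_poissonPoly, smul_add]
    ring

end StarPoly

/-- Pairs of a sequence of operators `A n` and an element `F + F'/(n+1)` of `StarPoly`, which is
meant to be the expansion of the symbol of `A n` in powers of `1/(n+1)`. -/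
abbrev Expansion : Type := (∀ n, Op n) × StarPoly

namespace Expansion

open StarPoly

theorem ext_components {a b : Expansion} (op : ∀ n, a.1 n = b.1 n) (hlead : lead a.2 = lead b.2)
    (hnext : next a.2 = next b.2) : a = b :=
  Prod.ext (funext op) (StarPoly.ext hlead hnext)

/-- The scalar `1/(n+1)` as an expansion. -/
def invDim : Expansion := (fun n : ℕ => (1 / ((n : ℂ) + 1)) • 1, mk 0 1)

theorem invDim_mul (a : Expansion) :
    invDim * a = (fun n : ℕ => (1 / ((n : ℂ) + 1)) • a.1 n, mk 0 (lead a.2)) := by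
  refine ext_components (fun n => smul_one_mul _ _) (zero_mul (lead a.2)) ?_
  simp [invDim, poissonPoly_zero_left]

theorem invDim_commute (a : Expansion) : Commute invDim a :=
  ext_components (fun n => by simp [invDim]) (mul_comm _ _)
    (by simp [invDim, poissonPoly_zero_left])

/-- The action of the lowering operators on operators and polynomials. -/
def lower : Expansion →ₗ[ℂ] Expansion := (LinearMap.piMap fun n => adMinus n).prodMap StarPoly.lower

theorem lower_fst (a : Expansion) (n : ℕ) : (lower a).1 n = adMinus n (a.1 n) := rfl

theorem lower_snd (a : Expansion) : (lower a).2 = StarPoly.lower a.2 := rfl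

theorem lower_mul (a b : Expansion) : lower (a * b) = lower a * b + a * lower b :=
  Prod.ext (funext fun n => ad_mul (𝕜 := ℂ) (Jminus n) (a.1 n) (b.1 n)) (StarPoly.lower_mul _ _)

theorem lower_lie (a b : Expansion) : lower ⁅a, b⁆ = ⁅lower a, b⁆ + ⁅a, lower b⁆ := by
  simp only [LieRing.of_associative_ring_bracket, map_sub, lower_mul]
  abel

theorem lower_invDim_mul (a : Expansion) : lower (invDim * a) = invDim * lower a := by
  rw [invDim_mul, invDim_mul]
  exact ext_components (fun n => map_smul (adMinus n) _ _) (map_zero lowering) rfl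

theorem lower_invDim_pow_mul (r : ℕ) (a : Expansion) :
    lower (invDim ^ r * a) = invDim ^ r * lower a := by
  induction r with
  | zero => simp only [pow_zero, one_mul]
  | succ r ih => rw [pow_succ', mul_assoc, mul_assoc, lower_invDim_mul, ih]

/-- The expansion of the sequence of operators that quantizes a spherical harmonic. -/
def basis (l k : ℕ) : Expansion := (fun n => bOp n l k, mk (bPoly l k) 0)

theorem lower_basis (l k : ℕ) : lower (basis l k) = basis l (k + 1) :=
  ext_components (fun n => adMinus_bOp n l k) (lowering_bPoly l k) (map_zero lowering)

/-- The expansions with operators zero and polynomials vanishing on the sphere. -/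
def nullExpansions : Submodule ℂ Expansion :=
  (⊥ : Submodule ℂ (∀ n, Op n)).prod
    ((sphereIdeal.restrictScalars ℂ).comap lead ⊓ (sphereIdeal.restrictScalars ℂ).comap next)

theorem mem_nullExpansions {a : Expansion} :
    a ∈ nullExpansions ↔ a.1 = 0 ∧ lead a.2 ∈ sphereIdeal ∧ next a.2 ∈ sphereIdeal := Iff.rfl

theorem lower_mem_nullExpansions {a : Expansion} (ha : a ∈ nullExpansions) :
    lower a ∈ nullExpansions := by
  obtain ⟨op, hlead, hnext⟩ := mem_nullExpansions.mp ha
  refine ⟨funext fun n => ?_, lowering_mem_sphereIdeal hlead, lowering_mem_sphereIdeal hnext⟩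
  rw [lower_fst, op]
  exact map_zero (adMinus n)

theorem mul_mem_nullExpansions_left (a : Expansion) {b : Expansion} (hb : b ∈ nullExpansions) :
    a * b ∈ nullExpansions := by
  obtain ⟨op, hlead, hnext⟩ := mem_nullExpansions.mp hb
  refine ⟨(congrArg (a.1 * ·) op).trans (mul_zero _), sphereIdeal.mul_mem_left _ hlead, ?_⟩
  exact add_mem (add_mem (sphereIdeal.mul_mem_left _ hnext) (sphereIdeal.mul_mem_left _ hlead))
    (Submodule.smul_of_tower_mem _ _ (poissonPoly_mem_sphereIdeal_right hlead _))

theorem mul_mem_nullExpansions_right {a : Expansion} (ha : a ∈ nullExpansions) (b : Expansion) :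
    a * b ∈ nullExpansions := by
  obtain ⟨op, hlead, hnext⟩ := mem_nullExpansions.mp ha
  refine ⟨(congrArg (· * b.1) op).trans (zero_mul _), sphereIdeal.mul_mem_right _ hlead, ?_⟩
  exact add_mem (add_mem (sphereIdeal.mul_mem_right _ hlead) (sphereIdeal.mul_mem_right _ hnext))
    (Submodule.smul_of_tower_mem _ _ (poissonPoly_mem_sphereIdeal_left hlead _))

/-- The expansions of sequences in the span of the operators `bOp n l k`, with coefficients
polynomial in `1/(n+1)`. -/
def expansions : Submodule ℂ Expansion :=
  Submodule.span ℂ (Set.range fun q : ℕ × ℕ × ℕ => invDim ^ q.1 * basis q.2.1 q.2.2) ⊔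
    nullExpansions

theorem invDim_pow_mul_basis_mem (r l k : ℕ) : invDim ^ r * basis l k ∈ expansions :=
  Submodule.mem_sup_left (Submodule.subset_span ⟨(r, l, k), rfl⟩)

theorem basis_mem (l k : ℕ) : basis l k ∈ expansions := by
  simpa only [pow_zero, one_mul] using invDim_pow_mul_basis_mem 0 l k

theorem map_mem (φ : Expansion →ₗ[ℂ] Expansion)
    (map_basis : ∀ r l k, φ (invDim ^ r * basis l k) ∈ expansions)
    (map_null : ∀ a ∈ nullExpansions, φ a ∈ nullExpansions) {a : Expansion} (ha : a ∈ expansions) :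
    φ a ∈ expansions := by
  suffices expansions ≤ expansions.comap φ from this ha
  refine sup_le (Submodule.span_le.mpr ?_) fun a ha => Submodule.mem_sup_right (map_null a ha)
  rintro _ ⟨⟨r, l, k⟩, rfl⟩
  exact map_basis r l k

theorem invDim_mul_mem {a : Expansion} (ha : a ∈ expansions) : invDim * a ∈ expansions := by
  refine map_mem (LinearMap.mulLeft ℂ invDim) (fun r l k => ?_)
    (fun a ha => mul_mem_nullExpansions_left invDim ha) ha
  rw [LinearMap.mulLeft_apply, ← mul_assoc, ← pow_succ']
  exact invDim_pow_mul_basis_mem (r + 1) l k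

theorem invDim_pow_mul_mem {a : Expansion} (ha : a ∈ expansions) (r : ℕ) :
    invDim ^ r * a ∈ expansions := by
  induction r with
  | zero => rwa [pow_zero, one_mul]
  | succ r ih =>
    rw [pow_succ', mul_assoc]
    exact invDim_mul_mem ih

theorem lower_mem {a : Expansion} (ha : a ∈ expansions) : lower a ∈ expansions := by
  refine map_mem lower (fun r l k => ?_) (fun a ha => lower_mem_nullExpansions ha) ha
  rw [lower_invDim_pow_mul, lower_basis]
  exact invDim_pow_mul_basis_mem r l (k + 1)

theorem mul_mem_of_basis {a : Expansion} (ha : ∀ l k, a * basis l k ∈ expansions) {b : Expansion}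
    (hb : b ∈ expansions) : a * b ∈ expansions := by
  refine map_mem (LinearMap.mulLeft ℂ a) (fun r l k => ?_)
    (fun b hb => mul_mem_nullExpansions_left a hb) hb
  rw [LinearMap.mulLeft_apply, ((invDim_commute a).pow_left r).symm.left_comm]
  exact invDim_pow_mul_mem (ha l k) r

end Expansion

section LevelOne

variable (n : ℕ)

theorem bOp_zero_right (l : ℕ) : bOp n l 0 = ((2 / ((n : ℂ) + 1)) • Jplus n) ^ l := rfl

theorem bOp_one_one : bOp n 1 1 = (-4 / ((n : ℂ) + 1)) • Jthree n := by
  rw [bOp_eq, pow_one, pow_one, Function.iterate_one, (isSpinTriple_J n).ad_f_e ℂ, smul_smul]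
  congr 1
  ring

theorem bOp_one_two : bOp n 1 2 = (-4 / ((n : ℂ) + 1)) • Jminus n := by
  rw [← adMinus_bOp, bOp_one_one, map_smul, (isSpinTriple_J n).ad_f_h ℂ]

theorem bOp_eq_zero {l k : ℕ} (hk : 2 * l < k) : bOp n l k = 0 := by
  rw [bOp_eq, (isSpinTriple_J n).ad_f_iterate_e_pow_eq_zero ℂ hk, smul_zero]

theorem bPoly_zero_right (l : ℕ) : bPoly l 0 = xplus ^ l := rfl

theorem bPoly_one_right (l : ℕ) :
    bPoly l 1 = (-2 * (l : ℂ)) • (MvPolynomial.X 2 * xplus ^ (l - 1)) := by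
  rw [← lowering_bPoly, bPoly_zero_right, Derivation.leibniz_pow, lowering_xplus]
  simp only [smul_eq_mul, MvPolynomial.smul_eq_C_mul, nsmul_eq_mul, map_mul, map_natCast]
  ring

theorem bPoly_one_one : bPoly 1 1 = (-2 : ℂ) • MvPolynomial.X 2 := by
  simp [bPoly_one_right]

theorem bPoly_one_two : bPoly 1 2 = (-2 : ℂ) • xminus := by
  rw [← lowering_bPoly, bPoly_one_one, Derivation.map_smul, lowering_z]

theorem xminus_mul_xplus :
    xminus * xplus = (MvPolynomial.X 0 ^ 2 + MvPolynomial.X 1 ^ 2 : MvPolynomial (Fin 3) ℂ) := by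
  simp only [xminus, xplus, MvPolynomial.smul_eq_C_mul]
  linear_combination -(MvPolynomial.X 1 : MvPolynomial (Fin 3) ℂ) ^ 2 * C_I_sq

theorem bPoly_succ_two (l : ℕ) :
    bPoly (l + 1) 2 = (-2 * ((l : ℂ) + 1)) • (xminus * xplus ^ l) +
      (4 * ((l : ℂ) + 1) * l) • (MvPolynomial.X 2 ^ 2 * xplus ^ (l - 1)) := by
  rw [← lowering_bPoly, bPoly_one_right, Derivation.map_smul, Derivation.leibniz, lowering_z,
    Derivation.leibniz_pow, lowering_xplus, Nat.add_sub_cancel]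
  simp only [smul_eq_mul, MvPolynomial.smul_eq_C_mul, nsmul_eq_mul, map_mul, map_add, map_neg,
    map_natCast, Nat.cast_add, map_one, Nat.cast_one, map_ofNat]
  ring

theorem bOp_one_two_mul_bOp_zero (l : ℕ) : bOp n 1 2 * bOp n l 0 =
    (1 / ((2 * (l : ℂ) + 1) * (l + 1))) • bOp n (l + 1) 2 - (2 / ((n : ℂ) + 1)) • bOp n l 1 -
      (4 * (l : ℂ) / (2 * l + 1) * (1 - (l : ℂ) ^ 2 / ((n : ℂ) + 1) ^ 2)) • bOp n (l - 1) 0 := by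
  have l_add_one_ne_zero : (l : ℂ) + 1 ≠ 0 := Nat.cast_add_one_ne_zero l
  have two_l_add_one_ne_zero : 2 * (l : ℂ) + 1 ≠ 0 := mod_cast (2 * l).cast_add_one_ne_zero (R := ℂ)
  have dim_ne_zero : (n : ℂ) + 1 ≠ 0 := Nat.cast_add_one_ne_zero n
  have four_l_add_two : 4 * (l : ℂ) + 2 = 2 * (2 * l + 1) := by ring
  rw [bOp_one_two, bOp_eq n l 0, bOp_eq n l 1, bOp_eq n (l + 1) 2, bOp_eq n (l - 1) 0,
    Function.iterate_zero, id, Function.iterate_one, smul_mul_assoc, mul_smul_comm,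
    Jminus_mul_Jplus_pow, four_l_add_two]
  generalize (n : ℂ) + 1 = N at dim_ne_zero
  simp only [Function.iterate_succ, Function.iterate_zero, Function.comp, id]
  cases l with
  | zero =>
    simp only [Nat.cast_zero, mul_zero, zero_add]
    match_scalars <;> field_simp <;> ring
  | succ l =>
    simp only [Nat.add_sub_cancel, pow_succ (2 / N)]
    generalize (2 / N) ^ l = H
    generalize ((l + 1 : ℕ) : ℂ) = M at *
    match_scalars <;> field_simp <;> ring

theorem bPoly_one_two_mul_sub_mem_sphereIdeal (l : ℕ) : bPoly 1 2 * bPoly l 0 -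
    ((1 / ((2 * (l : ℂ) + 1) * (l + 1))) • bPoly (l + 1) 2 -
      (4 * (l : ℂ) / (2 * l + 1)) • bPoly (l - 1) 0) ∈ sphereIdeal := by
  have l_add_one_ne_zero : (l : ℂ) + 1 ≠ 0 := Nat.cast_add_one_ne_zero l
  have two_l_add_one_ne_zero : 2 * (l : ℂ) + 1 ≠ 0 := mod_cast (2 * l).cast_add_one_ne_zero (R := ℂ)
  rw [bPoly_one_two, bPoly_succ_two, bPoly_zero_right, bPoly_zero_right]
  cases l with
  | zero => simp
  | succ l =>
    refine mem_sphereIdeal.mpr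
      ⟨(-(4 * ((l + 1 : ℕ) : ℂ) / (2 * ((l + 1 : ℕ) : ℂ) + 1))) • xplus ^ l, ?_⟩
    have radius_mul_xplus_pow : (MvPolynomial.X 0 ^ 2 + MvPolynomial.X 1 ^ 2 +
        MvPolynomial.X 2 ^ 2 - 1 : MvPolynomial (Fin 3) ℂ) * xplus ^ l =
        xminus * xplus ^ (l + 1) + MvPolynomial.X 2 ^ 2 * xplus ^ l - xplus ^ l := by
      rw [← xminus_mul_xplus]
      ring
    rw [mul_smul_comm, radius_mul_xplus_pow, Nat.add_sub_cancel, smul_mul_assoc]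
    generalize ((l + 1 : ℕ) : ℂ) = M at *
    match_scalars <;> field_simp
    ring

theorem I_smul_poissonPoly_bPoly_one_two (F : MvPolynomial (Fin 3) ℂ) :
    Complex.I • poissonPoly (bPoly 1 2) F = (-2 : ℂ) • lowering F := by
  rw [bPoly_one_two, poissonPoly_smul_left, lowering_eq_I_smul_poissonPoly, Derivation.smul_apply,
    smul_comm]

end LevelOne

namespace Expansion

open StarPoly

theorem basis_zero_zero : basis 0 0 = 1 := rfl

theorem basis_zero_succ (k : ℕ) : basis 0 (k + 1) = 0 := by
  induction k with
  | zero =>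
    refine ext_components (fun n => bOp_eq_zero n zero_lt_one) ?_ rfl
    exact (lowering_bPoly 0 0).symm.trans lowering.map_one_eq_zero
  | succ k ih => rw [← lower_basis, ih, map_zero]

theorem basis_one_three (k : ℕ) : basis 1 (k + 3) = 0 := by
  induction k with
  | zero =>
    refine ext_components (fun n => bOp_eq_zero n (by norm_num)) ?_ rfl
    change bPoly 1 (2 + 1) = 0
    rw [← lowering_bPoly, bPoly_one_two, Derivation.map_smul, lowering_xminus, smul_zero]
  | succ k ih => rw [add_right_comm, ← lower_basis, ih, map_zero]

theorem basis_succ_zero (l : ℕ) : basis (l + 1) 0 = basis 1 0 * basis l 0 := by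
  refine ext_components (fun n => ?_) ?_ ?_
  · simp only [basis, Prod.fst_mul, Pi.mul_apply, bOp_zero_right, pow_one, pow_succ' _ l]
  · change xplus ^ (l + 1) = xplus ^ 1 * xplus ^ l
    rw [pow_one, pow_succ']
  · simp [basis, bPoly_zero_right, poissonPoly_self]

theorem basis_zero_commute (l l' : ℕ) : Commute (basis l 0) (basis l' 0) := by
  have basis_zero_eq_pow (l : ℕ) : basis l 0 = basis 1 0 ^ l := by
    induction l with
    | zero => rfl
    | succ l ih => rw [basis_succ_zero, ih, pow_succ']
  rw [basis_zero_eq_pow l, basis_zero_eq_pow l']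
  exact Commute.pow_pow_self _ _ _

theorem lie_basis_one_two (a : Expansion) : ⁅basis 1 2, a⁆ = (-4 : ℂ) • (invDim * lower a) := by
  rw [invDim_mul]
  refine ext_components (fun n => ?_) ?_ ?_
  · change ⁅bOp n 1 2, a.1 n⁆ = (-4 : ℂ) • (_ • adMinus n (a.1 n))
    rw [bOp_one_two, smul_lie, ad_apply, smul_smul, mul_one_div]
  · exact (lead_lie _ _).trans (smul_zero _).symm
  · refine (next_lie _ _).trans ?_
    rw [mul_smul, basis, lead_mk, I_smul_poissonPoly_bPoly_one_two, smul_smul]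
    norm_num [lower_snd]

theorem lie_basis_one_one : ⁅basis 1 1, basis 1 0⁆ = (-4 : ℂ) • (invDim * basis 1 0) := by
  rw [invDim_mul]
  refine ext_components (fun n => ?_) ?_ ?_
  · change ⁅bOp n 1 1, bOp n 1 0⁆ = (-4 : ℂ) • (_ • bOp n 1 0)
    rw [bOp_one_one, bOp_zero_right, pow_one, smul_lie, lie_smul, (isSpinTriple_J n).lie_h_e,
      smul_smul, smul_smul, smul_smul, mul_one_div]
  · exact (lead_lie _ _).trans (smul_zero _).symm
  · refine (next_lie _ _).trans ?_
    simp only [basis, lead_mk, bPoly_one_one, bPoly_zero_right, pow_one, poissonPoly_smul_left,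
      poissonPoly_z_xplus, Prod.smul_mk, map_smul, next_mk]
    match_scalars
    linear_combination (4 : ℂ) * Complex.I_sq

theorem basis_one_one_mul_basis_one_zero :
    basis 1 1 * basis 1 0 = basis 1 0 * basis 1 1 - (4 : ℂ) • (invDim * basis 1 0) := by
  have commutator := lie_basis_one_one
  rw [LieRing.of_associative_ring_bracket, sub_eq_iff_eq_add, neg_smul] at commutator
  rw [commutator, neg_add_eq_sub]

theorem basis_succ_one (l : ℕ) : basis (l + 1) 1 =
    ((l : ℂ) + 1) • (basis 1 1 * basis l 0 + (2 * (l : ℂ)) • (invDim * basis l 0)) := by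
  induction l with
  | zero => simp [basis_zero_zero]
  | succ l ih =>
    have basis_one_one_mul : basis 1 1 * basis (l + 1) 0 =
        basis 1 0 * (basis 1 1 * basis l 0) - (4 : ℂ) • (invDim * basis (l + 1) 0) := by
      rw [basis_succ_zero l, ← mul_assoc, basis_one_one_mul_basis_one_zero]
      simp only [sub_mul, smul_mul_assoc, mul_assoc]
    have basis_one_zero_mul : basis 1 0 * (invDim * basis l 0) = invDim * basis (l + 1) 0 := by
      rw [basis_succ_zero l, (invDim_commute _).symm.left_comm]
    rw [← lower_basis, basis_succ_zero (l + 1), lower_mul, lower_basis, lower_basis, ih,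
      mul_smul_comm, mul_add, mul_smul_comm, basis_one_zero_mul, basis_one_one_mul]
    push_cast
    module

theorem lie_basis_one_one_basis_zero (l : ℕ) :
    ⁅basis 1 1, basis l 0⁆ = (-4 * (l : ℂ)) • (invDim * basis l 0) := by
  induction l with
  | zero => simp [basis_zero_zero, LieRing.of_associative_ring_bracket]
  | succ l ih =>
    have leibniz : ⁅basis 1 1, basis 1 0 * basis l 0⁆ =
        ⁅basis 1 1, basis 1 0⁆ * basis l 0 + basis 1 0 * ⁅basis 1 1, basis l 0⁆ :=
      ad_mul (𝕜 := ℂ) (basis 1 1) (basis 1 0) (basis l 0)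
    rw [basis_succ_zero, leibniz, lie_basis_one_one, ih, mul_smul_comm,
      (invDim_commute _).symm.left_comm, smul_mul_assoc, mul_assoc]
    push_cast
    module

theorem basis_one_two_mul_sub_mem_nullExpansions (l : ℕ) : basis 1 2 * basis l 0 -
    ((1 / ((2 * (l : ℂ) + 1) * (l + 1))) • basis (l + 1) 2 - (2 : ℂ) • (invDim * basis l 1) -
      (4 * (l : ℂ) / (2 * l + 1)) • (basis (l - 1) 0 -
        ((l : ℂ) ^ 2) • (invDim * (invDim * basis (l - 1) 0)))) ∈ nullExpansions := by
  simp only [invDim_mul]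
  refine ⟨funext fun n => sub_eq_zero.mpr ?_, ?_, ?_⟩
  · refine (bOp_one_two_mul_bOp_zero n l).trans ?_
    simp only [basis, Prod.fst_sub, Prod.smul_fst, Pi.sub_apply, Pi.smul_apply]
    generalize (n : ℂ) + 1 = N
    match_scalars <;> ring
  · simpa [basis] using bPoly_one_two_mul_sub_mem_sphereIdeal l
  · suffices next_eq : Complex.I • poissonPoly (bPoly 1 2) (bPoly l 0) = (-2 : ℂ) • bPoly l 1 by
      simp [basis, next_eq]
    rw [I_smul_poissonPoly_bPoly_one_two, lowering_bPoly]

theorem basis_one_mul_mem (k l k' : ℕ) : basis 1 k * basis l k' ∈ expansions := by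
  induction k' generalizing k with
  | zero =>
    match k with
    | 0 =>
      rw [← basis_succ_zero]
      exact basis_mem _ _
    | 1 =>
      have two_term : basis 1 1 * basis l 0 =
          ((l : ℂ) + 1)⁻¹ • basis (l + 1) 1 - (2 * (l : ℂ)) • (invDim * basis l 0) := by
        rw [basis_succ_one l, inv_smul_smul₀ (Nat.cast_add_one_ne_zero l), add_sub_cancel_right]
      rw [two_term]
      exact sub_mem (Submodule.smul_mem _ _ (basis_mem _ _))
        (Submodule.smul_mem _ _ (invDim_mul_mem (basis_mem _ _)))
    | 2 =>
      have approx_mem := sub_mem (sub_mem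
        (Submodule.smul_mem _ (1 / ((2 * (l : ℂ) + 1) * (l + 1))) (basis_mem (l + 1) 2))
        (Submodule.smul_mem _ (2 : ℂ) (invDim_mul_mem (basis_mem l 1))))
        (Submodule.smul_mem _ (4 * (l : ℂ) / (2 * l + 1)) (sub_mem (basis_mem (l - 1) 0)
          (Submodule.smul_mem _ ((l : ℂ) ^ 2)
            (invDim_mul_mem (invDim_mul_mem (basis_mem (l - 1) 0))))))
      exact (Submodule.sub_mem_iff_left _ approx_mem).mp
        (Submodule.mem_sup_right (basis_one_two_mul_sub_mem_nullExpansions l))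
    | k + 3 =>
      rw [basis_one_three, zero_mul]
      exact zero_mem _
  | succ k' ih =>
    rw [← lower_basis, eq_sub_of_add_eq' (lower_mul (basis 1 k) (basis l k')).symm, lower_basis]
    exact sub_mem (lower_mem (ih k)) (ih (k + 1))

theorem basis_mul_mem (l k : ℕ) {a : Expansion} (ha : a ∈ expansions) :
    basis l k * a ∈ expansions := by
  induction l generalizing k a with
  | zero =>
    cases k with
    | zero => rwa [basis_zero_zero, one_mul]
    | succ k =>
      rw [basis_zero_succ, zero_mul]
      exact zero_mem _
  | succ l ih =>
    induction k generalizing a with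
    | zero =>
      rw [basis_succ_zero, mul_assoc]
      exact mul_mem_of_basis (basis_one_mul_mem 0) (ih 0 ha)
    | succ k ihk =>
      rw [← lower_basis, eq_sub_of_add_eq (lower_mul (basis (l + 1) k) a).symm]
      exact sub_mem (lower_mem (ihk ha)) (ihk (lower_mem ha))

theorem mul_mem {a b : Expansion} (ha : a ∈ expansions) (hb : b ∈ expansions) :
    a * b ∈ expansions := by
  refine map_mem (LinearMap.mulRight ℂ b) (fun r l k => ?_)
    (fun a ha => mul_mem_nullExpansions_right ha b) ha
  rw [LinearMap.mulRight_apply, mul_assoc]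
  exact invDim_pow_mul_mem (basis_mul_mem l k hb) r

/-- The expansions that are divisible by `1/(n+1)`. -/
def shifted : Submodule ℂ Expansion := expansions.map (LinearMap.mulLeft ℂ invDim)

theorem invDim_mul_mem_shifted {a : Expansion} (ha : a ∈ expansions) : invDim * a ∈ shifted :=
  ⟨a, ha, rfl⟩

theorem lower_mem_shifted {a : Expansion} (ha : a ∈ shifted) : lower a ∈ shifted := by
  obtain ⟨b, hb, rfl⟩ := ha
  exact ⟨lower b, lower_mem hb, (lower_invDim_mul b).symm⟩

theorem mul_mem_shifted {a b : Expansion} (ha : a ∈ expansions) (hb : b ∈ shifted) :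
    a * b ∈ shifted := by
  obtain ⟨c, hc, rfl⟩ := hb
  exact ⟨a * c, mul_mem ha hc, (invDim_commute a).left_comm c⟩

theorem shifted_mul_mem {a b : Expansion} (ha : a ∈ shifted) (hb : b ∈ expansions) :
    a * b ∈ shifted := by
  obtain ⟨c, hc, rfl⟩ := ha
  exact ⟨c * b, mul_mem hc hb, (mul_assoc invDim c b).symm⟩

theorem lie_basis_one_mem_shifted (k l k' : ℕ) : ⁅basis 1 k, basis l k'⁆ ∈ shifted := by
  induction k' generalizing k with
  | zero =>
    match k with
    | 0 =>
      rw [LieRing.of_associative_ring_bracket, (basis_zero_commute 1 l).eq, sub_self]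
      exact zero_mem _
    | 1 =>
      rw [lie_basis_one_one_basis_zero]
      exact Submodule.smul_mem _ _ (invDim_mul_mem_shifted (basis_mem _ _))
    | 2 =>
      rw [lie_basis_one_two]
      exact Submodule.smul_mem _ _ (invDim_mul_mem_shifted (lower_mem (basis_mem _ _)))
    | k + 3 =>
      rw [basis_one_three, zero_lie]
      exact zero_mem _
  | succ k' ih =>
    rw [← lower_basis, eq_sub_of_add_eq' (lower_lie (basis 1 k) (basis l k')).symm, lower_basis]
    exact sub_mem (lower_mem_shifted (ih k)) (ih (k + 1))

theorem lie_basis_mem_shifted (l k l' k' : ℕ) : ⁅basis l k, basis l' k'⁆ ∈ shifted := by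
  induction l generalizing k l' k' with
  | zero =>
    cases k with
    | zero =>
      rw [basis_zero_zero, LieRing.of_associative_ring_bracket, one_mul, mul_one, sub_self]
      exact zero_mem _
    | succ k =>
      rw [basis_zero_succ, zero_lie]
      exact zero_mem _
  | succ l ih =>
    induction k generalizing l' k' with
    | zero =>
      have leibniz : ⁅basis 1 0 * basis l 0, basis l' k'⁆ =
          basis 1 0 * ⁅basis l 0, basis l' k'⁆ + ⁅basis 1 0, basis l' k'⁆ * basis l 0 := by
        simp only [LieRing.of_associative_ring_bracket]
        noncomm_ring
      rw [basis_succ_zero, leibniz]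
      exact add_mem (mul_mem_shifted (basis_mem _ _) (ih _ _ _))
        (shifted_mul_mem (lie_basis_one_mem_shifted _ _ _) (basis_mem _ _))
    | succ k ihk =>
      rw [← lower_basis, eq_sub_of_add_eq (lower_lie (basis (l + 1) k) (basis l' k')).symm,
        lower_basis]
      exact sub_mem (lower_mem_shifted (ihk _ _)) (ihk _ _)

end Expansion

/-! ### The Poisson bracket of polynomial functions on the sphere -/

theorem hasFDerivAt_inv_norm {F : Type*} [NormedAddCommGroup F] [InnerProductSpace ℝ F] {x : F}
    (hx : ‖x‖ = 1) : HasFDerivAt (fun y : F => ‖y‖⁻¹) (-innerSL ℝ x) x := by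
  have hasFDerivAt_norm := (hasStrictFDerivAt_norm_sq x).hasFDerivAt.sqrt (by simp [hx])
  simp only [Real.sqrt_sq (norm_nonneg _)] at hasFDerivAt_norm
  refine ((hasDerivAt_inv (by simp [hx])).comp_hasFDerivAt x hasFDerivAt_norm).congr_fderiv ?_
  ext y
  simp [hx]

theorem eval_radialProj_eventuallyEq (F : MvPolynomial (Fin 3) ℂ) {x : E3} (hx : x ≠ 0) :
    (fun y : E3 => MvPolynomial.eval (pt (radialProj y)) F) =ᶠ[𝓝 x]
      fun y => MvPolynomial.eval (fun j => ((‖y‖⁻¹ * y j : ℝ) : ℂ)) F := by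
  filter_upwards [isOpen_ne.mem_nhds hx] with y hy
  simp only [radialProj, dif_neg (show ¬ y = 0 from hy)]
  rfl

theorem grad_eval (F : MvPolynomial (Fin 3) ℂ) (p : S2) (k : Fin 3) :
    grad (fun q => MvPolynomial.eval (pt q) F) p k =
      MvPolynomial.eval (pt p) (MvPolynomial.pderiv k F) -
        pt p k * ∑ j, pt p j * MvPolynomial.eval (pt p) (MvPolynomial.pderiv j F) := by
  have norm_eq_one : ‖(p : E3)‖ = 1 := mem_sphere_zero_iff_norm.mp p.2
  have ne_zero : (p : E3) ≠ 0 := norm_ne_zero_iff.mp (by rw [norm_eq_one]; exact one_ne_zero)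
  have hasFDerivAt_coord (j : Fin 3) :
      HasFDerivAt (fun y : E3 => ((‖y‖⁻¹ * y j : ℝ) : ℂ)) _ (p : E3) :=
    Complex.ofRealCLM.hasFDerivAt.comp (p : E3)
      ((hasFDerivAt_inv_norm norm_eq_one).mul (EuclideanSpace.proj (𝕜 := ℝ) j).hasFDerivAt)
  have normalized_coord_eq : (fun j => ((‖(p : E3)‖⁻¹ * (p : E3) j : ℝ) : ℂ)) = pt p := by
    simp only [norm_eq_one, inv_one, one_mul]
    rfl
  calc grad (fun q => MvPolynomial.eval (pt q) F) p k
      = ∑ j, ((if j = k then 1 else 0) - pt p k * pt p j) *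
          MvPolynomial.eval (pt p) (MvPolynomial.pderiv j F) := by
        rw [grad, (eval_radialProj_eventuallyEq F ne_zero).fderiv_eq,
          (hasFDerivAt_eval hasFDerivAt_coord F).fderiv, normalized_coord_eq]
        simp [norm_eq_one, EuclideanSpace.inner_single_right, pt, mul_comm, sub_eq_add_neg,
          apply_ite, add_mul]
    _ = _ := by
        simp only [sub_mul, ite_mul, one_mul, zero_mul, Finset.sum_sub_distrib, Finset.sum_ite_eq',
          Finset.mem_univ, if_true, Finset.mul_sum, mul_assoc]

theorem poisson_eval (F G : MvPolynomial (Fin 3) ℂ) (p : S2) :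
    poisson (fun q => MvPolynomial.eval (pt q) F) (fun q => MvPolynomial.eval (pt q) G) p =
      MvPolynomial.eval (pt p) (poissonPoly F G) := by
  have coe_eq_pt : (fun k => ((p : E3) k : ℂ)) = pt p := rfl
  rw [poisson, coe_eq_pt]
  simp only [cross_apply, dotProduct, Fin.sum_univ_three, grad_eval,
    poissonPoly_apply, map_add, map_mul, map_sub, MvPolynomial.eval_X, Matrix.cons_val_zero,
    Matrix.cons_val_one, Matrix.cons_val]
  ring

section Dilation

open MvPolynomial

/-- The substitution `x ↦ s x`. -/
def dilate (s : ℂ) : MvPolynomial (Fin 3) ℂ →ₐ[ℂ] MvPolynomial (Fin 3) ℂ :=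
  aeval fun i => s • X i

theorem dilate_X (s : ℂ) (i : Fin 3) : dilate s (X i) = s • X i := aeval_X _ i

theorem pderiv_dilate (s : ℂ) (i : Fin 3) (F : MvPolynomial (Fin 3) ℂ) :
    pderiv i (dilate s F) = s • dilate s (pderiv i F) := by
  induction F using MvPolynomial.induction_on with
  | C a => simp [dilate, algebraMap_eq]
  | add F G hF hG => simp only [map_add, hF, hG, smul_add]
  | mul_X F j hF =>
    have pderiv_dilate_X : pderiv i (dilate s (X j)) = s • dilate s (pderiv i (X j)) := by
      obtain rfl | hij := eq_or_ne j i
      · rw [dilate_X, Derivation.map_smul, pderiv_X_self, map_one]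
      · rw [dilate_X, Derivation.map_smul, pderiv_X_of_ne hij, map_zero]
    rw [map_mul, Derivation.leibniz, Derivation.leibniz, hF, pderiv_dilate_X]
    simp only [smul_eq_mul, map_add, map_mul, smul_add, mul_smul_comm]

theorem lowering_dilate (s : ℂ) (F : MvPolynomial (Fin 3) ℂ) :
    lowering (dilate s F) = dilate s (lowering F) := by
  rw [lowering_eq, lowering_eq]
  simp only [pderiv_dilate, map_add, map_mul, map_neg, map_sub, map_smul, dilate_X]
  simp only [smul_eq_C_mul]
  ring

theorem dilate_bPoly (s : ℂ) (l k : ℕ) : dilate s (bPoly l k) = s ^ l • bPoly l k := by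
  induction k with
  | zero =>
    have dilate_xplus : dilate s xplus = s • xplus := by
      simp only [xplus, map_add, map_smul, dilate_X, smul_add, smul_comm s]
    rw [bPoly, Function.iterate_zero, id, map_pow, dilate_xplus, smul_pow]
  | succ k ih => rw [← lowering_bPoly, ← lowering_dilate, ih, Derivation.map_smul]

theorem poissonPoly_dilate (s : ℂ) (F G : MvPolynomial (Fin 3) ℂ) :
    poissonPoly (dilate s F) (dilate s G) = s • dilate s (poissonPoly F G) := by
  simp only [poissonPoly_apply, pderiv_dilate, map_add, map_mul, map_sub, dilate_X, smul_eq_C_mul]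
  ring

/-- The restriction to the sphere of the function `p ↦ F(s p)`, for a polynomial `F`. -/
def sphereFun (s : ℂ) : MvPolynomial (Fin 3) ℂ →ₐ[ℂ] C(S2, ℂ) :=
  aeval fun k => ⟨fun p => s * pt p k, by unfold pt; fun_prop⟩

theorem sphereFun_apply (s : ℂ) (F : MvPolynomial (Fin 3) ℂ) (p : S2) :
    sphereFun s F p = eval (fun k => s * pt p k) F := by
  have evalAlgHom_comp :
      (ContinuousMap.evalAlgHom ℂ ℂ p).comp (sphereFun s) = aeval fun k => s * pt p k :=
    algHom_ext fun k => by simp [sphereFun]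
  exact DFunLike.congr_fun evalAlgHom_comp F

theorem sphereFun_one_apply (F : MvPolynomial (Fin 3) ℂ) (p : S2) :
    sphereFun 1 F p = eval (pt p) F := by
  simp only [sphereFun_apply, one_mul]

theorem sphereFun_dilate (s : ℂ) (F : MvPolynomial (Fin 3) ℂ) :
    sphereFun 1 (dilate s F) = sphereFun s F := by
  have comp_dilate : (sphereFun 1).comp (dilate s) = sphereFun s :=
    algHom_ext fun k => ContinuousMap.ext fun p => by simp [dilate_X, sphereFun]
  exact DFunLike.congr_fun comp_dilate F

theorem sphereFun_bPoly (s : ℂ) (l k : ℕ) :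
    sphereFun s (bPoly l k) = s ^ l • sphereFun 1 (bPoly l k) := by
  rw [← sphereFun_dilate, dilate_bPoly, map_smul]

theorem sphereFun_poissonPoly_bPoly {s : ℂ} (hs : s * s = 1) (l k l' k' : ℕ) :
    sphereFun s (poissonPoly (bPoly l k) (bPoly l' k')) =
      (s * (s ^ l * s ^ l')) • sphereFun 1 (poissonPoly (bPoly l k) (bPoly l' k')) := by
  have smul_dilate : s • dilate s (poissonPoly (bPoly l k) (bPoly l' k')) =
      (s ^ l * s ^ l') • poissonPoly (bPoly l k) (bPoly l' k') := by
    rw [← poissonPoly_dilate, dilate_bPoly, dilate_bPoly, poissonPoly_smul_left,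
      Derivation.map_smul, smul_smul]
  rw [← sphereFun_dilate, mul_smul, ← map_smul _ (s ^ l * s ^ l'), ← smul_dilate, map_smul,
    smul_smul, hs, one_smul]

theorem sphereFun_eq_zero {s : ℂ} (hs : s * s = 1) {F : MvPolynomial (Fin 3) ℂ}
    (hF : F ∈ sphereIdeal) : sphereFun s F = 0 := by
  ext p
  rw [sphereFun_apply, ContinuousMap.zero_apply]
  refine eval_eq_zero_of_mem_sphereIdeal hF ?_
  linear_combination s * s * sum_pt_sq p + hs

end Dilation

/-! ### First-order expansions of sequences -/

section FirstOrder

/-- The expansion `u n = a + b / n + o(1 / n)` of a sequence in a normed space. -/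
def HasFirstOrderExpansion {E : Type*} [NormedAddCommGroup E] (u : ℕ → E) (a b : E) : Prop :=
  Tendsto (fun n => n • (u n - a)) atTop (𝓝 b)

namespace HasFirstOrderExpansion

section Module

variable {E : Type*} [NormedAddCommGroup E] {u v : ℕ → E} {a b a' b' : E}

theorem const (a : E) : HasFirstOrderExpansion (fun _ => a) a 0 := by
  simp only [HasFirstOrderExpansion, sub_self, smul_zero]
  exact tendsto_const_nhds

theorem congr' (hu : HasFirstOrderExpansion u a b) (huv : u =ᶠ[atTop] v) :
    HasFirstOrderExpansion v a b :=
  Tendsto.congr' (huv.mono fun n hn => by rw [hn]) hu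

theorem add (hu : HasFirstOrderExpansion u a b) (hv : HasFirstOrderExpansion v a' b') :
    HasFirstOrderExpansion (fun n => u n + v n) (a + a') (b + b') :=
  (Tendsto.add hu hv).congr fun n => by rw [← smul_add, add_sub_add_comm]

theorem tendsto [NormedSpace ℝ E] (hu : HasFirstOrderExpansion u a b) :
    Tendsto u atTop (𝓝 a) := by
  have sub_tendsto := (tendsto_inv_atTop_nhds_zero_nat (𝕜 := ℝ)).smul hu
  rw [zero_smul] at sub_tendsto
  refine tendsto_sub_nhds_zero_iff.mp (sub_tendsto.congr' ?_)
  filter_upwards [eventually_ne_atTop 0] with n hn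
  rw [← Nat.cast_smul_eq_nsmul ℝ, inv_smul_smul₀ (Nat.cast_ne_zero.mpr hn)]

theorem smul {𝕜 : Type*} [NormedField 𝕜] [NormedSpace 𝕜 E] [NormedSpace ℝ E] {r : ℕ → 𝕜}
    {c c' : 𝕜} (hr : HasFirstOrderExpansion r c c') (hu : HasFirstOrderExpansion u a b) :
    HasFirstOrderExpansion (fun n => r n • u n) (c • a) (c' • a + c • b) := by
  refine ((Tendsto.smul hr hu.tendsto).add (Tendsto.const_smul hu c)).congr fun n => ?_
  rw [smul_assoc, smul_comm c, ← smul_add, sub_smul, smul_sub]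
  abel_nf

theorem smul_const {𝕜 : Type*} [NormedField 𝕜] [NormedSpace 𝕜 E] {r : ℕ → 𝕜} {c c' : 𝕜}
    (hr : HasFirstOrderExpansion r c c') (a : E) :
    HasFirstOrderExpansion (fun n => r n • a) (c • a) (c' • a) :=
  (Tendsto.smul_const hr a).congr fun n => by rw [smul_assoc, sub_smul]

theorem const_smul {𝕜 : Type*} [NormedField 𝕜] [NormedSpace 𝕜 E]
    (hu : HasFirstOrderExpansion u a b) (c : 𝕜) :
    HasFirstOrderExpansion (fun n => c • u n) (c • a) (c • b) :=
  (Tendsto.const_smul hu c).congr fun n => by rw [smul_comm, smul_sub]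

theorem one_div_add_one_smul_iff {𝕜 : Type*} [RCLike 𝕜] [NormedSpace 𝕜 E] :
    HasFirstOrderExpansion (fun n => (1 / ((n : 𝕜) + 1)) • u n) 0 a ↔ Tendsto u atTop (𝓝 a) := by
  have div_tendsto := tendsto_natCast_div_add_atTop (1 : 𝕜)
  have nsmul_eq (n : ℕ) : n • ((1 / ((n : 𝕜) + 1)) • u n - 0) = ((n : 𝕜) / (n + 1)) • u n := by
    rw [sub_zero, ← Nat.cast_smul_eq_nsmul 𝕜, smul_smul, mul_one_div]
  simp only [HasFirstOrderExpansion, nsmul_eq]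
  refine ⟨fun hu => ?_, fun hu => one_smul 𝕜 a ▸ div_tendsto.smul hu⟩
  have smul_tendsto := (div_tendsto.inv₀ one_ne_zero).smul hu
  rw [inv_one, one_smul] at smul_tendsto
  refine smul_tendsto.congr' ?_
  filter_upwards [eventually_ne_atTop 0] with n hn
  exact inv_smul_smul₀
    (div_ne_zero (Nat.cast_ne_zero.mpr hn) (Nat.cast_add_one_ne_zero n)) (u n)

end Module

section Field

variable {𝕜 : Type*} [NormedField 𝕜] [NormedSpace ℝ 𝕜] {u v : ℕ → 𝕜} {a b : 𝕜}

theorem mul_zero_zero (hu : HasFirstOrderExpansion u a 0) (hv : HasFirstOrderExpansion v b 0) :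
    HasFirstOrderExpansion (fun n => u n * v n) (a * b) 0 := by
  simpa only [smul_eq_mul, zero_mul, mul_zero, add_zero] using hu.smul hv

theorem inv₀ (hu : HasFirstOrderExpansion u a b) (ha : a ≠ 0) :
    HasFirstOrderExpansion (fun n => (u n)⁻¹) a⁻¹ (-(a⁻¹ * a⁻¹ * b)) := by
  refine (((hu.tendsto.inv₀ ha).mul_const a⁻¹).mul hu).neg.congr' ?_
  filter_upwards [hu.tendsto.eventually_ne ha] with n hn
  rw [inv_sub_inv hn ha]
  simp only [nsmul_eq_mul]
  field_simp
  ring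

end Field

theorem one_sub_div_sq {𝕜 : Type*} [RCLike 𝕜] (c : 𝕜) :
    HasFirstOrderExpansion (fun n => 1 - c / ((n : 𝕜) + 1) ^ 2) 1 0 := by
  have inv_sq_expansion : HasFirstOrderExpansion
      (fun n => (1 / ((n : 𝕜) + 1)) • (1 / ((n : 𝕜) + 1))) 0 0 :=
    one_div_add_one_smul_iff.mpr tendsto_one_div_add_atTop_nhds_zero_nat
  have sub_expansion := (HasFirstOrderExpansion.const 1).add (inv_sq_expansion.const_smul (-c))
  rw [smul_zero, add_zero, add_zero] at sub_expansion
  refine sub_expansion.congr' (.of_forall fun n => ?_)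
  simp only [smul_eq_mul, div_eq_mul_inv, sq, mul_inv]
  ring

theorem of_sq {𝕜 : Type*} [NormedField 𝕜] {u : ℕ → 𝕜} {a : 𝕜}
    (hu : HasFirstOrderExpansion (fun n => u n ^ 2) (a ^ 2) 0)
    (hua : Tendsto u atTop (𝓝 a)) (ha : a + a ≠ 0) : HasFirstOrderExpansion u a 0 := by
  have add_tendsto : Tendsto (fun n => u n + a) atTop (𝓝 (a + a)) := hua.add_const a
  have quotient_tendsto := Tendsto.mul hu (add_tendsto.inv₀ ha)
  rw [zero_mul] at quotient_tendsto
  refine quotient_tendsto.congr' ?_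
  filter_upwards [add_tendsto.eventually_ne ha] with n hn
  rw [sq_sub_sq, smul_mul_assoc, mul_comm (u n + a), mul_inv_cancel_right₀ hn]

theorem apply {X : Type*} [TopologicalSpace X] [CompactSpace X] {u : ℕ → C(X, ℂ)} {a b : C(X, ℂ)}
    (hu : HasFirstOrderExpansion u a b) (x : X) :
    HasFirstOrderExpansion (fun n => u n x) (a x) (b x) :=
  ((continuous_eval_const x).tendsto b).comp hu

theorem ofReal_iff {u : ℕ → ℝ} {a b : ℝ} :
    HasFirstOrderExpansion (fun n => (u n : ℂ)) (a : ℂ) (b : ℂ) ↔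
      HasFirstOrderExpansion u a b := by
  have cast_sub (n : ℕ) : n • ((u n : ℂ) - a) = ((n • (u n - a) : ℝ) : ℂ) := by push_cast; rfl
  simp only [HasFirstOrderExpansion, cast_sub]
  exact tendsto_ofReal_iff

end HasFirstOrderExpansion

end FirstOrder

/-! ### The limits of the symbols of an expansion -/

namespace Expansion

open StarPoly

theorem expansions_induction {p : Expansion → Prop} (hbasis : ∀ l k, p (basis l k))
    (hnull : ∀ a ∈ nullExpansions, p a) (hinvDim : ∀ a, p a → p (invDim * a))
    (hadd : ∀ a b, p a → p b → p (a + b)) (hsmul : ∀ (c : ℂ) a, p a → p (c • a)) {a : Expansion}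
    (ha : a ∈ expansions) : p a := by
  obtain ⟨b, hb, c, hc, rfl⟩ := Submodule.mem_sup.mp ha
  refine hadd b c ?_ (hnull c hc)
  refine Submodule.span_induction ?_ (hnull 0 (zero_mem _)) (fun b c _ _ => hadd b c)
    (fun r b _ => hsmul r b) hb
  rintro _ ⟨⟨r, l, k⟩, rfl⟩
  induction r with
  | zero => simpa only [pow_zero, one_mul] using hbasis l k
  | succ r ih =>
    simp only [pow_succ', mul_assoc]
    exact hinvDim _ ih

end Expansion

section Limits

open Expansion StarPoly

/-- The symbol map of a symbol correspondence as a map to the Banach space `C(S², ℂ)`. -/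
def symbolMap {n : ℕ} (W : SymbolCorrespondence n) : Op n →ₗ[ℂ] C(S2, ℂ) where
  toFun P := ⟨W.symbol P, (W.smooth P).continuous⟩
  map_add' P Q := by ext; simp
  map_smul' r P := by ext; simp

theorem symbolMap_bOp {n : ℕ} {W : SymbolCorrespondence n} {d : ℕ → ℂ} (hd : IsSymbolScale W d)
    (l k : ℕ) : symbolMap W (bOp n l k) = d l • sphereFun 1 (bPoly l k) := by
  ext p
  rw [ContinuousMap.smul_apply, sphereFun_one_apply]
  exact hd l k p

variable {W : ∀ n, SymbolCorrespondence n} {d : ℕ → ℕ → ℂ} {s : ℂ}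

theorem tendsto_symbolMap (hs : s * s = 1) (hd : ∀ n, IsSymbolScale (W n) (d n))
    (hlim : ∀ l, Tendsto (fun n => d n l) atTop (𝓝 (s ^ l))) {a : Expansion} (ha : a ∈ expansions) :
    Tendsto (fun n => symbolMap (W n) (a.1 n)) atTop (𝓝 (sphereFun s (lead a.2))) := by
  refine expansions_induction (p := fun a => Tendsto (fun n => symbolMap (W n) (a.1 n)) atTop
    (𝓝 (sphereFun s (lead a.2)))) (fun l k => ?_) (fun a ha => ?_) (fun a iha => ?_)
    (fun a b iha ihb => ?_) (fun c a iha => ?_) ha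
  · simp only [basis, lead_mk, symbolMap_bOp (hd _), sphereFun_bPoly s]
    exact (hlim l).smul_const _
  · obtain ⟨op, hlead, -⟩ := mem_nullExpansions.mp ha
    simp only [op, Pi.zero_apply, map_zero, sphereFun_eq_zero hs hlead]
    exact tendsto_const_nhds
  · simp only [invDim_mul, map_smul, lead_mk, map_zero]
    exact (HasFirstOrderExpansion.one_div_add_one_smul_iff.mpr iha).tendsto
  · simpa only [Prod.fst_add, Prod.snd_add, Pi.add_apply, map_add] using iha.add ihb
  · simpa only [Prod.smul_fst, Prod.smul_snd, Pi.smul_apply, map_smul] using iha.const_smul c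

theorem hasFirstOrderExpansion_symbolMap (hs : s * s = 1) (hd : ∀ n, IsSymbolScale (W n) (d n))
    (hlim : ∀ l, HasFirstOrderExpansion (fun n => d n l) (s ^ l) 0) {a : Expansion}
    (ha : a ∈ expansions) :
    HasFirstOrderExpansion (fun n => symbolMap (W n) (a.1 n)) (sphereFun s (lead a.2))
      (sphereFun s (next a.2)) := by
  refine expansions_induction (p := fun a => HasFirstOrderExpansion
    (fun n => symbolMap (W n) (a.1 n)) (sphereFun s (lead a.2)) (sphereFun s (next a.2)))
    (fun l k => ?_) (fun a ha => ?_) (fun a iha => ?_) (fun a b iha ihb => ?_)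
    (fun c a iha => ?_) ha
  · simp only [basis, lead_mk, next_mk, map_zero, symbolMap_bOp (hd _), sphereFun_bPoly s]
    exact zero_smul ℂ (sphereFun 1 (bPoly l k)) ▸ (hlim l).smul_const _
  · obtain ⟨op, hlead, hnext⟩ := mem_nullExpansions.mp ha
    simp only [op, Pi.zero_apply, map_zero, sphereFun_eq_zero hs hlead, sphereFun_eq_zero hs hnext]
    exact .const 0
  · simp only [invDim_mul, map_smul, lead_mk, next_mk, map_zero]
    exact HasFirstOrderExpansion.one_div_add_one_smul_iff.mpr iha.tendsto
  · simpa only [Prod.fst_add, Prod.snd_add, Pi.add_apply, map_add] using iha.add ihb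
  · simpa only [Prod.smul_fst, Prod.smul_snd, Pi.smul_apply, map_smul] using iha.const_smul c

end Limits

/-! ### Asymptotics of the twisted products -/

section Twisted

open Expansion StarPoly HasFirstOrderExpansion

section BasisStar

variable {n : ℕ} (W : SymbolCorrespondence n)

/-- The twisted product of two symbols as an element of `C(S², ℂ)`. -/
def starMap (f g : S2 → ℂ) : C(S2, ℂ) :=
  symbolMap W (Function.invFun W.symbol f * Function.invFun W.symbol g)

theorem starMap_symbol (P Q : Op n) :
    starMap W (W.symbol P) (W.symbol Q) = symbolMap W (P * Q) := by
  simp only [starMap, Function.leftInverse_invFun W.injective _]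

/-- The twisted product of the functions `bPoly l k` and `bPoly l' k'` on the sphere, for a
correspondence with symbol scale `d`. -/
def basisStar (d : ℕ → ℂ) (l k l' k' : ℕ) : C(S2, ℂ) :=
  (d l * d l')⁻¹ • symbolMap W (bOp n l k * bOp n l' k')

theorem Y_eq_eval (l k : ℕ) : Y l (l - k) =
    fun p => MvPolynomial.eval (pt p) ((harmonicCoef l k : ℂ) • bPoly l k) := by
  funext p
  rw [← harmonicAux_eq, Y, sub_sub_cancel, Int.toNat_natCast]
  rfl

theorem Y_eq (l k : ℕ) : Y l (l - k) =
    ((harmonicCoef l k : ℂ) • sphereFun 1 (bPoly l k) : C(S2, ℂ)) := by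
  funext p
  rw [Y_eq_eval, ← map_smul, sphereFun_one_apply]

variable {W}

theorem Y_eq_symbol {d : ℕ → ℂ} (hd : IsSymbolScale W d) {l : ℕ} (hl : d l ≠ 0) (k : ℕ) :
    Y l (l - k) = W.symbol ((harmonicCoef l k / d l : ℂ) • bOp n l k) := by
  change _ = ⇑(symbolMap W _)
  rw [map_smul, symbolMap_bOp hd, smul_smul, div_mul_cancel₀ _ hl, Y_eq]

theorem starMap_Y {d : ℕ → ℂ} (hd : IsSymbolScale W d) {l l' : ℕ} (hl : d l ≠ 0) (hl' : d l' ≠ 0)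
    (k k' : ℕ) : starMap W (Y l (l - k)) (Y l' (l' - k')) =
      (harmonicCoef l k * harmonicCoef l' k' : ℂ) • basisStar W d l k l' k' := by
  rw [Y_eq_symbol hd hl, Y_eq_symbol hd hl', starMap_symbol, smul_mul_smul_comm, map_smul,
    basisStar, smul_smul, div_mul_div_comm, div_eq_mul_inv]

end BasisStar

theorem poisson_Y (l k l' k' : ℕ) : poisson (Y l (l - k)) (Y l' (l' - k')) =
    ((harmonicCoef l k * harmonicCoef l' k' : ℂ) •
      sphereFun 1 (poissonPoly (bPoly l k) (bPoly l' k')) : C(S2, ℂ)) := by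
  funext p
  rw [Y_eq_eval, Y_eq_eval, poisson_eval, poissonPoly_smul_left, Derivation.map_smul, smul_smul,
    MvPolynomial.smul_eval, ContinuousMap.smul_apply, sphereFun_one_apply, smul_eq_mul]

theorem abs_le_iff_exists {l : ℕ} {m : ℤ} : |m| ≤ l ↔ ∃ k ≤ 2 * l, m = l - (k : ℕ) := by
  refine ⟨fun hm => ⟨(l - m).toNat, ?_⟩, ?_⟩
  · obtain ⟨lower, upper⟩ := abs_le.mp hm
    omega
  · rintro ⟨k, hk, rfl⟩
    exact abs_le.mpr (by omega)

variable {W : ∀ n, SymbolCorrespondence n} {d : ℕ → ℕ → ℂ} {s : ℂ}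

theorem harmonicCoef_mul_ne_zero {l k l' k' : ℕ} (hk : k ≤ 2 * l) (hk' : k' ≤ 2 * l') :
    (harmonicCoef l k * harmonicCoef l' k' : ℂ) ≠ 0 :=
  mul_ne_zero (mod_cast harmonicCoef_ne_zero hk) (mod_cast harmonicCoef_ne_zero hk')

theorem tendstoUniformly_iff_of_eventually_eq_smul {F G : ℕ → C(S2, ℂ)} {f : S2 → ℂ}
    {g : C(S2, ℂ)} {r : ℂ} (hr : r ≠ 0) (hF : ∀ᶠ n in atTop, F n = r • G n)
    (hf : f = ⇑(r • g)) :
    TendstoUniformly (fun n => ⇑(F n)) f atTop ↔ Tendsto G atTop (𝓝 g) := by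
  rw [hf, ← ContinuousMap.tendsto_iff_tendstoUniformly, tendsto_congr' hF,
    tendsto_const_smul_iff₀ hr]

section Characterization

variable (hd : ∀ n, IsSymbolScale (W n) (d n)) (hne : ∀ n l, l ≤ n → d n l ≠ 0)

include hd hne

theorem eventually_starMap_Y (l k l' k' : ℕ) : ∀ᶠ n in atTop,
    starMap (W n) (Y l (l - k)) (Y l' (l' - k')) =
        (harmonicCoef l k * harmonicCoef l' k' : ℂ) • basisStar (W n) (d n) l k l' k' ∧
      starMap (W n) (Y l' (l' - k')) (Y l (l - k)) =
        (harmonicCoef l k * harmonicCoef l' k' : ℂ) • basisStar (W n) (d n) l' k' l k := by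
  filter_upwards [eventually_ge_atTop l, eventually_ge_atTop l'] with n hl hl'
  exact ⟨starMap_Y (hd n) (hne n l hl) (hne n l' hl') k k',
    mul_comm (harmonicCoef l k : ℂ) _ ▸ starMap_Y (hd n) (hne n l' hl') (hne n l hl) k' k⟩

variable {l k l' k' : ℕ} (hk : k ≤ 2 * l) (hk' : k' ≤ 2 * l')

include hk hk'

theorem tendstoUniformly_star_add_iff :
    TendstoUniformly (fun n p => (W n).star (Y l (l - k)) (Y l' (l' - k')) p +
        (W n).star (Y l' (l' - k')) (Y l (l - k)) p)
      (fun p => 2 * Y l (l - k) p * Y l' (l' - k') p) atTop ↔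
    Tendsto (fun n => basisStar (W n) (d n) l k l' k' + basisStar (W n) (d n) l' k' l k) atTop
      (𝓝 ((2 : ℂ) • (sphereFun 1 (bPoly l k) * sphereFun 1 (bPoly l' k')))) := by
  refine tendstoUniformly_iff_of_eventually_eq_smul
    (F := fun n => starMap (W n) (Y l (l - k)) (Y l' (l' - k')) +
      starMap (W n) (Y l' (l' - k')) (Y l (l - k)))
    (harmonicCoef_mul_ne_zero hk hk') ?_ ?_
  · filter_upwards [eventually_starMap_Y hd hne l k l' k'] with n star_eq
    rw [star_eq.1, star_eq.2]
    module
  · funext p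
    simp only [Y_eq, ContinuousMap.smul_apply, ContinuousMap.mul_apply, smul_eq_mul]
    ring

theorem tendstoUniformly_star_sub_iff :
    TendstoUniformly (fun n p => (W n).star (Y l (l - k)) (Y l' (l' - k')) p -
        (W n).star (Y l' (l' - k')) (Y l (l - k)) p) (fun _ => 0) atTop ↔
    Tendsto (fun n => basisStar (W n) (d n) l k l' k' - basisStar (W n) (d n) l' k' l k) atTop
      (𝓝 0) := by
  refine tendstoUniformly_iff_of_eventually_eq_smul
    (F := fun n => starMap (W n) (Y l (l - k)) (Y l' (l' - k')) -
      starMap (W n) (Y l' (l' - k')) (Y l (l - k)))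
    (harmonicCoef_mul_ne_zero hk hk') ?_ ?_
  · filter_upwards [eventually_starMap_Y hd hne l k l' k'] with n star_eq
    rw [star_eq.1, star_eq.2]
    module
  · exact funext fun _ => (mul_zero _).symm

theorem tendstoUniformly_mul_star_sub_iff :
    TendstoUniformly (fun (n : ℕ) p => (n : ℂ) * ((W n).star (Y l (l - k)) (Y l' (l' - k')) p -
        (W n).star (Y l' (l' - k')) (Y l (l - k)) p))
      (fun p => s * (2 * Complex.I * poisson (Y l (l - k)) (Y l' (l' - k')) p)) atTop ↔
    HasFirstOrderExpansion
      (fun n => basisStar (W n) (d n) l k l' k' - basisStar (W n) (d n) l' k' l k) 0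
      ((s * (2 * Complex.I)) • sphereFun 1 (poissonPoly (bPoly l k) (bPoly l' k'))) := by
  refine tendstoUniformly_iff_of_eventually_eq_smul
    (F := fun n : ℕ => (n : ℂ) • (starMap (W n) (Y l (l - k)) (Y l' (l' - k')) -
      starMap (W n) (Y l' (l' - k')) (Y l (l - k))))
    (harmonicCoef_mul_ne_zero hk hk') ?_ ?_
  · filter_upwards [eventually_starMap_Y hd hne l k l' k'] with n star_eq
    rw [star_eq.1, star_eq.2]
    module
  · funext p
    simp only [poisson_Y, ContinuousMap.smul_apply, smul_eq_mul]
    ring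

theorem tendstoUniformly_mul_star_add_sub_iff :
    TendstoUniformly (fun (n : ℕ) p => (n : ℂ) * ((W n).star (Y l (l - k)) (Y l' (l' - k')) p +
        (W n).star (Y l' (l' - k')) (Y l (l - k)) p - 2 * Y l (l - k) p * Y l' (l' - k') p))
      (fun _ => 0) atTop ↔
    HasFirstOrderExpansion
      (fun n => basisStar (W n) (d n) l k l' k' + basisStar (W n) (d n) l' k' l k)
      ((2 : ℂ) • (sphereFun 1 (bPoly l k) * sphereFun 1 (bPoly l' k'))) 0 := by
  set limit := (2 : ℂ) • (sphereFun 1 (bPoly l k) * sphereFun 1 (bPoly l' k')) with hlimit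
  have two_mul_Y (p : S2) : 2 * Y l (l - k) p * Y l' (l' - k') p =
      ((harmonicCoef l k * harmonicCoef l' k' : ℂ) • limit) p := by
    simp only [hlimit, Y_eq, ContinuousMap.smul_apply, ContinuousMap.mul_apply, smul_eq_mul]
    ring
  simp only [two_mul_Y]
  refine tendstoUniformly_iff_of_eventually_eq_smul
    (F := fun n : ℕ => (n : ℂ) • (starMap (W n) (Y l (l - k)) (Y l' (l' - k')) +
      starMap (W n) (Y l' (l' - k')) (Y l (l - k)) -
        (harmonicCoef l k * harmonicCoef l' k' : ℂ) • limit))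
    (harmonicCoef_mul_ne_zero hk hk') ?_ ?_
  · filter_upwards [eventually_starMap_Y hd hne l k l' k'] with n star_eq
    rw [star_eq.1, star_eq.2]
    module
  · exact funext fun _ => (mul_zero _).symm

omit hk hk'

theorem isPoissonTypeWithSign_iff_basisStar : IsPoissonTypeWithSign s W ↔
    ∀ l l' k k', k ≤ 2 * l → k' ≤ 2 * l' →
      Tendsto (fun n => basisStar (W n) (d n) l k l' k' + basisStar (W n) (d n) l' k' l k) atTop
        (𝓝 ((2 : ℂ) • (sphereFun 1 (bPoly l k) * sphereFun 1 (bPoly l' k')))) ∧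
      HasFirstOrderExpansion
        (fun n => basisStar (W n) (d n) l k l' k' - basisStar (W n) (d n) l' k' l k) 0
        ((s * (2 * Complex.I)) • sphereFun 1 (poissonPoly (bPoly l k) (bPoly l' k'))) := by
  constructor
  · intro h l l' k k' hk hk'
    have hm := abs_le_iff_exists.mpr ⟨k, hk, rfl⟩
    have hm' := abs_le_iff_exists.mpr ⟨k', hk', rfl⟩
    exact ⟨(tendstoUniformly_star_add_iff hd hne hk hk').mp (h.anticommutator _ _ _ _ hm hm'),
      (tendstoUniformly_mul_star_sub_iff hd hne hk hk').mp (h.bracket _ _ _ _ hm hm')⟩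
  · refine fun h => ⟨fun l l' m m' hm hm' => ?_, fun l l' m m' hm hm' => ?_,
      fun l l' m m' hm hm' => ?_⟩ <;>
      obtain ⟨k, hk, rfl⟩ := abs_le_iff_exists.mp hm <;>
      obtain ⟨k', hk', rfl⟩ := abs_le_iff_exists.mp hm' <;>
      obtain ⟨add_tendsto, sub_expansion⟩ := h l l' k k' hk hk'
    · exact (tendstoUniformly_star_sub_iff hd hne hk hk').mpr sub_expansion.tendsto
    · exact (tendstoUniformly_star_add_iff hd hne hk hk').mpr add_tendsto
    · exact (tendstoUniformly_mul_star_sub_iff hd hne hk hk').mpr sub_expansion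

theorem isPure_iff_basisStar : IsPure W ↔ ∀ l l' k k', k ≤ 2 * l → k' ≤ 2 * l' →
    HasFirstOrderExpansion
      (fun n => basisStar (W n) (d n) l k l' k' + basisStar (W n) (d n) l' k' l k)
      ((2 : ℂ) • (sphereFun 1 (bPoly l k) * sphereFun 1 (bPoly l' k'))) 0 := by
  constructor
  · exact fun h l l' k k' hk hk' => (tendstoUniformly_mul_star_add_sub_iff hd hne hk hk').mp
      (h _ _ _ _ (abs_le_iff_exists.mpr ⟨k, hk, rfl⟩) (abs_le_iff_exists.mpr ⟨k', hk', rfl⟩))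
  · intro h l l' m m' hm hm'
    obtain ⟨k, hk, rfl⟩ := abs_le_iff_exists.mp hm
    obtain ⟨k', hk', rfl⟩ := abs_le_iff_exists.mp hm'
    exact (tendstoUniformly_mul_star_add_sub_iff hd hne hk hk').mpr (h l l' k k' hk hk')

end Characterization

section Sufficiency

theorem pow_mul_pow_mul_self (hs : s * s = 1) (l l' : ℕ) :
    s ^ l * s ^ l' * (s ^ l * s ^ l') = 1 := by
  rw [mul_mul_mul_comm, ← mul_pow, ← mul_pow, hs, one_pow, one_pow, one_mul]

theorem inv_pow_mul_pow (hs : s * s = 1) (l l' : ℕ) : (s ^ l * s ^ l')⁻¹ = s ^ l * s ^ l' :=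
  inv_eq_of_mul_eq_one_left (pow_mul_pow_mul_self hs l l')

theorem pow_mul_pow_ne_zero (hs : s * s = 1) (l l' : ℕ) : s ^ l * s ^ l' ≠ 0 :=
  left_ne_zero_of_mul_eq_one (pow_mul_pow_mul_self hs l l')

theorem sphereFun_lead_basis_mul (s : ℂ) (l k l' k' : ℕ) :
    sphereFun s (lead (basis l k * basis l' k').2) =
      (s ^ l * s ^ l') • (sphereFun 1 (bPoly l k) * sphereFun 1 (bPoly l' k')) := by
  simp only [basis, Prod.snd_mul, lead_mul, lead_mk, map_mul, sphereFun_bPoly s,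
    smul_mul_smul_comm]

theorem sphereFun_next_basis_mul (hs : s * s = 1) (l k l' k' : ℕ) :
    sphereFun s (next (basis l k * basis l' k').2) = (s ^ l * s ^ l') •
      ((s * Complex.I) • sphereFun 1 (poissonPoly (bPoly l k) (bPoly l' k'))) := by
  simp only [basis, Prod.snd_mul, next_mul, lead_mk, next_mk, mul_zero, zero_mul, zero_add,
    map_smul, sphereFun_poissonPoly_bPoly hs, smul_smul]
  ring_nf

variable (hs : s * s = 1) (hd : ∀ n, IsSymbolScale (W n) (d n))

include hs

section Limit

variable (hlim : ∀ l, Tendsto (fun n => d n l) atTop (𝓝 (s ^ l)))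

include hlim

theorem tendsto_inv_mul (l l' : ℕ) :
    Tendsto (fun n => (d n l * d n l')⁻¹) atTop (𝓝 (s ^ l * s ^ l')) :=
  inv_pow_mul_pow hs l l' ▸ ((hlim l).mul (hlim l')).inv₀ (pow_mul_pow_ne_zero hs l l')

include hd

theorem tendsto_basisStar (l k l' k' : ℕ) :
    Tendsto (fun n => basisStar (W n) (d n) l k l' k') atTop
      (𝓝 (sphereFun 1 (bPoly l k) * sphereFun 1 (bPoly l' k'))) := by
  have product_tendsto := tendsto_symbolMap hs hd hlim
    (Expansion.mul_mem (basis_mem l k) (basis_mem l' k'))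
  have scaled_tendsto := (tendsto_inv_mul hs hlim l l').smul product_tendsto
  rwa [sphereFun_lead_basis_mul, smul_smul, pow_mul_pow_mul_self hs, one_smul ℂ]
    at scaled_tendsto

theorem hasFirstOrderExpansion_basisStar_sub (l k l' k' : ℕ) :
    HasFirstOrderExpansion
      (fun n => basisStar (W n) (d n) l k l' k' - basisStar (W n) (d n) l' k' l k) 0
      ((s * (2 * Complex.I)) • sphereFun 1 (poissonPoly (bPoly l k) (bPoly l' k'))) := by
  obtain ⟨c, hc, hlie⟩ := lie_basis_mem_shifted l k l' k'
  have lie_bOp (n : ℕ) : bOp n l k * bOp n l' k' - bOp n l' k' * bOp n l k =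
      (1 / ((n : ℂ) + 1)) • c.1 n :=
    (congrArg (fun a : Expansion => a.1 n) ((invDim_mul c).symm.trans hlie)).symm
  have lead_c : lead c.2 = (2 * Complex.I) • poissonPoly (bPoly l k) (bPoly l' k') := by
    have next_eq := congrArg (fun a : Expansion => next a.2) ((invDim_mul c).symm.trans hlie)
    exact next_eq.trans (next_lie _ _)
  have scaled_tendsto := one_div_add_one_smul_iff (𝕜 := ℂ).mpr
    ((tendsto_inv_mul hs hlim l l').smul (tendsto_symbolMap hs hd hlim hc))
  have limit_eq : (s ^ l * s ^ l') • sphereFun s (lead c.2) =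
      (s * (2 * Complex.I)) • sphereFun 1 (poissonPoly (bPoly l k) (bPoly l' k')) := by
    rw [lead_c, map_smul, sphereFun_poissonPoly_bPoly hs, smul_smul, smul_smul]
    congr 1
    linear_combination (2 * Complex.I * s) * pow_mul_pow_mul_self hs l l'
  rw [limit_eq] at scaled_tendsto
  refine scaled_tendsto.congr' (.of_forall fun n => ?_)
  have symbolMap_mul : symbolMap (W n) (bOp n l k * bOp n l' k') =
      (1 / ((n : ℂ) + 1)) • symbolMap (W n) (c.1 n) +
        symbolMap (W n) (bOp n l' k' * bOp n l k) := by
    rw [← map_smul, ← map_add, ← lie_bOp, sub_add_cancel]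
  simp only [basisStar, symbolMap_mul]
  module

end Limit

include hd

theorem hasFirstOrderExpansion_basisStar
    (hlim : ∀ l, HasFirstOrderExpansion (fun n => d n l) (s ^ l) 0) (l k l' k' : ℕ) :
    HasFirstOrderExpansion (fun n => basisStar (W n) (d n) l k l' k')
      (sphereFun 1 (bPoly l k) * sphereFun 1 (bPoly l' k'))
      ((s * Complex.I) • sphereFun 1 (poissonPoly (bPoly l k) (bPoly l' k'))) := by
  have inv_expansion : HasFirstOrderExpansion (fun n => (d n l * d n l')⁻¹) (s ^ l * s ^ l') 0 := by
    simpa only [inv_pow_mul_pow hs, mul_zero, neg_zero] using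
      ((hlim l).mul_zero_zero (hlim l')).inv₀ (pow_mul_pow_ne_zero hs l l')
  have product_expansion := inv_expansion.smul (hasFirstOrderExpansion_symbolMap hs hd hlim
    (Expansion.mul_mem (basis_mem l k) (basis_mem l' k')))
  rwa [zero_smul ℂ (sphereFun s _), zero_add, sphereFun_lead_basis_mul,
    sphereFun_next_basis_mul hs, smul_smul, smul_smul _ _ (_ • _), pow_mul_pow_mul_self hs,
    one_smul ℂ, one_smul ℂ] at product_expansion

variable (hne : ∀ n l, l ≤ n → d n l ≠ 0)

include hne

theorem isPoissonTypeWithSign_of_tendsto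
    (hlim : ∀ l, Tendsto (fun n => d n l) atTop (𝓝 (s ^ l))) : IsPoissonTypeWithSign s W := by
  refine (isPoissonTypeWithSign_iff_basisStar hd hne).mpr fun l l' k k' _ _ =>
    ⟨?_, hasFirstOrderExpansion_basisStar_sub hs hd hlim l k l' k'⟩
  have add_tendsto :=
    (tendsto_basisStar hs hd hlim l k l' k').add (tendsto_basisStar hs hd hlim l' k' l k)
  rwa [mul_comm (sphereFun 1 (bPoly l' k')), ← two_smul ℂ] at add_tendsto

theorem isPure_of_hasFirstOrderExpansion
    (hlim : ∀ l, HasFirstOrderExpansion (fun n => d n l) (s ^ l) 0) : IsPure W := by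
  refine (isPure_iff_basisStar hd hne).mpr fun l l' k k' _ _ => ?_
  have add_expansion := (hasFirstOrderExpansion_basisStar hs hd hlim l k l' k').add
    (hasFirstOrderExpansion_basisStar hs hd hlim l' k' l k)
  rwa [mul_comm (sphereFun 1 (bPoly l' k')), ← two_smul ℂ, poissonPoly_comm (bPoly l' k'), map_neg,
    smul_neg, add_neg_cancel] at add_expansion

end Sufficiency

section Necessity

/-- The point `(1, 0, 0)` of the sphere, where `x ± iy` take the value `1` and `z` vanishes. -/
def eastPole : S2 := ⟨!₂[1, 0, 0], by simp [EuclideanSpace.norm_eq, Fin.sum_univ_three]⟩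

theorem pt_eastPole : pt eastPole = ![1, 0, 0] := by
  funext k
  fin_cases k <;> simp [pt, eastPole]

theorem sphereFun_bPoly_zero_eastPole (l : ℕ) : sphereFun 1 (bPoly l 0) eastPole = 1 := by
  simp [sphereFun_one_apply, bPoly_zero_right, eval_xplus, pt_eastPole]

theorem sphereFun_bPoly_one_one_eastPole : sphereFun 1 (bPoly 1 1) eastPole = 0 := by
  simp [sphereFun_one_apply, bPoly_one_one, pt_eastPole]

theorem sphereFun_bPoly_one_two_eastPole : sphereFun 1 (bPoly 1 2) eastPole = -2 := by
  simp [sphereFun_one_apply, bPoly_one_two, eval_xminus, pt_eastPole]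

theorem poissonPoly_bPoly_one_one_bPoly_one_zero :
    poissonPoly (bPoly 1 1) (bPoly 1 0) = (2 * Complex.I) • bPoly 1 0 := by
  rw [bPoly_one_one, bPoly_zero_right, pow_one, poissonPoly_smul_left, poissonPoly_z_xplus]
  module

theorem bOp_casimir (n : ℕ) : (1 / 4 : ℂ) • (bOp n 1 1 * bOp n 1 1) -
    (1 / 4 : ℂ) • (bOp n 1 0 * bOp n 1 2 + bOp n 1 2 * bOp n 1 0) =
      (1 - 1 / ((n : ℂ) + 1) ^ 2) • bOp n 0 0 := by
  have Jplus_mul_Jminus : Jplus n * Jminus n = Jminus n * Jplus n + (2 : ℂ) • Jthree n := by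
    rw [← sub_eq_iff_eq_add', ← LieRing.of_associative_ring_bracket, (isSpinTriple_J n).lie_e_f]
    module
  have Jthree_mul_Jthree : Jthree n * Jthree n =
      ((((n : ℂ) + 1) ^ 2 - 1) / 4) • (1 : Op n) - Jminus n * Jplus n - Jthree n := by
    rw [← casimir_J]
    abel
  have hn : (n : ℂ) + 1 ≠ 0 := Nat.cast_add_one_ne_zero n
  simp only [bOp_zero_right, bOp_one_one, bOp_one_two, pow_zero, pow_one, smul_mul_smul_comm,
    Jplus_mul_Jminus, Jthree_mul_Jthree]
  match_scalars <;> field_simp <;> ring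

section Scale

variable {n : ℕ} {W : SymbolCorrespondence n} {d : ℕ → ℂ} (hd : IsSymbolScale W d)

include hd

theorem basisStar_highest_add (l : ℕ) :
    basisStar W d 1 0 l 0 + basisStar W d l 0 1 0 =
      (2 * (d (l + 1) / (d 1 * d l))) • sphereFun 1 (bPoly (l + 1) 0) := by
  simp only [basisStar, bOp_zero_right, ← pow_add]
  rw [add_comm 1 l, ← bOp_zero_right, symbolMap_bOp hd, mul_comm (d l)]
  module

theorem basisStar_one_one_sub :
    basisStar W d 1 1 1 0 - basisStar W d 1 0 1 1 =
      (1 / ((n : ℂ) + 1)) • (-4 * (d 1)⁻¹) • sphereFun 1 (bPoly 1 0) := by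
  have symbolMap_mul : symbolMap W (bOp n 1 1 * bOp n 1 0) =
      (1 / ((n : ℂ) + 1) * (-4 * d 1)) • sphereFun 1 (bPoly 1 0) +
        symbolMap W (bOp n 1 0 * bOp n 1 1) := by
    have lie_bOp : bOp n 1 1 * bOp n 1 0 - bOp n 1 0 * bOp n 1 1 =
        (-4 : ℂ) • (1 / ((n : ℂ) + 1)) • bOp n 1 0 := by
      have lie_basis := congrArg (fun a : Expansion => a.1 n) lie_basis_one_one
      rwa [invDim_mul] at lie_basis
    rw [sub_eq_iff_eq_add.mp lie_bOp, map_add, map_smul, map_smul, symbolMap_bOp hd]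
    module
  simp only [basisStar, symbolMap_mul]
  rw [← div_self_mul_self' (d 1)]
  module

theorem basisStar_casimir (hd0 : d 0 = 1) :
    (1 / 8 : ℂ) • (basisStar W d 1 1 1 1 + basisStar W d 1 1 1 1) -
      (1 / 4 : ℂ) • (basisStar W d 1 0 1 2 + basisStar W d 1 2 1 0) =
        ((1 - 1 / ((n : ℂ) + 1) ^ 2) * (d 1 * d 1)⁻¹) • sphereFun 1 (bPoly 0 0) := by
  have symbolMap_casimir := congrArg (symbolMap W) (bOp_casimir n)
  simp only [map_sub, map_add, map_smul, symbolMap_bOp hd, hd0, one_smul] at symbolMap_casimir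
  rw [mul_comm, mul_smul, ← symbolMap_casimir]
  simp only [basisStar]
  module

end Scale

variable (hd : ∀ n, IsSymbolScale (W n) (d n)) (hne : ∀ n l, l ≤ n → d n l ≠ 0)

include hd hne

theorem tendsto_inv_dipole_of_isPoissonTypeWithSign (hW : IsPoissonTypeWithSign s W) :
    Tendsto (fun n => (d n 1)⁻¹) atTop (𝓝 s) := by
  have bracket := (((isPoissonTypeWithSign_iff_basisStar hd hne).mp hW 1 1 1 0 (by lia)
    (by lia)).2).apply eastPole
  simp only [basisStar_one_one_sub (hd _), poissonPoly_bPoly_one_one_bPoly_one_zero, map_smul,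
    ContinuousMap.smul_apply, sphereFun_bPoly_zero_eastPole] at bracket
  have limit_eq : (s * (2 * Complex.I)) • (2 * Complex.I) • (1 : ℂ) = -4 * s := by
    simp only [smul_eq_mul]
    linear_combination 4 * s * Complex.I_mul_I
  simp only [ContinuousMap.zero_apply, limit_eq] at bracket
  rw [← tendsto_const_smul_iff₀ (show (-4 : ℂ) ≠ 0 by norm_num)]
  simpa only [smul_eq_mul, mul_one] using one_div_add_one_smul_iff.mp bracket

theorem tendsto_dipole_of_isPoissonTypeWithSign (hs : s * s = 1)
    (hW : IsPoissonTypeWithSign s W) : Tendsto (fun n => d n 1) atTop (𝓝 s) := by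
  have inv_tendsto := (tendsto_inv_dipole_of_isPoissonTypeWithSign hd hne hW).inv₀
    (left_ne_zero_of_mul_eq_one hs)
  simpa only [inv_inv, inv_eq_of_mul_eq_one_left hs] using inv_tendsto

omit hd in
theorem eventually_div_mul_cancel (l : ℕ) :
    ∀ᶠ n in atTop, d n (l + 1) / (d n 1 * d n l) * (d n 1 * d n l) = d n (l + 1) := by
  filter_upwards [eventually_ge_atTop 1, eventually_ge_atTop l] with n h1 hl
  exact div_mul_cancel₀ _ (mul_ne_zero (hne n 1 h1) (hne n l hl))

variable (hd0 : ∀ n, d n 0 = 1)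

include hd0

theorem tendsto_of_isPoissonTypeWithSign (hs : s * s = 1) (hW : IsPoissonTypeWithSign s W)
    (l : ℕ) : Tendsto (fun n => d n l) atTop (𝓝 (s ^ l)) := by
  induction l with
  | zero => simpa only [hd0, pow_zero] using tendsto_const_nhds
  | succ l ih =>
    have anticommutator := ((continuous_eval_const eastPole).tendsto _).comp
      ((isPoissonTypeWithSign_iff_basisStar hd hne).mp hW 1 l 0 0 (by lia) (by lia)).1
    simp only [Function.comp_def, basisStar_highest_add (hd _), ContinuousMap.smul_apply,
      ContinuousMap.mul_apply, sphereFun_bPoly_zero_eastPole, smul_eq_mul, mul_one]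
      at anticommutator
    have quotient_tendsto : Tendsto (fun n => d n (l + 1) / (d n 1 * d n l)) atTop (𝓝 1) := by
      rw [← tendsto_const_smul_iff₀ (two_ne_zero (α := ℂ))]
      simpa only [smul_eq_mul, mul_one] using anticommutator
    have product_tendsto := quotient_tendsto.mul
      ((tendsto_dipole_of_isPoissonTypeWithSign hd hne hs hW).mul ih)
    rw [one_mul, ← pow_succ'] at product_tendsto
    exact product_tendsto.congr' (eventually_div_mul_cancel hne l)

theorem hasFirstOrderExpansion_casimir_of_isPure (hW : IsPure W) : HasFirstOrderExpansion
    (fun n => (1 - 1 / ((n : ℂ) + 1) ^ 2) * (d n 1 * d n 1)⁻¹) 1 0 := by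
  rw [isPure_iff_basisStar hd hne] at hW
  have casimir := (((hW 1 1 1 1 (by lia) (by lia)).const_smul (1 / 8 : ℂ)).add
    ((hW 1 1 0 2 (by lia) (by lia)).const_smul (-(1 / 4) : ℂ))).apply eastPole
  simp only [neg_smul, ← sub_eq_add_neg, basisStar_casimir (hd _) (hd0 _),
    ContinuousMap.smul_apply, ContinuousMap.sub_apply, ContinuousMap.mul_apply,
    ContinuousMap.zero_apply, sphereFun_bPoly_zero_eastPole, sphereFun_bPoly_one_one_eastPole,
    sphereFun_bPoly_one_two_eastPole, smul_eq_mul, mul_one, mul_zero, sub_zero] at casimir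
  convert casimir using 1
  norm_num

theorem hasFirstOrderExpansion_dipole_of_isPure (hs : s * s = 1)
    (hlim : Tendsto (fun n => d n 1) atTop (𝓝 s)) (hW : IsPure W) :
    HasFirstOrderExpansion (fun n => d n 1) s 0 := by
  have factor_expansion := one_sub_div_sq (1 : ℂ)
  have inv_expansion : HasFirstOrderExpansion
      (fun n => ((1 - 1 / ((n : ℂ) + 1) ^ 2) * (d n 1 * d n 1)⁻¹)⁻¹) 1 0 := by
    simpa only [inv_one, mul_zero, neg_zero] using
      (hasFirstOrderExpansion_casimir_of_isPure hd hne hd0 hW).inv₀ one_ne_zero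
  have sq_expansion := factor_expansion.mul_zero_zero inv_expansion
  rw [mul_one] at sq_expansion
  refine of_sq ?_ hlim (add_self_eq_zero.not.mpr (left_ne_zero_of_mul_eq_one hs))
  rw [sq, hs]
  refine sq_expansion.congr' ?_
  filter_upwards [factor_expansion.tendsto.eventually_ne one_ne_zero] with n factor_ne_zero
  rw [mul_inv, inv_inv, mul_inv_cancel_left₀ factor_ne_zero, sq]

theorem hasFirstOrderExpansion_of_isPure (hs : s * s = 1)
    (hlim : Tendsto (fun n => d n 1) atTop (𝓝 s))
    (hW : IsPure W) (l : ℕ) : HasFirstOrderExpansion (fun n => d n l) (s ^ l) 0 := by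
  have dipole_expansion := hasFirstOrderExpansion_dipole_of_isPure hd hne hd0 hs hlim hW
  induction l with
  | zero => simpa only [hd0, pow_zero] using .const (1 : ℂ)
  | succ l ih =>
    have anticommutator :=
      (((isPure_iff_basisStar hd hne).mp hW 1 l 0 0 (by lia) (by lia)).apply eastPole).const_smul
        (1 / 2 : ℂ)
    simp only [basisStar_highest_add (hd _), ContinuousMap.smul_apply, ContinuousMap.mul_apply,
      sphereFun_bPoly_zero_eastPole, smul_eq_mul, mul_one] at anticommutator
    have quotient_expansion :
        HasFirstOrderExpansion (fun n => d n (l + 1) / (d n 1 * d n l)) 1 0 := by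
      simpa using anticommutator
    have product_expansion := quotient_expansion.mul_zero_zero (dipole_expansion.mul_zero_zero ih)
    rw [one_mul, ← pow_succ'] at product_expansion
    exact product_expansion.congr' (eventually_div_mul_cancel hne l)

end Necessity

end Twisted

/-! ### Characteristic numbers -/

namespace HasFirstOrderExpansion

theorem prod_range_one_sub_div_sq (l : ℕ) : HasFirstOrderExpansion
    (fun n => ∏ k ∈ Finset.range l, (1 - ((k : ℝ) + 1) ^ 2 / ((n : ℝ) + 1) ^ 2)) 1 0 := by
  induction l with
  | zero => simpa only [Finset.prod_range_zero] using .const (1 : ℝ)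
  | succ l ih =>
    simpa only [Finset.prod_range_succ, mul_one] using
      ih.mul_zero_zero (one_sub_div_sq (((l : ℝ) + 1) ^ 2))

theorem mul_right_iff {𝕜 : Type*} [NormedField 𝕜] [NormedSpace ℝ 𝕜] {u v : ℕ → 𝕜} {a : 𝕜}
    (hv : HasFirstOrderExpansion v 1 0) :
    HasFirstOrderExpansion (fun n => u n * v n) a 0 ↔ HasFirstOrderExpansion u a 0 := by
  refine ⟨fun huv => ?_, fun hu => by simpa only [mul_one] using hu.mul_zero_zero hv⟩
  have inv_expansion : HasFirstOrderExpansion (fun n => (v n)⁻¹) 1 0 := by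
    simpa only [inv_one, mul_zero, neg_zero] using hv.inv₀ one_ne_zero
  have product_expansion := huv.mul_zero_zero inv_expansion
  rw [mul_one] at product_expansion
  refine product_expansion.congr' ?_
  filter_upwards [hv.tendsto.eventually_ne one_ne_zero] with n hn
  exact mul_inv_cancel_right₀ hn (u n)

end HasFirstOrderExpansion

theorem tendsto_ratioNum (l : ℕ) : Tendsto (fun n => ratioNum n l) atTop (𝓝 1) := by
  simpa only [ratioNum, Real.sqrt_one] using
    (HasFirstOrderExpansion.prod_range_one_sub_div_sq l).tendsto.sqrt

theorem hasFirstOrderExpansion_ratioNum (l : ℕ) :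
    HasFirstOrderExpansion (fun n => ratioNum n l) 1 0 := by
  refine .of_sq ?_ (tendsto_ratioNum l) (by norm_num)
  rw [one_pow]
  refine (HasFirstOrderExpansion.prod_range_one_sub_div_sq l).congr' ?_
  filter_upwards [eventually_ge_atTop l] with n hn
  exact (ratioNum_sq hn).symm

section CharacteristicNumbers

variable {C : DeltaPlus → ℝˣ} {W : ∀ n, SymbolCorrespondence n}

theorem charNum_zero (n : ℕ) : charNum C n 0 = 1 := by simp [charNum]

theorem charNum_ne_zero (n l : ℕ) : charNum C n l ≠ 0 := by
  rw [charNum]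
  split_ifs <;> simp

theorem exists_isSymbolScale_of_isSequenceOf (hW : IsSequenceOf W C) : ∃ d : ℕ → ℕ → ℂ,
    (∀ n, IsSymbolScale (W n) (d n)) ∧ (∀ n l, l ≤ n → d n l ≠ 0) ∧ (∀ n, d n 0 = 1) ∧
      ∀ n l, l ≤ n → d n l = (charNum C n l * ratioNum n l : ℝ) := by
  choose d isSymbolScale d_eq using fun n => exists_isSymbolScale (W n) (charNum_zero n) (hW n)
  refine ⟨d, isSymbolScale, fun n l hl => ?_, fun n => ?_, d_eq⟩
  · rw [d_eq n l hl, Complex.ofReal_ne_zero]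
    exact mul_ne_zero (charNum_ne_zero n l) (ratioNum_pos hl).ne'
  · simp [d_eq n 0 (Nat.zero_le n), charNum_zero, ratioNum]

section Scale

variable {d : ℕ → ℕ → ℂ}
  (d_eq : ∀ n l, l ≤ n → d n l = (charNum C n l * ratioNum n l : ℝ)) (s : ℝ) (l : ℕ)

include d_eq

theorem tendsto_scale_iff : Tendsto (fun n => d n l) atTop (𝓝 ((s : ℂ) ^ l)) ↔
    Tendsto (fun n => charNum C n l) atTop (𝓝 (s ^ l)) := by
  rw [← tendsto_mul_iff_of_ne_zero (tendsto_ratioNum l) one_ne_zero, mul_one,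
    ← tendsto_ofReal_iff, Complex.ofReal_pow]
  refine tendsto_congr' ?_
  filter_upwards [eventually_ge_atTop l] with n hn
  exact d_eq n l hn

theorem hasFirstOrderExpansion_scale_iff :
    HasFirstOrderExpansion (fun n => d n l) ((s : ℂ) ^ l) 0 ↔
      HasFirstOrderExpansion (fun n => charNum C n l) (s ^ l) 0 := by
  rw [← (hasFirstOrderExpansion_ratioNum l).mul_right_iff, ← HasFirstOrderExpansion.ofReal_iff,
    Complex.ofReal_pow, Complex.ofReal_zero]
  have eventually_eq :
      (fun n => d n l) =ᶠ[atTop] fun n => ((charNum C n l * ratioNum n l : ℝ) : ℂ) :=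
    (eventually_ge_atTop l).mono fun n hn => d_eq n l hn
  exact ⟨fun h => h.congr' eventually_eq, fun h => h.congr' eventually_eq.symm⟩

end Scale

variable {s : ℝ}

theorem isPoissonTypeWithSign_iff (hW : IsSequenceOf W C) (hs : s * s = 1) :
    IsPoissonTypeWithSign s W ↔
      ∀ l : ℕ, Tendsto (fun n => charNum C n l) atTop (𝓝 (s ^ l)) := by
  have hs : (s : ℂ) * s = 1 := mod_cast hs
  obtain ⟨d, hd, hne, hd0, d_eq⟩ := exists_isSymbolScale_of_isSequenceOf hW
  simp only [← tendsto_scale_iff d_eq]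
  exact ⟨tendsto_of_isPoissonTypeWithSign hd hne hd0 hs,
    isPoissonTypeWithSign_of_tendsto hs hd hne⟩

theorem isPoissonTypeWithSign_and_isPure_iff (hW : IsSequenceOf W C) (hs : s * s = 1) :
    IsPoissonTypeWithSign s W ∧ IsPure W ↔
      ∀ l : ℕ, HasFirstOrderExpansion (fun n => charNum C n l) (s ^ l) 0 := by
  have hs : (s : ℂ) * s = 1 := mod_cast hs
  obtain ⟨d, hd, hne, hd0, d_eq⟩ := exists_isSymbolScale_of_isSequenceOf hW
  simp only [← hasFirstOrderExpansion_scale_iff d_eq]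
  constructor
  · rintro ⟨poisson, pure⟩
    exact hasFirstOrderExpansion_of_isPure hd hne hd0 hs
      (tendsto_dipole_of_isPoissonTypeWithSign hd hne hs poisson) pure
  · exact fun expansion => ⟨isPoissonTypeWithSign_of_tendsto hs hd hne fun l =>
      (expansion l).tendsto, isPure_of_hasFirstOrderExpansion hs hd hne expansion⟩

theorem isPoissonType_iff (hW : IsSequenceOf W C) :
    IsPoissonType W ↔ ∀ l : ℕ, Tendsto (fun n => charNum C n l) atTop (𝓝 1) := by
  simpa only [IsPoissonType, Complex.ofReal_one, one_pow] using
    isPoissonTypeWithSign_iff hW (one_mul (1 : ℝ))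

theorem isAntiPoissonType_iff (hW : IsSequenceOf W C) :
    IsAntiPoissonType W ↔ ∀ l : ℕ, Tendsto (fun n => charNum C n l) atTop (𝓝 ((-1) ^ l)) := by
  simpa only [IsAntiPoissonType, Complex.ofReal_neg, Complex.ofReal_one] using
    isPoissonTypeWithSign_iff hW (neg_mul_neg (1 : ℝ) 1 |>.trans (one_mul 1))

theorem isPurePoissonType_iff (hW : IsSequenceOf W C) : IsPurePoissonType W ↔
    ∀ l : ℕ, Tendsto (fun n : ℕ => (n : ℝ) * (charNum C n l - 1)) atTop (𝓝 0) := by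
  simpa only [IsPurePoissonType, IsPoissonType, Complex.ofReal_one, one_pow,
    HasFirstOrderExpansion, nsmul_eq_mul] using
    isPoissonTypeWithSign_and_isPure_iff hW (one_mul (1 : ℝ))

theorem isPureAntiPoissonType_iff (hW : IsSequenceOf W C) : IsPureAntiPoissonType W ↔
    ∀ l : ℕ, Tendsto (fun n : ℕ => (n : ℝ) * (charNum C n l - (-1) ^ l)) atTop (𝓝 0) := by
  simpa only [IsPureAntiPoissonType, IsAntiPoissonType, Complex.ofReal_neg, Complex.ofReal_one,
    HasFirstOrderExpansion, nsmul_eq_mul] using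
    isPoissonTypeWithSign_and_isPure_iff hW (neg_mul_neg (1 : ℝ) 1 |>.trans (one_mul 1))

theorem not_isPoissonType_of_frequently (hW : IsSequenceOf W C) {s : Set ℝ} (hs : IsClosed s)
    (one_notMem : (1 : ℝ) ∉ s) (hC : ∃ᶠ n in atTop, charNum C n 1 ∈ s) : ¬ IsPoissonType W :=
  fun poisson => hC <|
    ((isPoissonType_iff hW).mp poisson 1).eventually (hs.isOpen_compl.mem_nhds one_notMem)

theorem not_isAntiPoissonType_of_frequently (hW : IsSequenceOf W C) {s : Set ℝ} (hs : IsClosed s)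
    (neg_one_notMem : (-1 : ℝ) ∉ s) (hC : ∃ᶠ n in atTop, charNum C n 1 ∈ s) :
    ¬ IsAntiPoissonType W :=
  fun antiPoisson => hC <| (((isAntiPoissonType_iff hW).mp antiPoisson 1).eventually
    (hs.isOpen_compl.mem_nhds ((pow_one (-1 : ℝ)).symm ▸ neg_one_notMem)))

end CharacteristicNumbers

/-! ### Generic characteristic numbers -/

theorem residual_frequently_mem {ι X : Type*} [TopologicalSpace X] {q : ℕ → ι}
    (hq : Function.Injective q) {s : Set X} (hs : IsOpen s) (hne : s.Nonempty) :
    ∀ᶠ f in residual (ι → X), ∃ᶠ n in atTop, f (q n) ∈ s := by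
  classical
  obtain ⟨x, hx⟩ := hne
  simp only [frequently_atTop]
  refine eventually_countable_forall.mpr fun N => residual_of_dense_open ?_ fun f => ?_
  · simp only [Set.ofPred_exists, Set.ofPred_and]
    exact isOpen_iUnion fun n => isOpen_const.inter (hs.preimage (continuous_apply (q n)))
  · have update_tendsto : Tendsto (fun n => Function.update f (q n) x) atTop (𝓝 f) := by
      refine tendsto_pi_nhds.mpr fun i => tendsto_const_nhds.congr' ?_
      have eventually_ne : ∀ᶠ n in atTop, q n ≠ i :=
        Nat.cofinite_eq_atTop ▸ hq.tendsto_cofinite.eventually (eventually_cofinite_ne i)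
      filter_upwards [eventually_ne] with n hn
      rw [Function.update_of_ne hn.symm]
    refine mem_closure_of_tendsto update_tendsto ?_
    filter_upwards [eventually_ge_atTop N] with n hn
    exact ⟨n, hn, by rwa [Function.update_self]⟩

theorem ae_infinitePi_frequently_mem {ι X : Type*} [MeasurableSpace X] {P : Measure X}
    [IsProbabilityMeasure P] {q : ℕ → ι} (hq : Function.Injective q) {s : Set X}
    (hs : MeasurableSet s) (hPs : P s ≠ 0) :
    ∀ᵐ f ∂Measure.infinitePi (fun _ : ι => P), ∃ᶠ n in atTop, f (q n) ∈ s := by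
  have event_measurable (n : ℕ) : MeasurableSet {f : ι → X | f (q n) ∈ s} :=
    measurable_pi_apply (q n) hs
  have event_measure (n : ℕ) : Measure.infinitePi (fun _ : ι => P) {f | f (q n) ∈ s} = P s :=
    (measurePreserving_eval_infinitePi (fun _ : ι => P) (q n)).measure_preimage
      hs.nullMeasurableSet
  have eval_indep : iIndepFun (fun n (f : ι → X) => f (q n)) (Measure.infinitePi fun _ => P) :=
    (iIndepFun_infinitePi (X := fun _ => id) fun _ => measurable_id).precomp hq
  have event_indep : iIndepSet (fun n => {f : ι → X | f (q n) ∈ s})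
      (Measure.infinitePi fun _ => P) :=
    (iIndepSet_iff_meas_biInter event_measurable).mpr fun t =>
      eval_indep.measure_inter_preimage_eq_mul t fun _ _ => hs
  have limsup_measure := measure_limsup_eq_one event_measurable event_indep <| by
    simpa only [event_measure] using ENNReal.tsum_const_eq_top_of_ne_zero hPs
  have ae_mem := (prob_compl_eq_zero_iff (.measurableSet_limsup event_measurable)).mpr
    limsup_measure
  exact Filter.Eventually.mono ae_mem fun f hf => mem_limsup_iff_frequently_mem.mp hf

/-- The index of the number `c_1^{n+1}`. -/
def dipoleIndex (n : ℕ) : DeltaPlus := ⟨(n + 1, 1), Nat.one_pos, Nat.succ_pos n⟩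

theorem dipoleIndex_injective : Function.Injective dipoleIndex := fun m n h => by
  simpa [dipoleIndex] using h

theorem charNum_dipoleIndex (C : DeltaPlus → ℝˣ) (n : ℕ) :
    charNum C (n + 1) 1 = (C (dipoleIndex n) : ℝ) := by
  simp [charNum, dipoleIndex]

theorem frequently_charNum_mem {C : DeltaPlus → ℝˣ} {s : Set ℝ}
    (hC : ∃ᶠ n in atTop, (C (dipoleIndex n) : ℝ) ∈ s) : ∃ᶠ n in atTop, charNum C n 1 ∈ s :=
  (tendsto_add_atTop_nat 1).frequently (hC.mono fun n hn => charNum_dipoleIndex C n ▸ hn)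

theorem not_isPoissonType_and_not_isAntiPoissonType_of_frequently_two_lt {C : DeltaPlus → ℝˣ}
    {W : ∀ n, SymbolCorrespondence n} (hW : IsSequenceOf W C)
    (hC : ∃ᶠ n in atTop, 2 < (C (dipoleIndex n) : ℝ)) :
    ¬ IsPoissonType W ∧ ¬ IsAntiPoissonType W := by
  have two_le : ∃ᶠ n in atTop, charNum C n 1 ∈ Set.Ici 2 :=
    frequently_charNum_mem (hC.mono fun n hn => hn.le)
  exact ⟨not_isPoissonType_of_frequently hW isClosed_Ici (by norm_num) two_le,
    not_isAntiPoissonType_of_frequently hW isClosed_Ici (by norm_num) two_le⟩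

theorem not_isPoissonType_and_not_isAntiPoissonType_of_frequently_signs {ε : DeltaPlus → ℤˣ}
    {W : ∀ n, SymbolCorrespondence n} (hW : IsSequenceOf W (ofSigns ε))
    (hε : ∀ e, ∃ᶠ n in atTop, ε (dipoleIndex n) = e) :
    ¬ IsPoissonType W ∧ ¬ IsAntiPoissonType W := by
  have charNum_eq (e : ℤˣ) :
      ∃ᶠ n in atTop, charNum (ofSigns ε) n 1 ∈ ({((e : ℤ) : ℝ)} : Set ℝ) :=
    frequently_charNum_mem ((hε e).mono fun n hn => by simp [ofSigns, hn])
  exact ⟨not_isPoissonType_of_frequently hW isClosed_singleton (by norm_num) (charNum_eq (-1)),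
    not_isAntiPoissonType_of_frequently hW isClosed_singleton (by norm_num) (charNum_eq 1)⟩

theorem residual_frequently_two_lt :
    ∀ᶠ C in residual (DeltaPlus → ℝˣ), ∃ᶠ n in atTop, 2 < (C (dipoleIndex n) : ℝ) :=
  residual_frequently_mem dipoleIndex_injective (isOpen_Ioi.preimage Units.continuous_val)
    ⟨Units.mk0 3 (by norm_num), by norm_num⟩

theorem residual_frequently_signs :
    ∀ᶠ ε in residual (DeltaPlus → ℤˣ), ∀ e, ∃ᶠ n in atTop, ε (dipoleIndex n) = e :=
  eventually_all.mpr fun e => residual_frequently_mem dipoleIndex_injective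
    (isOpen_discrete {e}) (Set.singleton_nonempty e)

-- The `σ`-algebra of `ℤˣ` is the one induced by the inclusion in `ℤ`.
theorem measurableSet_singleton_sign (e : ℤˣ) : MeasurableSet ({e} : Set ℤˣ) :=
  ⟨{(e : ℤ)}, MeasurableSet.of_discrete, by ext; simp [Units.ext_iff]⟩

theorem ae_frequently_signs :
    ∀ᵐ ε ∂randomSigns, ∀ e, ∃ᶠ n in atTop, ε (dipoleIndex n) = e := by
  refine ae_all_iff.mpr fun e => ae_infinitePi_frequently_mem dipoleIndex_injective
    (measurableSet_singleton_sign e) ?_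
  rw [PMF.toMeasure_apply_singleton _ _ (measurableSet_singleton_sign e)]
  simp

end SpinSymbol

end

theorem theorem8p2p1 :
    (∀ (C : DeltaPlus → ℝˣ) (W : ∀ n, SymbolCorrespondence n), IsSequenceOf W C →
      (IsPoissonType W ↔
        ∀ l : ℕ, Tendsto (fun n => charNum C n l) atTop (𝓝 1)) ∧
      (IsAntiPoissonType W ↔
        ∀ l : ℕ, Tendsto (fun n => charNum C n l) atTop (𝓝 ((-1) ^ l))) ∧
      (IsPurePoissonType W ↔
        ∀ l : ℕ, Tendsto (fun n : ℕ => (n : ℝ) * (charNum C n l - 1)) atTop (𝓝 0)) ∧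
      (IsPureAntiPoissonType W ↔
        ∀ l : ℕ, Tendsto (fun n : ℕ => (n : ℝ) * (charNum C n l - (-1) ^ l)) atTop (𝓝 0))) ∧
    (∀ᶠ C in residual (DeltaPlus → ℝˣ), ∀ W : ∀ n, SymbolCorrespondence n, IsSequenceOf W C →
      ¬ IsPoissonType W ∧ ¬ IsAntiPoissonType W) ∧
    (∀ᶠ ε in residual (DeltaPlus → ℤˣ), ∀ W : ∀ n, SymbolCorrespondence n,
      IsSequenceOf W (ofSigns ε) → ¬ IsPoissonType W ∧ ¬ IsAntiPoissonType W) ∧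
    (∀ᵐ ε ∂randomSigns, ∀ W : ∀ n, SymbolCorrespondence n,
      IsSequenceOf W (ofSigns ε) → ¬ IsPoissonType W ∧ ¬ IsAntiPoissonType W) := by
  refine ⟨fun C W hW => ⟨isPoissonType_iff hW, isAntiPoissonType_iff hW,
    isPurePoissonType_iff hW, isPureAntiPoissonType_iff hW⟩, ?_, ?_, ?_⟩
  · filter_upwards [residual_frequently_two_lt] with C hC W hW
    exact not_isPoissonType_and_not_isAntiPoissonType_of_frequently_two_lt hW hC
  · filter_upwards [residual_frequently_signs] with ε hε W hW
    exact not_isPoissonType_and_not_isAntiPoissonType_of_frequently_signs hW hε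
  · filter_upwards [ae_frequently_signs] with ε hε W hW
    exact not_isPoissonType_and_not_isAntiPoissonType_of_frequently_signs hW hε
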